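/- **Setting.** Let $n\ge 1$ and $v:2^{[n]}\to\mathbb R$. The Shapley values are $\phi_i=\frac1n\sum_{S\subseteq[n]\setminus\{i\}}\binom{n-1}{|S|}^{-1}\,(v(S\cup\{i\})-v(S))$. Let $w(s)=\big(\binom ns s(n-s)\big)^{-1}$. Let $\mathbf Z$ be the matrix with one row $\sqrt{w(|S|)}\,\mathbf 1_S^\top$ for every $S\subseteq[n]$ with $0<|S|<n$, and let $\mathbf y$ be the vector with entries $\sqrt{w(|S|)}\,(v(S)-v(\emptyset))$. Put $\mathbf P=\mathbf I-\frac1n\mathbf 1\mathbf 1^\top$ and $\mathbf A=\mathbf Z\mathbf P$, and let $\ell_S=\mathbf A_S(\mathbf A^\top\mathbf A)^+\mathbf A_S^\top$ be the leverage scores of the rows of $\mathbf A$. **Leverage SHAP.** Given an integer target $m\ge\max(n,2)$, put $m_0=\min(m,2^n)$ and choose $c$ with $m_0-2=\sum_{s=1}^{n-1}\min\big(1,2c\binom ns^{-1}\big)\binom ns$. Include each complementary pair $\{S,\bar S\}$ with $0<|S|<n$ in the sample independently, with probability $p_S=\min(1,c(\ell_S+\ell_{\bar S}))$. Let $\mathbf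 Z'$ be the matrix whose rows are $\mathbf 1_S^\top$ for the sets $S$ in the sampled pairs, let $\mathbf W$ be the diagonal matrix with entries $w(|S|)/p_S$, and let $\mathbf b'$ be the vector with entries $v(S)-v(\emptyset)-\frac{v([n])-v(\emptyset)}n|S|$. Return $$\tilde{\boldsymbol\phi}=\operatorname*{argmin}_{\mathbf x}\big\|\mathbf W^{1/2}\mathbf Z'\mathbf P\mathbf x-\mathbf W^{1/2}\mathbf b'\big\|_2+\frac{v([n])-v(\emptyset)}n\mathbf 1,$$ where the minimizer of least norm, $(\mathbf M^\top\mathbf M)^+\mathbf M^\top\mathbf W^{1/2}\mathbf b'$ with $\mathbf M=\mathbf W^{1/2}\mathbf Z'\mathbf P$, is taken. **Theorem.** There are absolute constants $C,K>0$ such that the following hold for all $n\ge1$, all $v$ and all integers $m\ge\max(n,2)$. 1. A suitable $c$ exists. Leverage SHAP is executed by one fixed program (the same for all $n,m,v$) of a randomized real RAM (unit-cost integer and exact real arithmetic, comparisons, array access and biased coin flips) that accesses $v$ only by evaluating it at single sets. The evaluated sets are $\emptyset$, $[n]$ and the members of the sampled pairs, each evaluated exactly once. For every such $c$, the multiset of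 evaluated sets and the output of the program have the joint law prescribed above. 2. The expected number of evaluations of $v$ is exactly $\min(m,2^n)\le m$. 3. Not counting the time spent inside the evaluations of $v$, every run takes at most $K(m'+n)n^2$ steps, where $m'$ is the number of evaluations made in that run; the expected number of steps is at most $K\min(m,2^n)\,n^2=O(mn^2)$. 4. The output always satisfies $\langle\tilde{\boldsymbol\phi},\mathbf 1\rangle=v([n])-v(\emptyset)$. 5. For all $\epsilon>0$ and $0<\delta<1$: if $m\ge C\big(n\log\frac n\delta+\frac n{\epsilon\delta}\big)$, then with probability at least $1-\delta$ $$\|\mathbf Z\tilde{\boldsymbol\phi}-\mathbf y\|_2^2\le(1+\epsilon)\,\|\mathbf Z\boldsymbol\phi-\mathbf y\|_2^2 .$$ In particular, for $n\ge2$ a target $m=O\big(n\log\frac n\delta+\frac n{\epsilon\delta}\big)$ suffices for the guarantee in 5. -/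

import Mathlib

open scoped NNReal ENNReal Matrix

noncomputable section

namespace LeverageShap

/-! ### Pseudoinverse, leverage scores, least squares -/

section LinearAlgebra

variable {ρ κ : Type} [Fintype ρ] [Fintype κ]

/-- `B` is a Moore–Penrose inverse of the real matrix `M`. -/
def IsMoorePenrose (M : Matrix ρ κ ℝ) (B : Matrix κ ρ ℝ) : Prop :=
  M * B * M = M ∧ B * M * B = B ∧ (M * B)ᵀ = M * B ∧ (B * M)ᵀ = B * M

theorem exists_isMoorePenrose_of_symm [DecidableEq κ] (H : Matrix κ κ ℝ) (hH : Hᵀ = H) :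
    ∃ B : Matrix κ κ ℝ, IsMoorePenrose H B ∧ Bᵀ = B := by
  have hh : H.IsHermitian := by
    simpa [Matrix.IsHermitian, Matrix.conjTranspose_eq_transpose_of_trivial] using hH
  obtain ⟨U, d, hU, hs⟩ : ∃ (U : Matrix κ κ ℝ) (d : κ → ℝ), Uᵀ * U = 1 ∧
      H = U * Matrix.diagonal d * Uᵀ := by
    refine ⟨hh.eigenvectorUnitary, hh.eigenvalues, ?_, ?_⟩
    · have := Unitary.coe_star_mul_self hh.eigenvectorUnitary
      simpa [Matrix.star_eq_conjTranspose, Matrix.conjTranspose_eq_transpose_of_trivial] using this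
    · have := hh.spectral_theorem
      rw [Unitary.conjStarAlgAut_apply] at this
      simpa [Matrix.star_eq_conjTranspose, Matrix.conjTranspose_eq_transpose_of_trivial,
        Function.comp_def] using this
  have key : ∀ a b : κ → ℝ, (U * Matrix.diagonal a * Uᵀ) * (U * Matrix.diagonal b * Uᵀ)
      = U * Matrix.diagonal (fun i => a i * b i) * Uᵀ := by
    intro a b
    calc _ = U * Matrix.diagonal a * (Uᵀ * U) * Matrix.diagonal b * Uᵀ := by
            simp only [Matrix.mul_assoc]
      _ = _ := by
            rw [hU, Matrix.mul_one, Matrix.mul_assoc U, Matrix.diagonal_mul_diagonal]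
  have symm : ∀ a : κ → ℝ, (U * Matrix.diagonal a * Uᵀ)ᵀ = U * Matrix.diagonal a * Uᵀ := by
    intro a
    simp [Matrix.transpose_mul, Matrix.mul_assoc]
  refine ⟨U * Matrix.diagonal (fun i => (d i)⁻¹) * Uᵀ, ⟨?_, ?_, ?_, ?_⟩, symm _⟩
  · rw [hs, key, key]
    congr 3
    funext i
    exact mul_inv_mul_cancel (d i)
  · rw [hs, key, key]
    congr 3
    funext i
    simpa using mul_inv_mul_cancel (d i)⁻¹
  · rw [hs, key, symm]
  · rw [hs, key, symm]

theorem exists_isMoorePenrose (M : Matrix ρ κ ℝ) : ∃ B, IsMoorePenrose M B := by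
  classical
  obtain ⟨G, ⟨h1, h2, h3, h4⟩, hG⟩ := exists_isMoorePenrose_of_symm (Mᵀ * M) (by simp)
  have hz : M * (1 - G * (Mᵀ * M)) = 0 := by
    rw [← Matrix.conjTranspose_mul_self_eq_zero, Matrix.conjTranspose_eq_transpose_of_trivial,
      Matrix.transpose_mul]
    calc (1 - G * (Mᵀ * M))ᵀ * Mᵀ * (M * (1 - G * (Mᵀ * M)))
        = (1 - G * (Mᵀ * M))ᵀ * (Mᵀ * M - Mᵀ * M * G * (Mᵀ * M)) := by
          simp only [Matrix.mul_assoc, Matrix.mul_sub, Matrix.mul_one]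
      _ = 0 := by rw [h1, sub_self, Matrix.mul_zero]
  have hM : M * G * Mᵀ * M = M := by
    rw [Matrix.mul_sub, Matrix.mul_one, sub_eq_zero] at hz
    simpa only [Matrix.mul_assoc] using hz.symm
  refine ⟨G * Mᵀ, ?_, ?_, ?_, ?_⟩
  · simpa only [Matrix.mul_assoc] using hM
  · calc G * Mᵀ * M * (G * Mᵀ) = (G * (Mᵀ * M) * G) * Mᵀ := by simp only [Matrix.mul_assoc]
      _ = _ := by rw [h2]
  · simp [Matrix.transpose_mul, hG, Matrix.mul_assoc]
  · simpa only [Matrix.mul_assoc] using h4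

/-- The Moore–Penrose pseudoinverse `M⁺` (the four identities determine it uniquely). -/
def pinv (M : Matrix ρ κ ℝ) : Matrix κ ρ ℝ := (exists_isMoorePenrose M).choose

/-- The leverage score `Xᵢ (Xᵀ X)⁺ Xᵢᵀ` of the `i`-th row of `X`. -/
def leverageScore (X : Matrix ρ κ ℝ) (i : ρ) : ℝ := X i ⬝ᵥ (pinv (Xᵀ * X) *ᵥ X i)

/-- The least squares solution `argmin_x ‖M x - b‖₂ = (Mᵀ M)⁺ Mᵀ b`
(the minimizer of least norm when there are several). -/
def leastSquares (M : Matrix ρ κ ℝ) (b : ρ → ℝ) : κ → ℝ := pinv (Mᵀ * M) *ᵥ (Mᵀ *ᵥ b)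

end LinearAlgebra

/-! ### Shapley values and the regression problem -/

section Shapley

variable {n : ℕ}

/-- The Shapley values of the value function `v`. -/
def shapley (v : Finset (Fin n) → ℝ) (i : Fin n) : ℝ :=
  (1 / (n : ℝ)) * ∑ S ∈ (Finset.univ.erase i).powerset,
    (v (insert i S) - v S) / ((n - 1).choose S.card : ℝ)

/-- Row indices: subsets `S` of `[n]` with `0 < |S| < n`. -/
abbrev Row (n : ℕ) : Type := {S : Finset (Fin n) // 0 < S.card ∧ S.card < n}

/-- The complement of a row index. -/
def Row.compl (z : Row n) : Row n :=
  ⟨z.1ᶜ, by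
    have h := z.2
    rw [Finset.card_compl, Fintype.card_fin]
    omega⟩

/-- `w(s) = (binom(n, s) s (n - s))⁻¹`. -/
def weight (n s : ℕ) : ℝ := ((n.choose s : ℝ) * s * ((n : ℝ) - s))⁻¹

/-- The 0/1 indicator vector of a set. -/
def indicator (S : Finset (Fin n)) (i : Fin n) : ℝ := if i ∈ S then 1 else 0

/-- The matrix `Z`. -/
def matZ (n : ℕ) : Matrix (Row n) (Fin n) ℝ :=
  Matrix.of fun z i => √(weight n z.1.card) * indicator z.1 i

/-- The target vector `y`. -/
def vecY (v : Finset (Fin n) → ℝ) (z : Row n) : ℝ := √(weight n z.1.card) * (v z.1 - v ∅)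

/-- The projection `P = I - (1/n) 1 1ᵀ`. -/
def matP (n : ℕ) : Matrix (Fin n) (Fin n) ℝ :=
  1 - (1 / (n : ℝ)) • Matrix.of fun _ _ => (1 : ℝ)

/-- The matrix `A = Z P`. -/
def matA (n : ℕ) : Matrix (Row n) (Fin n) ℝ := matZ n * matP n

/-- The objective `‖Z x - y‖₂²`. -/
def objective (v : Finset (Fin n) → ℝ) (x : Fin n → ℝ) : ℝ :=
  ‖WithLp.toLp 2 (matZ n *ᵥ x - vecY v)‖ ^ 2

end Shapley

/-! ### Paired leverage score sampling without replacement -/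

section Sampling

/-- The random subset of `s` that contains each `a ∈ s` independently with probability `p a`. -/
def bernoulliSubset {α : Type} [DecidableEq α] (s : Finset α) (p : α → ℝ≥0)
    (hp : ∀ a, p a ≤ 1) : PMF (Finset α) :=
  PMF.ofFinset
    (fun T => if T ⊆ s then (((∏ a ∈ T, p a) * ∏ a ∈ s \ T, (1 - p a) : ℝ≥0) : ℝ≥0∞) else 0)
    s.powerset
    (by
      have h : ∑ T ∈ s.powerset, ((∏ a ∈ T, p a) * ∏ a ∈ s \ T, (1 - p a)) = 1 := by
        rw [← Finset.prod_add]
        exact Finset.prod_eq_one fun a _ => add_tsub_cancel_of_le (hp a)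
      refine (Finset.sum_congr rfl fun T hT => if_pos (Finset.mem_powerset.mp hT)).trans ?_
      rw [← ENNReal.ofNNReal_finsetSum, h, ENNReal.coe_one])
    (fun T hT => if_neg fun h => hT (Finset.mem_powerset.mpr h))

variable {n : ℕ}

/-- The set of all pairs `{z, z̄}` of complementary row indices. -/
def pairs (n : ℕ) : Finset (Finset (Row n)) :=
  Finset.univ.image fun z : Row n => {z, z.compl}

/-- The inclusion probability `min(1, c (ℓ_z + ℓ_z̄))` of the pair `{z, z̄}`, where `ℓ` are the
leverage scores of `A`. -/
def inclusionProb (c : ℝ) (B : Finset (Row n)) : ℝ≥0 :=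
  min 1 (c * ∑ z ∈ B, leverageScore (matA n) z).toNNReal

/-- The law of the sampled set of pairs: every pair is included independently. -/
def sampleLaw (n : ℕ) (c : ℝ) : PMF (Finset (Finset (Row n))) :=
  bernoulliSubset (pairs n) (inclusionProb c) fun _ => min_le_left _ _

/-- The oversampling parameter `c` for a number `m` of evaluations: two evaluations are reserved
for `v(∅)` and `v([n])`, and the expected number of sampled rows is `m - 2`. -/
def IsOversampling (n m : ℕ) (c : ℝ) : Prop :=
  (m : ℝ) - 2 = ∑ s ∈ Finset.Ico 1 n, min 1 (2 * c * (n.choose s : ℝ)⁻¹) * (n.choose s : ℝ)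

/-- The rows contained in the sampled pairs. -/
def sampledRows (T : Finset (Finset (Row n))) : Finset (Row n) := T.biUnion id

/-- The sets at which the value function is evaluated. -/
def evaluatedSets (T : Finset (Finset (Row n))) : Finset (Finset (Fin n)) :=
  insert ∅ (insert Finset.univ ((sampledRows T).image Subtype.val))

/-- The rows `zᵀ` of the sampled problem. -/
def sampledZ (T : Finset (Finset (Row n))) : Matrix (sampledRows T) (Fin n) ℝ :=
  Matrix.of fun z i => indicator z.1.1 i

/-- `W^{1/2}`, with `W` the diagonal matrix of weights `w(|z|) / min(1, c (ℓ_z + ℓ_z̄))`. -/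
def sqrtW (c : ℝ) (T : Finset (Finset (Row n))) :
    Matrix (sampledRows T) (sampledRows T) ℝ :=
  Matrix.diagonal fun z => √(weight n z.1.1.card / (inclusionProb c {z.1, z.1.compl} : ℝ))

/-- `b' = y' - ((v([n]) - v(∅)) / n) Z' 1`, where `y'_z = v(z) - v(∅)`. -/
def sampledB (v : Finset (Fin n) → ℝ) (T : Finset (Finset (Row n))) (z : sampledRows T) : ℝ :=
  v z.1.1 - v ∅ - (v Finset.univ - v ∅) / n * (sampledZ T *ᵥ fun _ => 1) z

/-- The Leverage SHAP estimate computed from the sampled set of pairs `T`. -/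
def estimate (v : Finset (Fin n) → ℝ) (c : ℝ) (T : Finset (Finset (Row n))) (i : Fin n) : ℝ :=
  leastSquares (sqrtW c T * sampledZ T * matP n) (sqrtW c T *ᵥ sampledB v T) i
    + (v Finset.univ - v ∅) / n

end Sampling

/-! ### A randomized real RAM with access to a value function

Memory consists of integer arrays and real arrays (finitely many of them are named in a program;
scalars are single array cells). Integer operations, exact real operations, comparisons, array
accesses and coin flips with a given bias cost one step each. The only constants are natural
numbers, reals are never rounded to integers, and the value function is available only through
`query`. A program is one fixed finite text for inputs of all sizes. -/

section Machine

variable {n : ℕ}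

/-- The memory and the counters of a run of a program that has access to a function on the subsets
of `Fin n`. -/
structure State (n : ℕ) where
  /-- cell `i` of integer array `a` -/
  nat : ℕ → ℕ → ℕ
  /-- cell `i` of real array `a` -/
  real : ℕ → ℕ → ℝ
  /-- number of steps so far -/
  time : ℕ
  /-- the queries so far, latest first -/
  queries : List (Finset (Fin n))

/-- Integer expressions. -/
inductive NExp where
  | const (k : ℕ)
  | get (a : ℕ) (i : NExp)
  | add (e f : NExp)
  | sub (e f : NExp)
  | mul (e f : NExp)

/-- Real expressions. -/
inductive RExp where
  | ofNat (e : NExp)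
  | get (a : ℕ) (i : NExp)
  | add (e f : RExp)
  | sub (e f : RExp)
  | mul (e f : RExp)
  | div (e f : RExp)

/-- Tests. -/
inductive BExp where
  | natLt (e f : NExp)
  | natEq (e f : NExp)
  | realLt (e f : RExp)
  | realEq (e f : RExp)

/-- Programs. -/
inductive Cmd where
  | skip
  /-- first `p`, then `q` -/
  | seq (p q : Cmd)
  /-- integer assignment `a[i] := e` -/
  | setNat (a : ℕ) (i e : NExp)
  /-- real assignment `a[i] := e` -/
  | setReal (a : ℕ) (i : NExp) (e : RExp)
  /-- `if b then p else q` -/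
  | ite (b : BExp) (p q : Cmd)
  /-- `for x[0] = 0, …, e - 1 do p`, the value of `e` being taken on entry -/
  | loop (x : ℕ) (e : NExp) (p : Cmd)
  /-- the integer cell `a[i]` becomes 1 with probability `e` (clipped to `[0, 1]`), else 0 -/
  | coin (a : ℕ) (i : NExp) (e : RExp)
  /-- the real cell `a[i]` becomes `v(S)` for the set `S` of all `j` with `b[j] ≠ 0` -/
  | query (a : ℕ) (i : NExp) (b : ℕ)

/-- The number of operations in an expression. -/
def NExp.size : NExp → ℕ
  | .const _ => 1
  | .get _ i => i.size + 1
  | .add e f => e.size + f.size + 1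
  | .sub e f => e.size + f.size + 1
  | .mul e f => e.size + f.size + 1

/-- The value of an expression (subtraction of integers is truncated). -/
def NExp.eval (σ : State n) : NExp → ℕ
  | .const k => k
  | .get a i => σ.nat a (i.eval σ)
  | .add e f => e.eval σ + f.eval σ
  | .sub e f => e.eval σ - f.eval σ
  | .mul e f => e.eval σ * f.eval σ

/-- The number of operations in an expression. -/
def RExp.size : RExp → ℕ
  | .ofNat e => e.size + 1
  | .get _ i => i.size + 1
  | .add e f => e.size + f.size + 1
  | .sub e f => e.size + f.size + 1
  | .mul e f => e.size + f.size + 1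
  | .div e f => e.size + f.size + 1

/-- The value of an expression (division by zero gives zero). -/
def RExp.eval (σ : State n) : RExp → ℝ
  | .ofNat e => (e.eval σ : ℝ)
  | .get a i => σ.real a (i.eval σ)
  | .add e f => e.eval σ + f.eval σ
  | .sub e f => e.eval σ - f.eval σ
  | .mul e f => e.eval σ * f.eval σ
  | .div e f => e.eval σ / f.eval σ

/-- The number of operations in a test. -/
def BExp.size : BExp → ℕ
  | .natLt e f => e.size + f.size + 1
  | .natEq e f => e.size + f.size + 1
  | .realLt e f => e.size + f.size + 1
  | .realEq e f => e.size + f.size + 1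

/-- The truth value of a test. -/
def BExp.eval (σ : State n) : BExp → Prop
  | .natLt e f => e.eval σ < f.eval σ
  | .natEq e f => e.eval σ = f.eval σ
  | .realLt e f => e.eval σ < f.eval σ
  | .realEq e f => e.eval σ = f.eval σ

/-- Charge `k` steps. -/
def State.tick (σ : State n) (k : ℕ) : State n := { σ with time := σ.time + k }

/-- Write to an integer cell. -/
def State.putNat (σ : State n) (a i x : ℕ) : State n :=
  { σ with nat := Function.update σ.nat a (Function.update (σ.nat a) i x) }

/-- Write to a real cell. -/
def State.putReal (σ : State n) (a i : ℕ) (x : ℝ) : State n :=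
  { σ with real := Function.update σ.real a (Function.update (σ.real a) i x) }

/-- The set whose indicator vector is stored in the integer array `b`. -/
def State.readSet (σ : State n) (b : ℕ) : Finset (Fin n) :=
  Finset.univ.filter fun j => σ.nat b j ≠ 0

/-- Run `f 0`, `f 1`, …, `f (k - 1)` in this order. -/
def iterate {α : Type} (f : ℕ → α → PMF α) : ℕ → α → PMF α
  | 0, σ => PMF.pure σ
  | k + 1, σ => (iterate f k σ).bind (f k)

/-- A coin that shows `true` with probability `x`, clipped to `[0, 1]`. -/
def flip (x : ℝ) : PMF Bool :=
  PMF.ofFintype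
    (fun r => ((if r then min 1 x.toNNReal else 1 - min 1 x.toNNReal : ℝ≥0) : ℝ≥0∞))
    (by
      rw [Fintype.sum_bool, ← ENNReal.coe_add]
      simp [add_tsub_cancel_of_le (min_le_left 1 x.toNNReal)])

open Classical in
/-- The law of the state after running a program from a given state, with value function `v`. -/
def Cmd.run (v : Finset (Fin n) → ℝ) : Cmd → State n → PMF (State n)
  | .skip, σ => PMF.pure σ
  | .seq p q, σ => (p.run v σ).bind (q.run v)
  | .setNat a i e, σ =>
      PMF.pure ((σ.putNat a (i.eval σ) (e.eval σ)).tick (i.size + e.size + 1))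
  | .setReal a i e, σ =>
      PMF.pure ((σ.putReal a (i.eval σ) (e.eval σ)).tick (i.size + e.size + 1))
  | .ite b p q, σ =>
      if b.eval σ then p.run v (σ.tick (b.size + 1)) else q.run v (σ.tick (b.size + 1))
  | .loop x e p, σ =>
      iterate (fun k τ => p.run v ((τ.putNat x 0 k).tick 1)) (e.eval σ) (σ.tick (e.size + 1))
  | .coin a i e, σ =>
      (flip (e.eval σ)).map fun r =>
        (σ.putNat a (i.eval σ) (if r then 1 else 0)).tick (i.size + e.size + 1)
  | .query a i b, σ =>
      PMF.pure { (σ.putReal a (i.eval σ) (v (σ.readSet b))).tick (i.size + 1) with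
        queries := σ.readSet b :: σ.queries }

/-- The initial state: cells 0 and 1 of the integer array 0 hold `n` and `m`, all else is zero. -/
def State.init (n m : ℕ) : State n where
  nat := fun a i => if a = 0 ∧ i = 0 then n else if a = 0 ∧ i = 1 then m else 0
  real := fun _ _ => 0
  time := 0
  queries := []

/-- The output: the first `n` cells of the real array 0. -/
def State.output (σ : State n) (i : Fin n) : ℝ := σ.real 0 i

/-- The law of the final state on input `n`, `m` with value function `v`. -/
def Cmd.law (prog : Cmd) (v : Finset (Fin n) → ℝ) (m : ℕ) : PMF (State n) :=
  prog.run v (State.init n m)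

end Machine

/-- The expectation of a nonnegative function. -/
def expect {α : Type} (μ : PMF α) (f : α → ℝ≥0∞) : ℝ≥0∞ := ∑' a, μ a * f a

end LeverageShap

end

/-! Accuracy. Permutations of [n] permute the rows of A, so AᵀA commutes with permutations; it kills
constants, and its trace identifies it as P/n (`sum_weight_centered_mul_centered`, `matA_gram`).
Hence a row of size s has leverage score 1/binom(n,s) (`leverageScore_matA`), and the inclusion
probability of a pair depends only on s. The residual r of the Shapley values satisfies Aᵀr = 0
(`matA_transpose_mulVec_residual`), so by Pythagoras a deviation d with ∑d = 0 costs exactly |d|²/n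
(`objective_eq`). For the estimate, d solves a linear system whose matrix is the sampled Gram matrix
and whose right-hand side is, up to sign, the vector `noise`, a sum of independent terms with total
mean Aᵀr = 0. If n times the sampled Gram matrix is at least 1/4 on sum-zero vectors, the excess is
at most 16n|noise|² (`objective_estimate_le`). The second moment of the noise is at most
objective/(nc) (`bernoulliMean_noise_le`), and Markov's inequality gives the term n/(εδ).

The spectral lower bound is a matrix Chernoff bound with the potential tr(1+H)⁻ᵠ in place of a
matrix exponential. Adding a short random rank one summand decreases the potential, in expectation,
at least as much as adding half the expected summand (`bernoulli_potential_le`). Replacing the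
summands one by one bounds the mean potential by n(2/3)ᵠ, whereas an eigenvalue below 1/4 would
force it above (4/5)ᵠ; with q = ⌊c/2⌋, Markov's inequality gives the term n log(n/δ).

Program. There are too many pairs to flip a coin for each. They are represented by the nonempty
subsets of the first n-1 elements, the leaves of a binary tree. The probability that nothing is
sampled below a node depends only on the number of undecided elements and the size so far, so a
table of about n² numbers suffices to descend the tree while keeping only nodes with a sampled leaf
below (`flip_split`, `levelLaw_succ`). Each row costs constant time per level, then n² for its share
of the normal equations. These are solved in n³ steps by conjugate deflation of the columns of the
Gram matrix (`Deflated.step`), which keeps the solution in the range of that matrix and hence yields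
the one of least norm. The oversampling parameter comes from an explicit water-filling formula.

The law of a run is compared with the mathematical law by couplings (`Couple`); deterministic stages
use a Hoare logic with syntactic framing. Everything is assembled in `couple_leverageShap` and
`holds_leverageShap_time`. -/

open scoped NNReal ENNReal Matrix

noncomputable section

namespace LeverageShap

set_option linter.unusedSectionVars false

/-! ### The potential tr(1+H)⁻ᵠ under rank one changes -/

section Potential

variable {κ : Type} [Fintype κ] [DecidableEq κ]

/-- A single orthogonal matrix serves all exponents, so that quadratic forms of different powers can
be compared in the same coordinates. -/
theorem exists_orthogonal_diagonalization (H : Matrix κ κ ℝ) (hh : H.IsHermitian) :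
    ∃ (U : Matrix κ κ ℝ), Uᵀ * U = 1 ∧
      ∀ k : ℕ, H ^ k = U * Matrix.diagonal (fun i => hh.eigenvalues i ^ k) * Uᵀ := by
  obtain ⟨U, hU, hs⟩ : ∃ (U : Matrix κ κ ℝ), Uᵀ * U = 1 ∧
      H = U * Matrix.diagonal hh.eigenvalues * Uᵀ := by
    refine ⟨hh.eigenvectorUnitary, ?_, ?_⟩
    · have := Unitary.coe_star_mul_self hh.eigenvectorUnitary
      simpa [Matrix.star_eq_conjTranspose, Matrix.conjTranspose_eq_transpose_of_trivial] using this
    · have := hh.spectral_theorem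
      rw [Unitary.conjStarAlgAut_apply] at this
      simpa [Matrix.star_eq_conjTranspose, Matrix.conjTranspose_eq_transpose_of_trivial,
        Function.comp_def] using this
  refine ⟨U, hU, fun k => ?_⟩
  induction k with
  | zero => simp [mul_eq_one_comm.mp hU]
  | succ k ih =>
    have hp : (fun i => hh.eigenvalues i ^ (k + 1)) =
      fun i => hh.eigenvalues i ^ k * hh.eigenvalues i := by ext i; rw [pow_succ]
    rw [pow_succ, ih, hp, ← Matrix.diagonal_mul_diagonal]
    nth_rw 2 [hs]
    calc U * Matrix.diagonal (fun i => hh.eigenvalues i ^ k) * Uᵀ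
          * (U * Matrix.diagonal hh.eigenvalues * Uᵀ)
        = U * Matrix.diagonal (fun i => hh.eigenvalues i ^ k) * (Uᵀ
          * U) * Matrix.diagonal hh.eigenvalues * Uᵀ := by simp only [Matrix.mul_assoc]
      _ = _ := by rw [hU, Matrix.mul_one]; simp only [Matrix.mul_assoc]

/-- The moments `xᵀ Rᵏ x` of a symmetric matrix. -/
def moment (R : Matrix κ κ ℝ) (x : κ → ℝ) (k : ℕ) : ℝ := x ⬝ᵥ (R ^ k *ᵥ x)

/-- The moments are those of a positive measure on the spectrum; the masses are the squared
coordinates of `x` in an eigenbasis. -/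
theorem exists_moment_eq_sum {R : Matrix κ κ ℝ} (hR : R.PosDef) (x : κ → ℝ) :
    ∃ w d : κ → ℝ, (∀ i, 0 ≤ w i) ∧ (∀ i, 0 < d i) ∧ ∀ k, moment R x k = ∑ i, w i * d i ^ k := by
  obtain ⟨U, hU, h⟩ := exists_orthogonal_diagonalization R hR.1
  refine ⟨fun i => (Uᵀ *ᵥ x) i ^ 2, hR.1.eigenvalues, fun i => sq_nonneg _,
    fun i => hR.eigenvalues_pos i, fun k => ?_⟩
  rw [moment, h k, ← Matrix.mulVec_mulVec, ← Matrix.mulVec_mulVec, Matrix.dotProduct_mulVec,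
    ← Matrix.mulVec_transpose]
  simp only [dotProduct, Matrix.mulVec_diagonal]
  exact Finset.sum_congr rfl fun i _ => by ring

theorem moment_nonneg {R : Matrix κ κ ℝ} (hR : R.PosDef) (x : κ → ℝ) (k : ℕ) :
    0 ≤ moment R x k := by
  obtain ⟨w, d, hw, hd, h⟩ := exists_moment_eq_sum hR x
  rw [h]
  exact Finset.sum_nonneg fun i _ => mul_nonneg (hw i) (pow_nonneg (hd i).le k)

/-- Chebyshev's sum inequality for the measure with masses `w i * d i`: the functions `d ^ a` and `d
^ b` increase together, so the symmetrized double sum `key` is nonnegative. -/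
theorem moment_mul_le {R : Matrix κ κ ℝ} (hR : R.PosDef) (x : κ → ℝ) (a b : ℕ) :
    moment R x (a + 1) * moment R x (b + 1) ≤ moment R x 1 * moment R x (a + b + 1) := by
  obtain ⟨w, d, hw, hd, h⟩ := exists_moment_eq_sum hR x
  have key : 0 ≤ ∑ i, ∑ j, (w i * d i) * (w j * d j) *
      ((d i ^ a - d j ^ a) * (d i ^ b - d j ^ b)) := by
    refine Finset.sum_nonneg fun i _ => Finset.sum_nonneg fun j _ => mul_nonneg
      (mul_nonneg (mul_nonneg (hw i) (hd i).le) (mul_nonneg (hw j) (hd j).le)) ?_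
    rcases le_total (d i) (d j) with hij | hij
    · exact mul_nonneg_of_nonpos_of_nonpos
        (sub_nonpos.2 (pow_le_pow_left₀ (hd i).le hij a))
        (sub_nonpos.2 (pow_le_pow_left₀ (hd i).le hij b))
    · exact mul_nonneg
        (sub_nonneg.2 (pow_le_pow_left₀ (hd j).le hij a))
        (sub_nonneg.2 (pow_le_pow_left₀ (hd j).le hij b))
  have e : ∑ i, ∑ j, (w i * d i) * (w j * d j) *
      ((d i ^ a - d j ^ a) * (d i ^ b - d j ^ b)) =
      2 * (moment R x 1 * moment R x (a + b + 1))
        - 2 * (moment R x (a + 1) * moment R x (b + 1)) := by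
    have e1 : moment R x 1 * moment R x (a + b + 1) =
        ∑ i, ∑ j, (w i * d i) * (w j * d j) * d j ^ (a + b) := by
      rw [h, h, Finset.sum_mul_sum]
      exact Finset.sum_congr rfl fun i _ => Finset.sum_congr rfl fun j _ => by ring
    have e2 : moment R x 1 * moment R x (a + b + 1) =
        ∑ i, ∑ j, (w i * d i) * (w j * d j) * d i ^ (a + b) := by
      rw [e1, Finset.sum_comm]
      exact Finset.sum_congr rfl fun i _ => Finset.sum_congr rfl fun j _ => by ring
    have e3 : moment R x (a + 1) * moment R x (b + 1) =
        ∑ i, ∑ j, (w i * d i) * (w j * d j) * (d i ^ a * d j ^ b) := by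
      rw [h, h, Finset.sum_mul_sum]
      exact Finset.sum_congr rfl fun i _ => Finset.sum_congr rfl fun j _ => by ring
    have e4 : moment R x (a + 1) * moment R x (b + 1) =
        ∑ i, ∑ j, (w i * d i) * (w j * d j) * (d j ^ a * d i ^ b) := by
      rw [e3, Finset.sum_comm]
      exact Finset.sum_congr rfl fun i _ => Finset.sum_congr rfl fun j _ => by ring
    rw [two_mul, two_mul]
    nth_rw 1 [e1]
    rw [e2]
    nth_rw 1 [e3]
    rw [e4]
    simp only [← Finset.sum_add_distrib, ← Finset.sum_sub_distrib]
    exact Finset.sum_congr rfl fun i _ => Finset.sum_congr rfl fun j _ => by ring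
  linarith

/-- Telescoping of powers under a rank one change. -/
theorem pow_sub_pow_rankOne {R R' : Matrix κ κ ℝ} {x : κ → ℝ}
    (h : R - R' = R * Matrix.vecMulVec x x * R') (k : ℕ) :
    R ^ k - R' ^ k =
      ∑ l ∈ Finset.range k, R ^ (k - l) * Matrix.vecMulVec x x * R' ^ (l + 1) := by
  induction k with
  | zero => simp
  | succ k ih =>
    have : R ^ (k + 1) - R' ^ (k + 1) = R * (R ^ k - R' ^ k) + (R - R') * R' ^ k := by
      rw [pow_succ' R, pow_succ' R']; noncomm_ring
    rw [this, ih, Finset.sum_range_succ, h, Finset.mul_sum]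
    congr 1
    · refine Finset.sum_congr rfl fun l hl => ?_
      rw [Finset.mem_range] at hl
      rw [show k + 1 - l = (k - l) + 1 by omega, pow_succ' R (k - l)]
      simp only [Matrix.mul_assoc]
    · rw [show k + 1 - k = 1 by omega, pow_one, Matrix.mul_assoc, Matrix.mul_assoc,
        ← pow_succ', ← Matrix.mul_assoc]

theorem dotProduct_mul_vecMulVec_mul (A B : Matrix κ κ ℝ) (x y : κ → ℝ) :
    y ⬝ᵥ ((A * Matrix.vecMulVec x x * B) *ᵥ y) = (y ⬝ᵥ (A *ᵥ x)) * (x ⬝ᵥ (B *ᵥ y)) := by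
  rw [← Matrix.mulVec_mulVec, ← Matrix.mulVec_mulVec, Matrix.vecMulVec_mulVec,
    op_smul_eq_smul, Matrix.mulVec_smul, dotProduct_smul, smul_eq_mul, mul_comm]

/-- Trading powers of `R'` for powers of `R` costs products of moments only. These are nonnegative
for positive definite matrices, so a mixed moment is at most the pure one; the lower bound below
estimates the same products from above. -/
theorem moment_mixed {R R' : Matrix κ κ ℝ} {x : κ → ℝ}
    (h : R - R' = R * Matrix.vecMulVec x x * R') (a j : ℕ) :
    x ⬝ᵥ ((R ^ a * R' ^ j) *ᵥ x) = moment R x (a + j) -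
      ∑ l ∈ Finset.range j, moment R x (a + (j - l)) * moment R' x (l + 1) := by
  have h1 : R ^ a * R' ^ j = R ^ (a + j) - ∑ l ∈ Finset.range j,
      R ^ (a + (j - l)) * Matrix.vecMulVec x x * R' ^ (l + 1) := by
    have := congrArg (R ^ a * ·) (pow_sub_pow_rankOne h j)
    simp only [mul_sub, Finset.mul_sum, ← Matrix.mul_assoc, ← pow_add] at this
    rw [← this]; simp
  rw [h1, Matrix.sub_mulVec, dotProduct_sub, Matrix.sum_mulVec, dotProduct_sum]
  simp only [dotProduct_mul_vecMulVec_mul]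
  rfl

theorem trace_mul_vecMulVec_mul (A B : Matrix κ κ ℝ) (hA : Aᵀ = A) (hB : Bᵀ = B) (x : κ → ℝ) :
    (A * Matrix.vecMulVec x x * B).trace = x ⬝ᵥ ((A * B) *ᵥ x) := by
  rw [Matrix.trace_mul_comm, ← Matrix.mul_assoc, Matrix.mul_vecMulVec, Matrix.trace_vecMulVec,
    dotProduct_comm]
  calc x ⬝ᵥ ((B * A) *ᵥ x) = x ⬝ᵥ ((A * B)ᵀ *ᵥ x) := by rw [Matrix.transpose_mul, hA, hB]
    _ = _ := by rw [Matrix.mulVec_transpose, dotProduct_comm, Matrix.dotProduct_mulVec]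

section RankOne

variable {R R' : Matrix κ κ ℝ} {x : κ → ℝ} (hR : R.PosDef) (hR' : R'.PosDef)
    (h : R - R' = R * Matrix.vecMulVec x x * R')
include hR hR' h

theorem moment_le_of_rankOne (k : ℕ) : moment R' x k ≤ moment R x k := by
  have := moment_mixed h 0 k
  rw [pow_zero, one_mul, zero_add] at this
  change moment R' x k = _ at this
  rw [this, sub_le_self_iff]
  exact Finset.sum_nonneg fun l _ => mul_nonneg (moment_nonneg hR _ _) (moment_nonneg hR' _ _)

/-- The difference telescopes into `q` mixed moments of total order `q + 1`, each at most the pure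
moment. -/
theorem trace_pow_sub_le (q : ℕ) :
    (R ^ q).trace - (R' ^ q).trace ≤ q * moment R x (q + 1) := by
  rw [← Matrix.trace_sub, pow_sub_pow_rankOne h, Matrix.trace_sum]
  refine (Finset.sum_le_card_nsmul _ _ (moment R x (q + 1)) fun l hl => ?_).trans_eq (by simp)
  rw [Finset.mem_range] at hl
  rw [trace_mul_vecMulVec_mul _ _ ?_ ?_, moment_mixed h, show q - l + (l + 1) = q + 1 by omega,
    sub_le_self_iff]
  · exact Finset.sum_nonneg fun l _ => mul_nonneg (moment_nonneg hR _ _) (moment_nonneg hR' _ _)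
  · exact (by simpa using hR.1.pow (q - l) : (R ^ (q - l)).IsSymm)
  · exact (by simpa using hR'.1.pow (l + 1) : (R' ^ (l + 1)).IsSymm)

/-- Each of the `q` mixed moments falls short of the pure one by at most `q` products of moments,
and by monotonicity and Chebyshev each product is at most `moment R x 1 * moment R x (q + 1)`. -/
theorem le_trace_pow_sub (q : ℕ) :
    q * (moment R x (q + 1) * (1 - q * moment R x 1)) ≤ (R ^ q).trace - (R' ^ q).trace := by
  rw [← Matrix.trace_sub, pow_sub_pow_rankOne h, Matrix.trace_sum]
  refine le_trans (le_of_eq (by simp)) (Finset.card_nsmul_le_sum _ _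
    (moment R x (q + 1) * (1 - q * moment R x 1)) fun l hl => ?_)
  rw [Finset.mem_range] at hl
  rw [trace_mul_vecMulVec_mul _ _ ?_ ?_, moment_mixed h, show q - l + (l + 1) = q + 1 by omega]
  · have : ∑ j ∈ Finset.range (l + 1), moment R x (q - l + (l + 1 - j)) * moment R' x (j + 1) ≤
        q * (moment R x 1 * moment R x (q + 1)) := by
      refine (Finset.sum_le_card_nsmul _ _ (moment R x 1 * moment R x (q + 1))
        fun j hj => ?_).trans ?_
      · rw [Finset.mem_range] at hj
        have := moment_mul_le hR x (q - j) j
        rw [show q - j + j + 1 = q + 1 by omega] at this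
        rw [show q - l + (l + 1 - j) = q - j + 1 by omega]
        exact (mul_le_mul_of_nonneg_left (moment_le_of_rankOne hR hR' h _)
          (moment_nonneg hR _ _)).trans this
      · rw [nsmul_eq_mul, Finset.card_range]
        refine mul_le_mul_of_nonneg_right (by exact_mod_cast hl)
          (mul_nonneg (moment_nonneg hR _ _) (moment_nonneg hR _ _))
    linarith
  · exact (by simpa using hR.1.pow (q - l) : (R ^ (q - l)).IsSymm)
  · exact (by simpa using hR'.1.pow (l + 1) : (R' ^ (l + 1)).IsSymm)

end RankOne

/-- The potential `tr (1 + H)⁻ᵠ`. -/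
def potential (q : ℕ) (H : Matrix κ κ ℝ) : ℝ := ((1 + H)⁻¹ ^ q).trace

theorem posDef_one_add {H : Matrix κ κ ℝ} (hH : H.PosSemidef) : (1 + H).PosDef :=
  Matrix.PosDef.one.add_posSemidef hH

theorem posSemidef_add_vecMulVec {H : Matrix κ κ ℝ} (hH : H.PosSemidef) (x : κ → ℝ) :
    (H + Matrix.vecMulVec x x).PosSemidef := by
  refine hH.add ?_
  simpa using Matrix.posSemidef_vecMulVec_self_star x

theorem inv_sub_inv_rankOne {H : Matrix κ κ ℝ} (hH : H.PosSemidef) (x : κ → ℝ) :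
    (1 + H)⁻¹ - (1 + (H + Matrix.vecMulVec x x))⁻¹ =
      (1 + H)⁻¹ * Matrix.vecMulVec x x * (1 + (H + Matrix.vecMulVec x x))⁻¹ := by
  have h1 := (Matrix.isUnit_iff_isUnit_det _).1 (posDef_one_add hH).isUnit
  have h2 := (Matrix.isUnit_iff_isUnit_det _).1
    (posDef_one_add (posSemidef_add_vecMulVec hH x)).isUnit
  set N := 1 + H with hN
  set N' := 1 + (H + Matrix.vecMulVec x x) with hN'
  have : Matrix.vecMulVec x x = N' - N := by rw [hN, hN']; abel
  rw [this, mul_sub, sub_mul, Matrix.nonsing_inv_mul _ h1, one_mul, Matrix.mul_assoc,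
    Matrix.mul_nonsing_inv _ h2, mul_one]

/-- With `z = (1 + H)⁻¹ x` one has `x = z + H z`, and the difference of the two sides is `zᵀHz +
|Hz|²`. -/
theorem moment_one_le {H : Matrix κ κ ℝ} (hH : H.PosSemidef) (x : κ → ℝ) :
    moment (1 + H)⁻¹ x 1 ≤ x ⬝ᵥ x := by
  have h1 := (Matrix.isUnit_iff_isUnit_det _).1 (posDef_one_add hH).isUnit
  set z := (1 + H)⁻¹ *ᵥ x with hz
  have hx : x = z + H *ᵥ z := by
    have : (1 + H) *ᵥ z = x := by
      rw [hz, Matrix.mulVec_mulVec, Matrix.mul_nonsing_inv _ h1, Matrix.one_mulVec]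
    rw [← this, Matrix.add_mulVec, Matrix.one_mulVec]
  have e : moment (1 + H)⁻¹ x 1 = x ⬝ᵥ z := by rw [moment, pow_one]
  have h2 : 0 ≤ z ⬝ᵥ (H *ᵥ z) := by simpa using hH.dotProduct_mulVec_nonneg z
  have h3 : 0 ≤ (H *ᵥ z) ⬝ᵥ (H *ᵥ z) := by simpa using dotProduct_star_self_nonneg (H *ᵥ z)
  rw [e]
  nth_rw 1 [hx]
  rw [hx]
  simp only [add_dotProduct, dotProduct_add]
  rw [dotProduct_comm (H *ᵥ z) z]
  linarith

theorem potential_sub_le (q : ℕ) {H : Matrix κ κ ℝ} (hH : H.PosSemidef) (x : κ → ℝ) :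
    potential q H - potential q (H + Matrix.vecMulVec x x) ≤
      q * moment (1 + H)⁻¹ x (q + 1) :=
  trace_pow_sub_le (posDef_one_add hH).inv (posDef_one_add (posSemidef_add_vecMulVec hH x)).inv
    (inv_sub_inv_rankOne hH x) q

/-- For short vectors the decrease of the potential is at least half its linearization; by
`potential_sub_le` it never exceeds the linearization. -/
theorem le_potential_sub (q : ℕ) {H : Matrix κ κ ℝ} (hH : H.PosSemidef) (x : κ → ℝ)
    (hx : q * (x ⬝ᵥ x) ≤ 1 / 2) :
    1 / 2 * (q * moment (1 + H)⁻¹ x (q + 1)) ≤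
      potential q H - potential q (H + Matrix.vecMulVec x x) := by
  refine le_trans ?_ (le_trace_pow_sub (posDef_one_add hH).inv
    (posDef_one_add (posSemidef_add_vecMulVec hH x)).inv (inv_sub_inv_rankOne hH x) q)
  have h1 := moment_one_le hH x
  have h2 := moment_nonneg (posDef_one_add hH).inv x (q + 1)
  have h3 : (q : ℝ) * moment (1 + H)⁻¹ x 1 ≤ 1 / 2 :=
    (mul_le_mul_of_nonneg_left h1 (Nat.cast_nonneg q)).trans hx
  have h4 : 0 ≤ (q : ℝ) * moment (1 + H)⁻¹ x (q + 1) := mul_nonneg (Nat.cast_nonneg q) h2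
  nlinarith

theorem moment_smul (R : Matrix κ κ ℝ) (a : ℝ) (x : κ → ℝ) (k : ℕ) :
    moment R (a • x) k = a ^ 2 * moment R x k := by
  simp only [moment, Matrix.mulVec_smul, dotProduct_smul, smul_dotProduct, smul_eq_mul]
  ring

theorem vecMulVec_sqrt_smul {a : ℝ} (ha : 0 ≤ a) (x : κ → ℝ) :
    Matrix.vecMulVec (√a • x) (√a • x) = a • Matrix.vecMulVec x x := by
  rw [Matrix.smul_vecMulVec, Matrix.vecMulVec_smul, smul_smul, Real.mul_self_sqrt ha]

theorem posSemidef_add_smul {H : Matrix κ κ ℝ} (hH : H.PosSemidef) {a : ℝ} (ha : 0 ≤ a)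
    (x : κ → ℝ) : (H + a • Matrix.vecMulVec x x).PosSemidef := by
  rw [← vecMulVec_sqrt_smul ha]
  exact posSemidef_add_vecMulVec hH _

/-- One random rank one summand may be replaced by half its expectation. -/
theorem bernoulli_potential_le (q : ℕ) {H : Matrix κ κ ℝ} (hH : H.PosSemidef) (x : κ → ℝ)
    (hx : q * (x ⬝ᵥ x) ≤ 1 / 2) {p : ℝ} (hp : 0 ≤ p) :
    p * potential q (H + Matrix.vecMulVec x x) + (1 - p) * potential q H ≤
      potential q (H + (p / 2) • Matrix.vecMulVec x x) := by
  have h1 := le_potential_sub q hH x hx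
  -- A full summand occurs with probability `p` and gains at least half the linear term; the
  -- deterministic summand with factor `p / 2` gains at most `p / 2` times the linear term.
  have hp2 : 0 ≤ p / 2 := by positivity
  have h2 := potential_sub_le q hH (√(p / 2) • x)
  rw [vecMulVec_sqrt_smul hp2, moment_smul, Real.sq_sqrt hp2] at h2
  nlinarith [mul_le_mul_of_nonneg_left h1 hp]

/-- Cut the summand into `N` equal pieces, each short enough for `le_potential_sub`; every piece
decreases the potential. -/
theorem potential_add_le (q : ℕ) {H : Matrix κ κ ℝ} (hH : H.PosSemidef) (x : κ → ℝ) :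
    potential q (H + Matrix.vecMulVec x x) ≤ potential q H := by
  obtain ⟨N, hN⟩ := exists_nat_ge (2 * (q * (x ⬝ᵥ x)) + 1)
  have hx0 : 0 ≤ x ⬝ᵥ x := by simpa using dotProduct_star_self_nonneg x
  have hN0 : (0 : ℝ) < N := by
    have : 0 ≤ (q : ℝ) * (x ⬝ᵥ x) := by positivity
    linarith
  have hNi : (0 : ℝ) ≤ (N : ℝ)⁻¹ := by positivity
  have step : ∀ k : ℕ, potential q (H + ((k : ℝ) * (N : ℝ)⁻¹) • Matrix.vecMulVec x x) ≤
      potential q H := by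
    intro k
    induction k with
    | zero => simp
    | succ k ih =>
      refine le_trans ?_ ih
      have hH' := posSemidef_add_smul hH (a := (k : ℝ) * (N : ℝ)⁻¹) (by positivity) x
      have h1 := le_potential_sub q hH' (√((N : ℝ)⁻¹) • x) (by
        rw [smul_dotProduct, dotProduct_smul, smul_eq_mul, smul_eq_mul, ← mul_assoc (√_),
          Real.mul_self_sqrt hNi, mul_left_comm, ← div_eq_inv_mul, div_le_iff₀ hN0]
        linarith)
      have h2 := moment_nonneg (posDef_one_add hH').inv (√((N : ℝ)⁻¹) • x) (q + 1)
      rw [vecMulVec_sqrt_smul hNi, add_assoc, ← add_smul] at h1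
      have h3 : ((k + 1 : ℕ) : ℝ) * (N : ℝ)⁻¹ = (k : ℝ) * (N : ℝ)⁻¹ + (N : ℝ)⁻¹ := by
        push_cast; ring
      rw [h3]
      have h4 : 0 ≤ (q : ℝ) * moment (1 + (H + ((k : ℝ) * (N : ℝ)⁻¹) • Matrix.vecMulVec x x))⁻¹
        (√((N : ℝ)⁻¹) • x) (q + 1) := by positivity
      linarith
  have := step N
  rwa [mul_inv_cancel₀ hN0.ne', one_smul] at this

theorem potential_add_smul_le (q : ℕ) {H : Matrix κ κ ℝ} (hH : H.PosSemidef) {a : ℝ} (ha : 0 ≤ a)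
    (x : κ → ℝ) : potential q (H + a • Matrix.vecMulVec x x) ≤ potential q H := by
  rw [← vecMulVec_sqrt_smul ha]
  exact potential_add_le q hH _

/-- A small potential bounds the smallest eigenvalue from below. -/
theorem le_quadratic_of_potential_lt (q : ℕ) {H : Matrix κ κ ℝ} (hH : H.PosSemidef) {t : ℝ}
    (ht : 0 < 1 + t) (h : potential q H < ((1 + t)⁻¹) ^ q) (x : κ → ℝ) :
    t * (x ⬝ᵥ x) ≤ x ⬝ᵥ (H *ᵥ x) := by
  have hN := posDef_one_add hH
  set R := (1 + H)⁻¹ with hRdef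
  have hR : R.PosDef := hN.inv
  obtain ⟨U, hU, hk⟩ := exists_orthogonal_diagonalization R hR.1
  have hpos := fun i => hR.eigenvalues_pos i
  set d := hR.1.eigenvalues with hd
  have htr : potential q H = ∑ i, d i ^ q := by
    rw [potential, ← hRdef, hk q, Matrix.trace_mul_comm, ← Matrix.mul_assoc, hU, Matrix.one_mul,
      Matrix.trace_diagonal]
  -- An eigenvalue of `(1 + H)⁻¹` that is too large would exceed the bound on the trace by itself,
  -- all the other terms being positive.
  have hlt : ∀ i, d i < (1 + t)⁻¹ := by
    intro i
    by_contra hc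
    push Not at hc
    have h1 : ((1 + t)⁻¹) ^ q ≤ d i ^ q := pow_le_pow_left₀ (by positivity) hc q
    have h2 : d i ^ q ≤ ∑ i, d i ^ q :=
      Finset.single_le_sum (f := fun i => d i ^ q) (fun j _ => (pow_pos (hpos j) q).le)
        (Finset.mem_univ i)
    linarith
  have hUU : U * Uᵀ = 1 := mul_eq_one_comm.mp hU
  have hNeq : 1 + H = U * Matrix.diagonal (fun i => (d i)⁻¹) * Uᵀ := by
    have h1 : R * (U * Matrix.diagonal (fun i => (d i)⁻¹) * Uᵀ) = 1 := by
      have := hk 1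
      rw [pow_one] at this
      rw [this]
      calc _ = U * Matrix.diagonal (fun i => d i ^ 1) * (Uᵀ * U) *
            Matrix.diagonal (fun i => (d i)⁻¹) * Uᵀ := by simp only [Matrix.mul_assoc]
        _ = 1 := by
          rw [hU, Matrix.mul_one, Matrix.mul_assoc U, Matrix.diagonal_mul_diagonal]
          have : (fun i => d i ^ 1 * (d i)⁻¹) = fun _ => (1 : ℝ) := by
            ext i; rw [pow_one, mul_inv_cancel₀ (hpos i).ne']
          rw [this, Matrix.diagonal_one, Matrix.mul_one, hUU]
    have h2 : (1 + H) * R = 1 :=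
      Matrix.mul_nonsing_inv _ ((Matrix.isUnit_iff_isUnit_det _).1 hN.isUnit)
    calc 1 + H = (1 + H) * (R * (U * Matrix.diagonal (fun i => (d i)⁻¹) * Uᵀ)) := by
          rw [h1, Matrix.mul_one]
      _ = _ := by rw [← Matrix.mul_assoc, h2, Matrix.one_mul]
  have hx : (1 + t) * (x ⬝ᵥ x) ≤ x ⬝ᵥ ((1 + H) *ᵥ x) := by
    have e1 : x ⬝ᵥ ((1 + H) *ᵥ x) = ∑ i, (Uᵀ *ᵥ x) i ^ 2 * (d i)⁻¹ := by
      rw [hNeq, ← Matrix.mulVec_mulVec, ← Matrix.mulVec_mulVec, Matrix.dotProduct_mulVec,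
        ← Matrix.mulVec_transpose]
      simp only [dotProduct, Matrix.mulVec_diagonal]
      exact Finset.sum_congr rfl fun i _ => by ring
    have e2 : x ⬝ᵥ x = ∑ i, (Uᵀ *ᵥ x) i ^ 2 := by
      calc x ⬝ᵥ x = x ⬝ᵥ ((U * Uᵀ) *ᵥ x) := by rw [hUU, Matrix.one_mulVec]
        _ = _ := by
          rw [← Matrix.mulVec_mulVec, Matrix.dotProduct_mulVec, ← Matrix.mulVec_transpose]
          simp only [dotProduct]
          exact Finset.sum_congr rfl fun i _ => by ring
    rw [e1, e2, Finset.mul_sum]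
    refine Finset.sum_le_sum fun i _ => ?_
    rw [mul_comm]
    refine mul_le_mul_of_nonneg_left ?_ (sq_nonneg _)
    rw [le_inv_comm₀ ht (hpos i)]
    exact (hlt i).le
  rw [Matrix.add_mulVec, Matrix.one_mulVec, dotProduct_add] at hx
  linarith

end Potential

/-! ### Expectations over independent Bernoulli subsets -/

section BernoulliMean

variable {α : Type} [DecidableEq α]

/-- The expectation of `g T` when `T` contains each `a ∈ s` independently with probability `p a`. -/
def bernoulliMean (s : Finset α) (p : α → ℝ) (g : Finset α → ℝ) : ℝ :=
  ∑ T ∈ s.powerset, ((∏ a ∈ T, p a) * ∏ a ∈ s \ T, (1 - p a)) * g T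

theorem bernoulliMean_empty (p : α → ℝ) (g : Finset α → ℝ) : bernoulliMean ∅ p g = g ∅ := by
  simp [bernoulliMean]

/-- Conditions on the presence of `a`; the moment formulas and the Chernoff bound are inductions on
this identity. -/
theorem bernoulliMean_insert {a : α} {s : Finset α} (ha : a ∉ s) (p : α → ℝ)
    (g : Finset α → ℝ) :
    bernoulliMean (insert a s) p g =
      bernoulliMean s p fun T => p a * g (insert a T) + (1 - p a) * g T := by
  rw [bernoulliMean, Finset.sum_powerset_insert ha, bernoulliMean, ← Finset.sum_add_distrib]
  refine Finset.sum_congr rfl fun T hT => ?_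
  rw [Finset.mem_powerset] at hT
  have haT : a ∉ T := fun h => ha (hT h)
  rw [Finset.insert_sdiff_of_notMem _ haT, Finset.prod_insert (by simp [ha]),
    Finset.prod_insert haT, Finset.insert_sdiff_insert, Finset.sdiff_insert_of_notMem ha]
  ring

theorem bernoulliMean_const (s : Finset α) (p : α → ℝ) (c : ℝ) :
    bernoulliMean s p (fun _ => c) = c := by
  induction s using Finset.induction_on with
  | empty => exact bernoulliMean_empty _ _
  | insert a s ha ih =>
    rw [bernoulliMean_insert ha]
    simpa [← add_mul] using ih

theorem bernoulliMean_add (s : Finset α) (p : α → ℝ) (f g : Finset α → ℝ) :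
    bernoulliMean s p (fun T => f T + g T) = bernoulliMean s p f + bernoulliMean s p g := by
  simp [bernoulliMean, mul_add, Finset.sum_add_distrib]

theorem bernoulliMean_const_mul (s : Finset α) (p : α → ℝ) (c : ℝ) (g : Finset α → ℝ) :
    bernoulliMean s p (fun T => c * g T) = c * bernoulliMean s p g := by
  simp only [bernoulliMean, Finset.mul_sum]
  exact Finset.sum_congr rfl fun T _ => by ring

theorem bernoulliMean_sum {ι : Type} (t : Finset ι) (s : Finset α) (p : α → ℝ)
    (g : ι → Finset α → ℝ) :
    bernoulliMean s p (fun T => ∑ i ∈ t, g i T) = ∑ i ∈ t, bernoulliMean s p (g i) := by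
  simp only [bernoulliMean, Finset.mul_sum]
  exact Finset.sum_comm

theorem bernoulliMean_mono {s : Finset α} {p : α → ℝ} (h0 : ∀ a ∈ s, 0 ≤ p a)
    (h1 : ∀ a ∈ s, p a ≤ 1) {f g : Finset α → ℝ} (h : ∀ T ⊆ s, f T ≤ g T) :
    bernoulliMean s p f ≤ bernoulliMean s p g := by
  refine Finset.sum_le_sum fun T hT => ?_
  rw [Finset.mem_powerset] at hT
  exact mul_le_mul_of_nonneg_left (h T hT) (mul_nonneg
    (Finset.prod_nonneg fun a ha => h0 a (hT ha))
    (Finset.prod_nonneg fun a ha => sub_nonneg.2 (h1 a (Finset.mem_sdiff.1 ha).1)))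

/-- The mean of an additive statistic. -/
theorem bernoulliMean_sum_mem (s : Finset α) (p u : α → ℝ) :
    bernoulliMean s p (fun T => ∑ a ∈ T, u a) = ∑ a ∈ s, p a * u a := by
  induction s using Finset.induction_on with
  | empty => simp [bernoulliMean_empty]
  | insert a s ha ih =>
    rw [bernoulliMean_insert ha, Finset.sum_insert ha, ← ih]
    have : bernoulliMean s p (fun T => p a * ∑ b ∈ insert a T, u b + (1 - p a) * ∑ b ∈ T, u b) =
        bernoulliMean s p (fun T => p a * u a + ∑ b ∈ T, u b) := by
      refine Finset.sum_congr rfl fun T hT => ?_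
      rw [Finset.mem_powerset] at hT
      beta_reduce
      rw [Finset.sum_insert fun h => ha (hT h)]
      ring
    rw [this, bernoulliMean_add, bernoulliMean_const]

/-- The second moment of a shifted centered sum. -/
theorem bernoulliMean_sq (s : Finset α) (p u : α → ℝ) (b : ℝ) :
    bernoulliMean s p (fun T => (b + ∑ a ∈ T, u a - ∑ a ∈ s, p a * u a) ^ 2) =
      b ^ 2 + ∑ a ∈ s, p a * (1 - p a) * u a ^ 2 := by
  -- The shift `b` is there for the induction: the centered outcome for the new element, `(1 - p a)
  -- * u a` or `-p a * u a`, is absorbed into it.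
  induction s using Finset.induction_on generalizing b with
  | empty => simp [bernoulliMean_empty]
  | insert a s ha ih =>
    rw [bernoulliMean_insert ha]
    have : bernoulliMean s p (fun T =>
          p a * (b + ∑ c ∈ insert a T, u c - ∑ c ∈ insert a s, p c * u c) ^ 2 +
          (1 - p a) * (b + ∑ c ∈ T, u c - ∑ c ∈ insert a s, p c * u c) ^ 2) =
        bernoulliMean s p (fun T =>
          p a * (b + (1 - p a) * u a + ∑ c ∈ T, u c - ∑ c ∈ s, p c * u c) ^ 2 +
          (1 - p a) * (b - p a * u a + ∑ c ∈ T, u c - ∑ c ∈ s, p c * u c) ^ 2) := by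
      refine Finset.sum_congr rfl fun T hT => ?_
      rw [Finset.mem_powerset] at hT
      beta_reduce
      rw [Finset.sum_insert fun h => ha (hT h), Finset.sum_insert ha]
      ring
    rw [this, bernoulliMean_add, bernoulliMean_const_mul, bernoulliMean_const_mul, ih, ih,
      Finset.sum_insert ha]
    ring

theorem bernoulliSubset_apply (s : Finset α) (p : α → ℝ≥0) (hp : ∀ a, p a ≤ 1) (T : Finset α) :
    bernoulliSubset s p hp T =
      if T ⊆ s then (((∏ a ∈ T, p a) * ∏ a ∈ s \ T, (1 - p a) : ℝ≥0) : ℝ≥0∞) else 0 := rfl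

theorem subset_of_mem_support_bernoulliSubset {s : Finset α} {p : α → ℝ≥0} {hp : ∀ a, p a ≤ 1}
    {T : Finset α} (h : T ∈ (bernoulliSubset s p hp).support) : T ⊆ s := by
  by_contra hc
  rw [PMF.mem_support_iff, bernoulliSubset_apply, if_neg hc] at h
  exact h rfl

theorem expect_bernoulliSubset (s : Finset α) (p : α → ℝ≥0) (hp : ∀ a, p a ≤ 1)
    (g : Finset α → ℝ≥0) :
    expect (bernoulliSubset s p hp) (fun T => (g T : ℝ≥0∞)) =
      ENNReal.ofReal (bernoulliMean s (fun a => (p a : ℝ)) fun T => g T) := by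
  rw [expect, tsum_eq_sum (s := s.powerset)]
  · have : bernoulliMean s (fun a => (p a : ℝ)) (fun T => g T) =
        ((∑ T ∈ s.powerset, ((∏ a ∈ T, p a) * ∏ a ∈ s \ T, (1 - p a)) * g T : ℝ≥0) : ℝ) := by
      rw [bernoulliMean]
      push_cast
      refine Finset.sum_congr rfl fun T _ => ?_
      congr 2
      exact Finset.prod_congr rfl fun a _ => by rw [NNReal.coe_sub (hp a), NNReal.coe_one]
    rw [this, ENNReal.ofReal_coe_nnreal]
    push_cast
    refine Finset.sum_congr rfl fun T hT => ?_
    rw [bernoulliSubset_apply, if_pos (Finset.mem_powerset.1 hT)]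
    push_cast
    rfl
  · intro T hT
    rw [bernoulliSubset_apply, if_neg fun h => hT (Finset.mem_powerset.2 h), zero_mul]

theorem toOuterMeasure_eq_expect {β : Type} (μ : PMF β) (E : Set β) :
    μ.toOuterMeasure E = expect μ (E.indicator fun _ => 1) := by
  rw [PMF.toOuterMeasure_apply, expect]
  refine tsum_congr fun x => ?_
  by_cases h : x ∈ E <;> simp [h]

/-- Markov's inequality for the complement of an event. -/
theorem le_toOuterMeasure_bernoulliSubset (s : Finset α) (p : α → ℝ≥0) (hp : ∀ a, p a ≤ 1)
    (E : Set (Finset α)) (f : Finset α → ℝ) (hf0 : ∀ T ⊆ s, 0 ≤ f T)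
    (hf1 : ∀ T ⊆ s, T ∉ E → 1 ≤ f T) {δ : ℝ}
    (hδ : bernoulliMean s (fun a => (p a : ℝ)) f ≤ δ) :
    ENNReal.ofReal (1 - δ) ≤ (bernoulliSubset s p hp).toOuterMeasure E := by
  classical
  have h1 : E.indicator (fun _ => (1 : ℝ≥0∞)) =
      fun T => ((E.indicator (fun _ => (1 : ℝ≥0)) T : ℝ≥0) : ℝ≥0∞) := by
    funext T
    by_cases h : T ∈ E <;> simp [h]
  rw [toOuterMeasure_eq_expect, h1, expect_bernoulliSubset]
  refine ENNReal.ofReal_le_ofReal ?_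
  -- The indicator of `E` plus `f` is at least 1 everywhere; take means.
  have h2 : (1 : ℝ) ≤ bernoulliMean s (fun a => (p a : ℝ))
      (fun T => ((E.indicator (fun _ => (1 : ℝ≥0)) T : ℝ≥0) : ℝ) + f T) := by
    rw [← bernoulliMean_const s (fun a => (p a : ℝ)) 1]
    refine bernoulliMean_mono (fun a _ => (p a).2) (fun a _ => by exact_mod_cast hp a) ?_
    intro T hT
    by_cases h : T ∈ E
    · simpa [h] using hf0 T hT
    · simpa [h] using hf1 T hT h
  rw [bernoulliMean_add] at h2
  linarith

end BernoulliMean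

/-! ### The matrix Chernoff bound for the lower tail -/

section Chernoff

variable {κ : Type} [Fintype κ] [DecidableEq κ] {α : Type} [DecidableEq α]

/-- A random sum of rank one matrices has, in expectation, no larger potential than half its
expectation. -/
theorem bernoulliMean_potential_le (q : ℕ) (s : Finset α) (p : α → ℝ) (x : α → κ → ℝ)
    (h0 : ∀ a ∈ s, 0 ≤ p a) (h1 : ∀ a ∈ s, p a ≤ 1)
    (hx : ∀ a ∈ s, p a = 1 ∨ q * (x a ⬝ᵥ x a) ≤ 1 / 2)
    {H : Matrix κ κ ℝ} (hH : H.PosSemidef) :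
    bernoulliMean s p (fun T => potential q (H + ∑ a ∈ T, Matrix.vecMulVec (x a) (x a))) ≤
      potential q (H + ∑ a ∈ s, (p a / 2) • Matrix.vecMulVec (x a) (x a)) := by
  induction s using Finset.induction_on generalizing H with
  | empty => simp [bernoulliMean_empty]
  | insert a s ha ih =>
    have hpa := h0 a (Finset.mem_insert_self a s)
    have h0' : ∀ b ∈ s, 0 ≤ p b := fun b hb => h0 b (Finset.mem_insert_of_mem hb)
    have h1' : ∀ b ∈ s, p b ≤ 1 := fun b hb => h1 b (Finset.mem_insert_of_mem hb)
    rw [bernoulliMean_insert ha, Finset.sum_insert ha, ← add_assoc]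
    -- The induction hypothesis is applied at a base point that already contains half the
    -- expectation of the new summand.
    refine le_trans ?_ (ih h0' h1' (fun b hb => hx b (Finset.mem_insert_of_mem hb))
      (posSemidef_add_smul hH (by positivity : 0 ≤ p a / 2) (x a)))
    refine bernoulliMean_mono h0' h1' fun T hT => ?_
    have hpsd : ∀ U : Finset α, (H + ∑ b ∈ U, Matrix.vecMulVec (x b) (x b)).PosSemidef := by
      intro U
      refine hH.add (Matrix.posSemidef_sum _ fun b _ => ?_)
      simpa using Matrix.posSemidef_vecMulVec_self_star (x b)
    have e : H + (p a / 2) • Matrix.vecMulVec (x a) (x a) +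
        ∑ b ∈ T, Matrix.vecMulVec (x b) (x b) =
        H + ∑ b ∈ T, Matrix.vecMulVec (x b) (x b) +
          (p a / 2) • Matrix.vecMulVec (x a) (x a) := by abel
    have e' : H + ∑ b ∈ insert a T, Matrix.vecMulVec (x b) (x b) =
        H + ∑ b ∈ T, Matrix.vecMulVec (x b) (x b) + Matrix.vecMulVec (x a) (x a) := by
      rw [Finset.sum_insert fun h => ha (hT h)]; abel
    rw [e, e']
    -- A summand with probability 1 is not random, and may be long: monotonicity of the potential
    -- suffices for it.
    rcases hx a (Finset.mem_insert_self a s) with hp1 | hsmall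
    · rw [hp1, one_mul, sub_self, zero_mul, add_zero]
      have := potential_add_smul_le q
        (posSemidef_add_smul (hpsd T) (by norm_num : (0 : ℝ) ≤ 1 / 2) (x a))
        (by norm_num : (0 : ℝ) ≤ 1 / 2) (x a)
      rw [add_assoc, ← add_smul] at this
      norm_num at this ⊢
      exact this
    · exact bernoulli_potential_le q (hpsd T) (x a) hsmall hpa

end Chernoff

/-! ### Pseudoinverses and least squares solutions -/

section Pseudoinverse

variable {ρ κ : Type} [Fintype ρ] [Fintype κ]

theorem pinv_spec (M : Matrix ρ κ ℝ) : IsMoorePenrose M (pinv M) := (exists_isMoorePenrose M).choose_spec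

theorem IsMoorePenrose.unique {M : Matrix ρ κ ℝ} {B C : Matrix κ ρ ℝ} (hB : IsMoorePenrose M B)
    (hC : IsMoorePenrose M C) : B = C := by
  obtain ⟨b1, b2, b3, b4⟩ := hB
  obtain ⟨c1, c2, c3, c4⟩ := hC
  have e1 : M * B = M * C := by
    calc M * B = (M * C * M) * B := by rw [c1]
      _ = (M * C)ᵀ * (M * B)ᵀ := by rw [c3, b3, Matrix.mul_assoc (M * C)]
      _ = (M * B * M * C)ᵀ := by rw [← Matrix.transpose_mul, Matrix.mul_assoc (M * B)]
      _ = M * C := by rw [b1, c3]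
  have e2 : B * M = C * M := by
    calc B * M = B * (M * C * M) := by rw [c1]
      _ = (B * M)ᵀ * (C * M)ᵀ := by rw [c4, b4]; simp only [Matrix.mul_assoc]
      _ = (C * (M * B * M))ᵀ := by rw [← Matrix.transpose_mul]; simp only [Matrix.mul_assoc]
      _ = C * M := by rw [b1, c4]
  calc B = B * M * B := b2.symm
    _ = C * (M * B) := by rw [e2, Matrix.mul_assoc]
    _ = C := by rw [e1, ← Matrix.mul_assoc, c2]

theorem pinv_eq {M : Matrix ρ κ ℝ} {B : Matrix κ ρ ℝ} (h : IsMoorePenrose M B) : pinv M = B :=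
  (pinv_spec M).unique h

theorem pinv_transpose_of_symm {H : Matrix κ κ ℝ} (hH : Hᵀ = H) : (pinv H)ᵀ = pinv H := by
  obtain ⟨h1, h2, h3, h4⟩ := pinv_spec H
  refine (pinv_eq ⟨?_, ?_, ?_, ?_⟩).symm
  · have := congrArg Matrix.transpose h1
    simpa [Matrix.transpose_mul, hH, Matrix.mul_assoc] using this
  · have := congrArg Matrix.transpose h2
    simpa [Matrix.transpose_mul, hH, Matrix.mul_assoc] using this
  · rw [Matrix.transpose_mul, Matrix.transpose_transpose, hH]
    rw [Matrix.transpose_mul, hH] at h4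
    exact h4.symm
  · rw [Matrix.transpose_mul, Matrix.transpose_transpose, hH]
    rw [Matrix.transpose_mul, hH] at h3
    exact h3.symm

theorem pinv_mul_self_comm {H : Matrix κ κ ℝ} (hH : Hᵀ = H) : pinv H * H = H * pinv H := by
  have h4 := (pinv_spec H).2.2.2
  rwa [Matrix.transpose_mul, hH, pinv_transpose_of_symm hH, eq_comm] at h4

/-- The matrix `M (1 - G MᵀM)` has zero Gram matrix, hence is zero; transpose. -/
theorem mul_pinv_gram_mul_transpose (M : Matrix ρ κ ℝ) :
    Mᵀ * M * pinv (Mᵀ * M) * Mᵀ = Mᵀ := by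
  classical
  have hs : (Mᵀ * M)ᵀ = Mᵀ * M := by simp
  set G := pinv (Mᵀ * M) with hG
  have h1 : Mᵀ * M * G * (Mᵀ * M) = Mᵀ * M := (pinv_spec _).1
  have hz : M * (1 - G * (Mᵀ * M)) = 0 := by
    rw [← Matrix.conjTranspose_mul_self_eq_zero, Matrix.conjTranspose_eq_transpose_of_trivial,
      Matrix.transpose_mul]
    calc (1 - G * (Mᵀ * M))ᵀ * Mᵀ * (M * (1 - G * (Mᵀ * M)))
        = (1 - G * (Mᵀ * M))ᵀ * (Mᵀ * M - Mᵀ * M * G * (Mᵀ * M)) := by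
          simp only [Matrix.mul_assoc, Matrix.mul_sub, Matrix.mul_one]
      _ = 0 := by rw [h1, sub_self, Matrix.mul_zero]
  rw [Matrix.mul_sub, Matrix.mul_one, sub_eq_zero] at hz
  have := congrArg Matrix.transpose hz
  rw [Matrix.transpose_mul, Matrix.transpose_mul, hs, pinv_transpose_of_symm hs] at this
  exact this.symm

theorem leastSquares_normal (M : Matrix ρ κ ℝ) (b : ρ → ℝ) :
    (Mᵀ * M) *ᵥ leastSquares M b = Mᵀ *ᵥ b := by
  rw [leastSquares, Matrix.mulVec_mulVec, Matrix.mulVec_mulVec, mul_pinv_gram_mul_transpose]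

theorem exists_leastSquares_eq (M : Matrix ρ κ ℝ) (b : ρ → ℝ) :
    ∃ y, leastSquares M b = (Mᵀ * M) *ᵥ y := by
  have hs : (Mᵀ * M)ᵀ = Mᵀ * M := by simp
  refine ⟨pinv (Mᵀ * M) *ᵥ leastSquares M b, ?_⟩
  rw [Matrix.mulVec_mulVec, ← pinv_mul_self_comm hs, ← Matrix.mulVec_mulVec, leastSquares_normal]
  rfl

/-- Membership in the range of the Gram matrix singles out the least norm solution. This certifies
the output of the solver without computing a pseudoinverse. -/
theorem leastSquares_eq_of_normal {M : Matrix ρ κ ℝ} {b : ρ → ℝ} {x y : κ → ℝ}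
    (hx : (Mᵀ * M) *ᵥ x = Mᵀ *ᵥ b) (hy : x = (Mᵀ * M) *ᵥ y) : leastSquares M b = x := by
  have hs : (Mᵀ * M)ᵀ = Mᵀ * M := by simp
  rw [leastSquares, ← hx, hy, Matrix.mulVec_mulVec, Matrix.mulVec_mulVec,
    pinv_mul_self_comm hs, (pinv_spec (Mᵀ * M)).1]

end Pseudoinverse

/-! ### Leverage scores and optimality of the Shapley values -/

section Regression

variable {n : ℕ}

theorem sum_indicator (S : Finset (Fin n)) : ∑ i, indicator S i = S.card := by
  simp [indicator]

/-- The centered indicator vector `P 1_S`. -/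
def centered (S : Finset (Fin n)) (i : Fin n) : ℝ := indicator S i - S.card / n

theorem sum_centered (hn : 1 ≤ n) (S : Finset (Fin n)) : ∑ i, centered S i = 0 := by
  have : (n : ℝ) ≠ 0 := by positivity
  simp only [centered, Finset.sum_sub_distrib, sum_indicator]
  simp only [Finset.sum_const, Finset.card_univ, Fintype.card_fin, nsmul_eq_mul]
  field_simp
  ring

theorem centered_compl (hn : 1 ≤ n) (S : Finset (Fin n)) (i : Fin n) :
    centered Sᶜ i = -centered S i := by
  have h0 : (n : ℝ) ≠ 0 := by positivity
  have h1 : S.card ≤ n := by simpa using S.card_le_univ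
  rw [centered, centered, indicator, indicator, Finset.card_compl, Fintype.card_fin,
    Nat.cast_sub h1]
  by_cases h : i ∈ S <;> simp [h] <;> field_simp <;> ring

theorem sum_centered_sq (hn : 1 ≤ n) (S : Finset (Fin n)) :
    ∑ i, centered S i * centered S i = S.card * (n - S.card) / n := by
  have h0 : (n : ℝ) ≠ 0 := by positivity
  have : ∀ i, centered S i * centered S i =
      indicator S i * (1 - 2 * (S.card / n)) + (S.card / n : ℝ) ^ 2 := by
    intro i
    by_cases h : i ∈ S <;> simp [centered, indicator, h] <;> ring
  simp only [this, Finset.sum_add_distrib, ← Finset.sum_mul, sum_indicator]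
  simp only [Finset.sum_const, Finset.card_univ, Fintype.card_fin, nsmul_eq_mul]
  field_simp
  ring

theorem mul_matP (S : Finset (Fin n)) (a : ℝ) (j : Fin n) :
    ∑ k, a * indicator S k * matP n k j = a * centered S j := by
  have : ∀ k, a * indicator S k * matP n k j =
      (if k = j then a * indicator S k else 0) - a * indicator S k * (1 / n) := by
    intro k
    by_cases h : k = j <;> simp [matP, h] ; ring
  simp only [this, Finset.sum_sub_distrib, ← Finset.sum_mul, ← Finset.mul_sum, sum_indicator]
  simp [centered]
  ring

theorem matA_apply (z : Row n) (j : Fin n) :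
    matA n z j = √(weight n z.1.card) * centered z.1 j := by
  rw [matA, Matrix.mul_apply]
  exact mul_matP _ _ _

theorem weight_nonneg (n s : ℕ) (hs : s ≤ n) : 0 ≤ weight n s := by
  rw [weight]
  have : (s : ℝ) ≤ n := by exact_mod_cast hs
  have : (0 : ℝ) ≤ n - s := by linarith
  positivity

theorem card_le (S : Finset (Fin n)) : S.card ≤ n := by simpa using S.card_le_univ

theorem sum_row_eq_sum_filter (f : Finset (Fin n) → ℝ) :
    ∑ z : Row n, f z.1 = ∑ S with 0 < S.card ∧ S.card < n, f S :=
  (Finset.sum_subtype (Finset.univ.filter fun S : Finset (Fin n) => 0 < S.card ∧ S.card < n)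
    (by simp) f).symm

theorem weight_eq_zero {s : ℕ} (h : ¬(0 < s ∧ s < n)) (hs : s ≤ n) : weight n s = 0 := by
  have : s = 0 ∨ s = n := by omega
  rcases this with rfl | rfl <;> simp [weight]

/-- The weight is 0 at sizes 0 and `n`, since `0⁻¹ = 0`; so the sum extends to all sets, which
permutations act on. -/
theorem sum_row_weight (f : Finset (Fin n) → ℝ) :
    ∑ z : Row n, weight n z.1.card * f z.1 =
      ∑ S : Finset (Fin n), weight n S.card * f S := by
  rw [sum_row_eq_sum_filter fun S => weight n S.card * f S, Finset.sum_filter]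
  refine Finset.sum_congr rfl fun S _ => ?_
  split_ifs with h
  · rfl
  · rw [weight_eq_zero h (card_le S), zero_mul]

theorem sum_row_card (f : ℕ → ℝ) :
    ∑ z : Row n, f z.1.card = ∑ s ∈ Finset.Ico 1 n, n.choose s * f s := by
  rw [sum_row_eq_sum_filter fun S => f S.card, Finset.sum_filter, ← Finset.powerset_univ,
    Finset.sum_powerset_apply_card fun s => if 0 < s ∧ s < n then f s else 0]
  simp only [Finset.card_univ, Fintype.card_fin, nsmul_eq_mul, mul_ite, mul_zero]
  rw [← Finset.sum_filter]
  refine Finset.sum_congr ?_ fun _ _ => rfl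
  ext s
  simp only [Finset.mem_filter, Finset.mem_range, Finset.mem_Ico]
  omega

theorem centered_map (σ : Equiv.Perm (Fin n)) (S : Finset (Fin n)) (i : Fin n) :
    centered (S.map σ.toEmbedding) (σ i) = centered S i := by
  simp [centered, indicator]

theorem sum_perm (σ : Equiv.Perm (Fin n)) (f : Finset (Fin n) → ℝ) :
    ∑ S : Finset (Fin n), f (S.map σ.toEmbedding) = ∑ S, f S :=
  Equiv.sum_comp (Equiv.finsetCongr σ) f

/-- By symmetry the sum is the same for all coordinates, and the coordinates of a centered vector
add up to 0. -/
theorem sum_card_mul_centered (hn : 1 ≤ n) (f : ℕ → ℝ) (i : Fin n) :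
    ∑ S : Finset (Fin n), f S.card * centered S i = 0 := by
  have hconst : ∀ j, ∑ S : Finset (Fin n), f S.card * centered S j =
      ∑ S : Finset (Fin n), f S.card * centered S i := by
    intro j
    rw [← sum_perm (Equiv.swap i j)]
    refine Finset.sum_congr rfl fun S _ => ?_
    have := centered_map (Equiv.swap i j) S i
    rw [Equiv.swap_apply_left] at this
    rw [this, Finset.card_map]
  have hsum : ∑ j, ∑ S : Finset (Fin n), f S.card * centered S j = 0 := by
    rw [Finset.sum_comm]
    simp [← Finset.mul_sum, sum_centered hn]
  simp only [hconst, Finset.sum_const, Finset.card_univ, Fintype.card_fin, nsmul_eq_mul,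
    mul_eq_zero] at hsum
  rcases hsum with h | h
  · norm_cast at h; omega
  · exact h

/-- A permutation invariant matrix has equal diagonal and equal off-diagonal entries. Zero row sums
and the trace determine both; for the trace, each of the `n - 1` sizes contributes exactly `1 / n`.
-/
theorem sum_weight_centered_mul_centered (hn : 1 ≤ n) (i j : Fin n) :
    ∑ S : Finset (Fin n), weight n S.card * (centered S i * centered S j) =
      1 / n * matP n i j := by
  have h0 : (n : ℝ) ≠ 0 := by positivity
  set Q : Fin n → Fin n → ℝ := fun i j =>
    ∑ S : Finset (Fin n), weight n S.card * (centered S i * centered S j) with hQ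
  have perm : ∀ (σ : Equiv.Perm (Fin n)) i j, Q (σ i) (σ j) = Q i j := by
    intro σ i j
    simp only [hQ]
    rw [← sum_perm σ]
    refine Finset.sum_congr rfl fun S _ => ?_
    rw [centered_map, centered_map, Finset.card_map]
  have rowsum : ∀ i, ∑ j, Q i j = 0 := by
    intro i
    simp only [hQ]
    rw [Finset.sum_comm]
    simp [← Finset.mul_sum, sum_centered hn]
  have diag : ∀ i j, Q i i = Q j j := by
    intro i j
    have := perm (Equiv.swap i j) i i
    rw [Equiv.swap_apply_left] at this
    exact this.symm
  have off : ∀ i j k, i ≠ j → i ≠ k → Q i j = Q i k := by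
    intro i j k hj hk
    have := perm (Equiv.swap j k) i j
    rw [Equiv.swap_apply_left, Equiv.swap_apply_of_ne_of_ne hj hk] at this
    exact this.symm
  have trace : ∑ i, Q i i = ((n : ℝ) - 1) / n := by
    simp only [hQ]
    rw [Finset.sum_comm]
    simp only [← Finset.mul_sum, sum_centered_sq hn]
    rw [← sum_row_weight fun S => S.card * ((n : ℝ) - S.card) / n,
      sum_row_card fun s => weight n s * (s * ((n : ℝ) - s) / n)]
    have : ∀ s ∈ Finset.Ico 1 n, (n.choose s : ℝ) * (weight n s * (s * ((n : ℝ) - s) / n)) =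
        1 / n := by
      intro s hs
      rw [Finset.mem_Ico] at hs
      have h1 : (n.choose s : ℝ) ≠ 0 := by exact_mod_cast (Nat.choose_pos hs.2.le).ne'
      have h2 : (s : ℝ) ≠ 0 := by norm_cast; omega
      have h3 : (n : ℝ) - s ≠ 0 := by
        rw [sub_ne_zero]; norm_cast; omega
      rw [weight]
      field_simp
    rw [Finset.sum_congr rfl this]
    simp [Nat.cast_sub hn]
    ring
  have hd : ∀ i, (n : ℝ) * Q i i = ((n : ℝ) - 1) / n := by
    intro i
    rw [← trace, Finset.sum_congr rfl fun j _ => diag j i]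
    simp
  change Q i j = _
  by_cases hij : i = j
  · subst hij
    have := hd i
    simp only [matP, Matrix.sub_apply, Matrix.one_apply_eq, Matrix.smul_apply, Matrix.of_apply,
      smul_eq_mul, mul_one]
    field_simp
    field_simp at this
    linarith
  · have h1 := rowsum i
    rw [← Finset.add_sum_erase _ _ (Finset.mem_univ i)] at h1
    rw [Finset.sum_congr rfl fun k hk => off i k j (Finset.ne_of_mem_erase hk).symm hij] at h1
    simp only [Finset.sum_const, Finset.card_erase_of_mem (Finset.mem_univ i), Finset.card_univ,
      Fintype.card_fin, nsmul_eq_mul, Nat.cast_sub hn, Nat.cast_one] at h1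
    have h2 := hd i
    have hn2 : (n : ℝ) - 1 ≠ 0 := by
      rw [sub_ne_zero]
      intro h
      have hn1 : n = 1 := by exact_mod_cast h
      subst hn1
      exact hij (Subsingleton.elim i j)
    have h3 : ((n : ℝ) - 1) * (Q i j + 1 / n ^ 2) = 0 := by
      have : Q i i = ((n : ℝ) - 1) / n ^ 2 := by
        field_simp; field_simp at h2; linarith
      rw [this] at h1
      rw [← h1]; ring
    have h4 := (mul_eq_zero.1 h3).resolve_left hn2
    simp only [matP, Matrix.sub_apply, Matrix.one_apply_ne hij, Matrix.smul_apply, Matrix.of_apply,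
      smul_eq_mul, mul_one]
    have : Q i j = -(1 / n ^ 2) := by linarith
    rw [this]
    ring

theorem matA_gram (hn : 1 ≤ n) : (matA n)ᵀ * matA n = (1 / n : ℝ) • matP n := by
  ext i j
  rw [Matrix.mul_apply, Matrix.smul_apply, smul_eq_mul, ← sum_weight_centered_mul_centered hn,
    ← sum_row_weight fun S => centered S i * centered S j]
  refine Finset.sum_congr rfl fun z _ => ?_
  rw [Matrix.transpose_apply, matA_apply, matA_apply]
  have := Real.mul_self_sqrt (weight_nonneg n z.1.card (card_le z.1))
  linear_combination (centered z.1 i * centered z.1 j) * this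

theorem matP_mulVec (n : ℕ) (x : Fin n → ℝ) (i : Fin n) :
    (matP n *ᵥ x) i = x i - (∑ j, x j) / n := by
  rw [matP, Matrix.sub_mulVec, Matrix.one_mulVec, Matrix.smul_mulVec]
  simp [Matrix.mulVec, dotProduct]
  ring

theorem matP_mulVec_of_sum_eq_zero {x : Fin n → ℝ} (h : ∑ j, x j = 0) : matP n *ᵥ x = x := by
  ext i; rw [matP_mulVec, h]; simp

theorem sum_matP_mulVec (hn : 1 ≤ n) (x : Fin n → ℝ) : ∑ i, (matP n *ᵥ x) i = 0 := by
  have h0 : (n : ℝ) ≠ 0 := by positivity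
  simp only [matP_mulVec, Finset.sum_sub_distrib, Finset.sum_const, Finset.card_univ,
    Fintype.card_fin, nsmul_eq_mul]
  field_simp
  ring

theorem matP_transpose (n : ℕ) : (matP n)ᵀ = matP n := by
  ext i j
  simp [matP, Matrix.one_apply, eq_comm]

theorem matP_mul_self (hn : 1 ≤ n) : matP n * matP n = matP n := by
  refine Matrix.ext_of_mulVec_single fun i => ?_
  rw [← Matrix.mulVec_mulVec]
  exact matP_mulVec_of_sum_eq_zero (sum_matP_mulVec hn _)

theorem pinv_matA_gram (hn : 1 ≤ n) : pinv ((matA n)ᵀ * matA n) = (n : ℝ) • matP n := by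
  have h0 : (n : ℝ) ≠ 0 := by positivity
  rw [matA_gram hn]
  refine pinv_eq ⟨?_, ?_, ?_, ?_⟩ <;>
    simp [matP_mul_self hn, matP_transpose, smul_smul, h0]

/-- The pseudoinverse acts on a row as multiplication by `n`, so the score is `n` times the squared
row norm; the factor `s (n - s)` of that norm cancels against the weight. -/
theorem leverageScore_matA (hn : 1 ≤ n) (z : Row n) :
    leverageScore (matA n) z = (n.choose z.1.card : ℝ)⁻¹ := by
  have h0 : (n : ℝ) ≠ 0 := by positivity
  have hrow : matA n z = √(weight n z.1.card) • centered z.1 := by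
    ext j; rw [matA_apply]; rfl
  rw [leverageScore, pinv_matA_gram hn, hrow, Matrix.smul_mulVec, Matrix.mulVec_smul,
    matP_mulVec_of_sum_eq_zero (sum_centered hn _)]
  simp only [smul_dotProduct, dotProduct_smul, smul_eq_mul]
  rw [dotProduct, sum_centered_sq hn]
  have h2 : (z.1.card : ℝ) ≠ 0 := by exact_mod_cast z.2.1.ne'
  have h3 : (n : ℝ) - z.1.card ≠ 0 := by
    rw [sub_ne_zero]; exact_mod_cast z.2.2.ne'
  have h1 : (n.choose z.1.card : ℝ) ≠ 0 := by exact_mod_cast (Nat.choose_pos z.2.2.le).ne'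
  have hw := Real.mul_self_sqrt (weight_nonneg n z.1.card (card_le z.1))
  calc _ = √(weight n z.1.card) * √(weight n z.1.card) * (z.1.card * (n - z.1.card)) := by
        field_simp
    _ = _ := by
      rw [hw, weight]
      field_simp

/-- Both sides are linear in `v`; the coefficients are compared for `S` and `insert i S` with `i ∉
S`. The sets ∅ and [n] have weight 0, and the last term supplies their coefficients. -/
theorem shapley_eq (hn : 1 ≤ n) (v : Finset (Fin n) → ℝ) (i : Fin n) :
    shapley v i = n * ∑ z : Row n, weight n z.1.card * (centered z.1 i * v z.1) +
      (v Finset.univ - v ∅) / n := by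
  have h0 : (n : ℝ) ≠ 0 := by positivity
  have hi : i ∉ Finset.univ.erase i := Finset.notMem_erase i _
  have hU : (Finset.univ : Finset (Fin n)) = insert i (Finset.univ.erase i) :=
    (Finset.insert_erase (Finset.mem_univ i)).symm
  have hpow : (Finset.univ : Finset (Finset (Fin n))) =
      (insert i (Finset.univ.erase i)).powerset := by rw [← hU, Finset.powerset_univ]
  rw [sum_row_weight fun S => centered S i * v S, hpow, Finset.sum_powerset_insert hi,
    ← Finset.sum_add_distrib, shapley]
  have key : ∀ S ∈ (Finset.univ.erase i).powerset,
      1 / (n : ℝ) * ((v (insert i S) - v S) / ((n - 1).choose S.card : ℝ)) =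
      n * (weight n S.card * (centered S i * v S) +
        weight n (insert i S).card * (centered (insert i S) i * v (insert i S))) +
      ((if S = Finset.univ.erase i then v Finset.univ / n else 0) -
        (if S = ∅ then v ∅ / n else 0)) := by
    intro S hS
    rw [Finset.mem_powerset] at hS
    have hiS : i ∉ S := fun h => hi (hS h)
    have hcard : S.card ≤ n - 1 := by
      have := Finset.card_le_card hS
      simpa using this
    have hc0 : ((n - 1).choose S.card : ℝ) ≠ 0 := by
      exact_mod_cast (Nat.choose_pos hcard).ne'
    have e1 : -(1 / (n : ℝ)) / ((n - 1).choose S.card : ℝ) =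
        n * (weight n S.card * centered S i) - if S = ∅ then 1 / (n : ℝ) else 0 := by
      by_cases hS0 : S = ∅
      · subst hS0; simp [weight]
      · have hs : 0 < S.card := Finset.card_pos.2 (Finset.nonempty_iff_ne_empty.2 hS0)
        have hs0 : (S.card : ℝ) ≠ 0 := by exact_mod_cast hs.ne'
        have hch : (n.choose S.card : ℝ) * ((n : ℝ) - S.card) =
            n * ((n - 1).choose S.card : ℝ) := by
          have := Nat.choose_mul_succ_eq (n - 1) S.card
          rw [show n - 1 + 1 = n by omega] at this
          rw [← Nat.cast_sub (by omega)]
          norm_cast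
          rw [← this, mul_comm]
        have hns : (n : ℝ) - S.card ≠ 0 := by
          rw [sub_ne_zero]; norm_cast; omega
        have hcn : (n.choose S.card : ℝ) ≠ 0 := by
          exact_mod_cast (Nat.choose_pos (by omega)).ne'
        simp only [hS0, if_false, sub_zero, weight, centered, indicator, hiS]
        field_simp
        linear_combination -(S.card : ℝ) * hch
    have e2 : (1 / (n : ℝ)) / ((n - 1).choose S.card : ℝ) =
        n * (weight n (S.card + 1) * centered (insert i S) i) +
          if S = Finset.univ.erase i then 1 / (n : ℝ) else 0 := by
      by_cases hS1 : S = Finset.univ.erase i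
      · have : S.card = n - 1 := by simp [hS1]
        rw [if_pos hS1, this, show n - 1 + 1 = n by omega, weight, Nat.choose_self, sub_self,
          mul_zero, inv_zero, zero_mul, mul_zero, zero_add, Nat.cast_one, div_one]
      · have hlt : S.card < n - 1 := by
          have := Finset.card_lt_card (hS.ssubset_of_ne hS1)
          simpa using this
        have hch : (n.choose (S.card + 1) : ℝ) * ((S.card : ℝ) + 1) =
            n * ((n - 1).choose S.card : ℝ) := by
          have := Nat.add_one_mul_choose_eq (n - 1) S.card
          rw [show n - 1 + 1 = n by omega] at this
          exact_mod_cast this.symm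
        have hns : (n : ℝ) - ((S.card : ℝ) + 1) ≠ 0 := by
          rw [sub_ne_zero]; norm_cast; omega
        have hcn : (n.choose (S.card + 1) : ℝ) ≠ 0 := by
          exact_mod_cast (Nat.choose_pos (by omega)).ne'
        have hs1 : (S.card : ℝ) + 1 ≠ 0 := Nat.cast_add_one_ne_zero _
        simp only [hS1, if_false, weight, centered, indicator, Finset.mem_insert_self, if_true,
          Finset.card_insert_of_notMem hiS, Nat.cast_add, Nat.cast_one, add_zero]
        field_simp
        linarith
    have e3 : 1 / (n : ℝ) * ((v (insert i S) - v S) / ((n - 1).choose S.card : ℝ)) =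
        (1 / (n : ℝ)) / ((n - 1).choose S.card : ℝ) * v (insert i S) +
        -(1 / (n : ℝ)) / ((n - 1).choose S.card : ℝ) * v S := by ring
    rw [e3, e1, e2, Finset.card_insert_of_notMem hiS]
    by_cases hS0 : S = ∅ <;> by_cases hS1 : S = Finset.univ.erase i
    · have h1 : v Finset.univ = v (insert i S) := by rw [hS1, ← hU]
      rw [if_pos hS0, if_pos hS1, if_pos hS0, if_pos hS1, h1, hS0]; ring
    · rw [if_pos hS0, if_neg hS1, if_pos hS0, if_neg hS1, hS0]; ring
    · have h1 : v Finset.univ = v (insert i S) := by rw [hS1, ← hU]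
      rw [if_neg hS0, if_pos hS1, if_neg hS0, if_pos hS1, h1]; ring
    · simp only [if_neg hS0, if_neg hS1]; ring
  rw [Finset.mul_sum, Finset.sum_congr rfl key, Finset.sum_add_distrib, ← Finset.mul_sum,
    Finset.sum_sub_distrib]
  simp
  ring

theorem sum_shapley (hn : 1 ≤ n) (v : Finset (Fin n) → ℝ) :
    ∑ i, shapley v i = v Finset.univ - v ∅ := by
  have h0 : (n : ℝ) ≠ 0 := by positivity
  simp only [shapley_eq hn, Finset.sum_add_distrib, ← Finset.mul_sum]
  rw [Finset.sum_comm]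
  simp only [← Finset.mul_sum, ← Finset.sum_mul, sum_centered hn]
  simp
  field_simp

/-- The residual of the Shapley values in the regression problem. -/
def residual (v : Finset (Fin n) → ℝ) (z : Row n) : ℝ := (matZ n *ᵥ shapley v - vecY v) z

/-- The Shapley values solve the constrained least squares problem. -/
theorem matA_transpose_mulVec_residual (hn : 1 ≤ n) (v : Finset (Fin n) → ℝ) :
    (matA n)ᵀ *ᵥ residual v = 0 := by
  have h0 : (n : ℝ) ≠ 0 := by positivity
  ext i
  set α := (v Finset.univ - v ∅) / n with hα
  set β : Fin n → ℝ := fun j => n * ∑ z : Row n, weight n z.1.card * (centered z.1 j * v z.1)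
    with hβ
  have hβ0 : ∑ j, β j = 0 := by
    have := sum_shapley hn v
    have hs : ∀ j, shapley v j = β j + α := fun j => shapley_eq hn v j
    simp only [hs, Finset.sum_add_distrib, Finset.sum_const, Finset.card_univ, Fintype.card_fin,
      nsmul_eq_mul, hα, mul_div_cancel₀ _ h0] at this
    linarith
  have hZ : ∀ z : Row n, residual v z = √(weight n z.1.card) *
      (∑ j, centered z.1 j * β j + α * z.1.card - (v z.1 - v ∅)) := by
    intro z
    have hs : ∀ j, shapley v j = β j + α := fun j => shapley_eq hn v j
    rw [residual, Pi.sub_apply, vecY, Matrix.mulVec, dotProduct]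
    simp only [matZ, Matrix.of_apply, hs, mul_add, Finset.sum_add_distrib, mul_assoc,
      ← Finset.mul_sum, ← Finset.sum_mul, sum_indicator]
    -- Centering makes no difference against a vector of sum zero.
    have : ∑ j, centered z.1 j * β j = ∑ j, indicator z.1 j * β j := by
      simp only [centered, sub_mul, Finset.sum_sub_distrib, ← Finset.mul_sum, hβ0, mul_zero,
        sub_zero]
    rw [this]
    ring
  have e1 : ((matA n)ᵀ *ᵥ residual v) i = ∑ z : Row n, weight n z.1.card *
      (centered z.1 i * (∑ j, centered z.1 j * β j + α * z.1.card - (v z.1 - v ∅))) := by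
    rw [Matrix.mulVec, dotProduct]
    refine Finset.sum_congr rfl fun z _ => ?_
    rw [Matrix.transpose_apply, matA_apply, hZ]
    have := Real.mul_self_sqrt (weight_nonneg n z.1.card (card_le z.1))
    linear_combination (centered z.1 i * (∑ j, centered z.1 j * β j + α * z.1.card -
      (v z.1 - v ∅))) * this
  have e2 : ∑ z : Row n, weight n z.1.card * (centered z.1 i * ∑ j, centered z.1 j * β j) =
      1 / n * β i := by
    have h1 : 1 / (n : ℝ) * β i = (((1 / n : ℝ) • matP n) *ᵥ β) i := by
      rw [Matrix.smul_mulVec, matP_mulVec_of_sum_eq_zero hβ0]; rfl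
    rw [h1, Matrix.mulVec, dotProduct]
    simp only [Matrix.smul_apply, smul_eq_mul, ← sum_weight_centered_mul_centered hn,
      Finset.mul_sum, Finset.sum_mul]
    rw [Finset.sum_comm]
    refine Finset.sum_congr rfl fun j _ => ?_
    rw [← Finset.sum_mul, ← sum_row_weight fun S => centered S i * centered S j, Finset.sum_mul]
    exact Finset.sum_congr rfl fun z _ => by ring
  -- The part of the residual that depends on the size alone is orthogonal to centered vectors.
  have e3 : ∑ z : Row n, weight n z.1.card * (centered z.1 i * (α * z.1.card + v ∅)) = 0 := by
    rw [sum_row_weight fun S => centered S i * (α * S.card + v ∅),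
      ← sum_card_mul_centered hn (fun s => weight n s * (α * s + v ∅)) i]
    exact Finset.sum_congr rfl fun z _ => by ring
  have e4 : ∑ z : Row n, weight n z.1.card * (centered z.1 i * v z.1) = 1 / n * β i := by
    simp only [hβ]; field_simp
  rw [e1, Pi.zero_apply]
  calc _ = ∑ z : Row n, weight n z.1.card * (centered z.1 i * ∑ j, centered z.1 j * β j) +
        ∑ z : Row n, weight n z.1.card * (centered z.1 i * (α * z.1.card + v ∅)) -
        ∑ z : Row n, weight n z.1.card * (centered z.1 i * v z.1) := by
        rw [← Finset.sum_add_distrib, ← Finset.sum_sub_distrib]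
        exact Finset.sum_congr rfl fun z _ => by ring
    _ = 0 := by rw [e2, e3, e4]; ring

end Regression

/-! ### Water filling -/

section WaterFilling

/-- The water level `τ` with `∑ min (B i) τ = M` is the largest of the levels obtained by
saturating the terms below some `B t`. -/
theorem sum_min_eq_of_isMax {ι : Type} (I : Finset ι) (B : ι → ℝ) {M τ : ℝ}
    (hM : 0 ≤ M) (hMB : M ≤ ∑ i ∈ I, B i) 
    (hle : ∀ t ∈ I, (M - ∑ i ∈ I with B i < B t, B i) / (I.filter fun i => ¬B i < B t).card ≤ τ)
    (heq : τ = 0 ∨ ∃ t ∈ I,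
      τ = (M - ∑ i ∈ I with B i < B t, B i) / (I.filter fun i => ¬B i < B t).card) :
    ∑ i ∈ I, min (B i) τ = M := by
  have hpos : ∀ t ∈ I, (0 : ℝ) < (I.filter fun i => ¬B i < B t).card := fun t ht => by
    exact_mod_cast Finset.card_pos.2 ⟨t, Finset.mem_filter.2 ⟨ht, lt_irrefl _⟩⟩
  refine le_antisymm ?_ ?_
  -- Upper bound: if `τ` is the level of `t`, bound the terms below `B t` by `B i` and the others by
  -- `τ`; these bounds add up to `M`.
  · rcases heq with rfl | ⟨t, ht, h⟩
    · refine le_trans (Finset.sum_nonpos fun i _ => min_le_right _ _) hM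
    · rw [← Finset.sum_filter_add_sum_filter_not I fun i => B i < B t]
      have h1 : ∑ i ∈ I with B i < B t, min (B i) τ ≤ ∑ i ∈ I with B i < B t, B i :=
        Finset.sum_le_sum fun i _ => min_le_left _ _
      have h2 : ∑ i ∈ I with ¬B i < B t, min (B i) τ ≤
          (I.filter fun i => ¬B i < B t).card * τ := by
        rw [← nsmul_eq_mul]
        exact Finset.sum_le_card_nsmul _ _ _ fun i _ => min_le_right _ _
      have h3 := hpos t ht
      rw [eq_div_iff h3.ne'] at h
      linarith
  · by_cases hall : ∀ i ∈ I, B i < τ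
    · rw [Finset.sum_congr rfl fun i hi => min_eq_left (hall i hi).le]
      exact hMB
    · push Not at hall
      obtain ⟨j, hj, hjτ⟩ := hall
      -- Lower bound: for the smallest `B t` that is at least `τ`, the terms saturated by `τ` are
      -- exactly accounted for by the split at `B t`, and the level of `t` is at most `τ`.
      obtain ⟨t, ht, hmin⟩ := Finset.exists_min_image (I.filter fun i => τ ≤ B i) B
        ⟨j, Finset.mem_filter.2 ⟨hj, hjτ⟩⟩
      rw [Finset.mem_filter] at ht
      have hlt : ∀ i ∈ I, B i < B t → B i ≤ τ := by
        intro i hi h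
        by_contra hc
        exact absurd (hmin i (Finset.mem_filter.2 ⟨hi, (not_le.1 hc).le⟩)) (not_le.2 h)
      rw [← Finset.sum_filter_add_sum_filter_not I fun i => B i < B t]
      have h1 : ∑ i ∈ I with B i < B t, min (B i) τ = ∑ i ∈ I with B i < B t, B i := by
        refine Finset.sum_congr rfl fun i hi => min_eq_left ?_
        rw [Finset.mem_filter] at hi
        exact hlt i hi.1 hi.2
      have h2 : ∑ i ∈ I with ¬B i < B t, min (B i) τ =
          (I.filter fun i => ¬B i < B t).card * τ := by
        rw [← nsmul_eq_mul, ← Finset.sum_const]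
        refine Finset.sum_congr rfl fun i hi => min_eq_right ?_
        rw [Finset.mem_filter, not_lt] at hi
        exact ht.2.trans hi.2
      have h3 := hle t ht.1
      rw [div_le_iff₀ (hpos t ht.1)] at h3
      rw [h1, h2]
      linarith

theorem exists_isMax_level {ι : Type} (I : Finset ι) (f : ι → ℝ) :
    ∃ τ : ℝ, 0 ≤ τ ∧ (∀ t ∈ I, f t ≤ τ) ∧ (τ = 0 ∨ ∃ t ∈ I, τ = f t) := by
  classical
  obtain ⟨τ, hτ, hmax⟩ := Finset.exists_max_image (insert 0 (I.image f)) id ⟨0, by simp⟩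
  refine ⟨τ, hmax 0 (by simp), fun t ht => hmax _ (by simp; right; exact ⟨t, ht, rfl⟩), ?_⟩
  simp only [Finset.mem_insert, Finset.mem_image] at hτ
  rcases hτ with h | ⟨t, ht, h⟩
  · exact Or.inl h
  · exact Or.inr ⟨t, ht, h.symm⟩

end WaterFilling

/-! ### The oversampling parameter -/

section Oversampling

variable {n : ℕ}

theorem choose_cast_pos {s : ℕ} (hs : s ≤ n) : (0 : ℝ) < n.choose s := by
  exact_mod_cast Nat.choose_pos hs

theorem sum_choose_Ico (hn : 1 ≤ n) : ∑ s ∈ Finset.Ico 1 n, (n.choose s : ℝ) = 2 ^ n - 2 := by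
  have h := Nat.sum_range_choose n
  rw [Finset.sum_range_succ, Finset.range_eq_Ico, Finset.sum_eq_sum_Ico_succ_bot hn] at h
  simp at h
  have : (1 : ℝ) + ∑ s ∈ Finset.Ico 1 n, (n.choose s : ℝ) + 1 = 2 ^ n := by exact_mod_cast h
  linarith

theorem min_one_mul_choose {s : ℕ} (hs : s ≤ n) (τ : ℝ) :
    min 1 (τ * (n.choose s : ℝ)⁻¹) * n.choose s = min (n.choose s : ℝ) τ := by
  have := choose_cast_pos hs
  rw [min_mul_of_nonneg _ _ this.le, one_mul, mul_assoc, inv_mul_cancel₀ this.ne', mul_one]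

/-- With `τ = 2c` the condition on `c` is a water filling problem for the binomial coefficients. -/
theorem isOversampling_half_iff {m : ℕ} (τ : ℝ) : IsOversampling n m (τ / 2) ↔
    ∑ s ∈ Finset.Ico 1 n, min (n.choose s : ℝ) τ = m - 2 := by
  rw [IsOversampling, eq_comm, mul_div_cancel₀ _ (two_ne_zero)]
  rw [Finset.sum_congr rfl fun s hs => min_one_mul_choose (Finset.mem_Ico.1 hs).2.le τ]

/-- The level obtained by saturating the terms below the one with index `t`. -/
def candidateLevel (n m t : ℕ) : ℝ :=
  ((m : ℝ) - 2 - ∑ s ∈ Finset.Ico 1 n with (n.choose s : ℝ) < n.choose t, (n.choose s : ℝ)) /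
    ((Finset.Ico 1 n).filter fun s => ¬(n.choose s : ℝ) < n.choose t).card

/-- `τ` is the largest candidate level. -/
def IsMaxLevel (n m : ℕ) (τ : ℝ) : Prop :=
  0 ≤ τ ∧ (∀ t ∈ Finset.Ico 1 n, candidateLevel n m t ≤ τ) ∧
    (τ = 0 ∨ ∃ t ∈ Finset.Ico 1 n, τ = candidateLevel n m t)

theorem IsMaxLevel.isOversampling {m : ℕ} {τ : ℝ} (hn : 1 ≤ n) (hm : 2 ≤ m) (hm2 : m ≤ 2 ^ n)
    (h : IsMaxLevel n m τ) : IsOversampling n m (τ / 2) := by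
  rw [isOversampling_half_iff]
  have h1 : (2 : ℝ) ≤ m := by exact_mod_cast hm
  have h2 : (m : ℝ) ≤ 2 ^ n := by exact_mod_cast hm2
  refine sum_min_eq_of_isMax _ (fun s => (n.choose s : ℝ)) (by linarith) ?_
    h.2.1 h.2.2
  rw [sum_choose_Ico hn]
  linarith

theorem exists_isOversampling {m : ℕ} (hn : 1 ≤ n) (hm : 2 ≤ m) :
    ∃ c, IsOversampling n (min m (2 ^ n)) c := by
  obtain ⟨τ, h⟩ := exists_isMax_level (Finset.Ico 1 n) (candidateLevel n (min m (2 ^ n)))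
  refine ⟨τ / 2, IsMaxLevel.isOversampling hn (le_min hm ?_) (min_le_right _ _) h⟩
  calc 2 = 2 ^ 1 := rfl
    _ ≤ 2 ^ n := Nat.pow_le_pow_right (by norm_num) hn

theorem IsOversampling.nonneg {m : ℕ} {c : ℝ} (h : IsOversampling n m c) (hn : 2 ≤ n)
    (hm : 2 ≤ m) : 0 ≤ c := by
  by_contra hc
  push Not at hc
  have h1 : (2 : ℝ) ≤ m := by exact_mod_cast hm
  have h2 : ∑ s ∈ Finset.Ico 1 n, min 1 (2 * c * (n.choose s : ℝ)⁻¹) * (n.choose s : ℝ) < 0 := by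
    refine Finset.sum_neg (fun s hs => ?_) ⟨1, by simp; omega⟩
    rw [min_one_mul_choose (Finset.mem_Ico.1 hs).2.le]
    exact (min_le_right _ _).trans_lt (by linarith)
  rw [IsOversampling] at h
  linarith

/-- The inclusion probability of the pairs of sets of sizes `s` and `n - s`. -/
def levelProb (n : ℕ) (c : ℝ) (s : ℕ) : ℝ≥0 := (min 1 (2 * c * (n.choose s : ℝ)⁻¹)).toNNReal

theorem levelProb_le_one (c : ℝ) (s : ℕ) : levelProb n c s ≤ 1 := by
  rw [levelProb, Real.toNNReal_le_one]
  exact min_le_left _ _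

theorem coe_levelProb {c : ℝ} (hc : 0 ≤ c) (s : ℕ) :
    (levelProb n c s : ℝ) = min 1 (2 * c * (n.choose s : ℝ)⁻¹) := by
  rw [levelProb, Real.coe_toNNReal]
  exact le_min zero_le_one (by positivity)

/-- Each term is monotone in `c`, so equal sums force equal terms. The parameter need not be unique,
but the probabilities are. -/
theorem IsOversampling.levelProb_eq {m : ℕ} {c c' : ℝ} (h : IsOversampling n m c)
    (h' : IsOversampling n m c') {s : ℕ} (hs : s ∈ Finset.Ico 1 n) :
    levelProb n c s = levelProb n c' s := by
  wlog hcc : c ≤ c' generalizing c c'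
  · exact (this h' h (le_of_not_ge hcc)).symm
  rw [IsOversampling] at h h'
  rw [h] at h'
  have hle : ∀ s ∈ Finset.Ico 1 n, min 1 (2 * c * (n.choose s : ℝ)⁻¹) * (n.choose s : ℝ) ≤
      min 1 (2 * c' * (n.choose s : ℝ)⁻¹) * (n.choose s : ℝ) := fun s _ => by gcongr
  have h1 := (Finset.sum_eq_sum_iff_of_le hle).1 h' s hs
  rw [levelProb, levelProb, mul_right_cancel₀ (choose_cast_pos (Finset.mem_Ico.1 hs).2.le).ne' h1]

end Oversampling

/-! ### Complementary pairs of rows -/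

section Pairs

variable {n : ℕ}

theorem Row.compl_compl (z : Row n) : z.compl.compl = z := Subtype.ext (_root_.compl_compl _)

theorem Row.one_le (z : Row n) : 1 ≤ n := by have := z.2; omega

theorem Row.compl_ne (z : Row n) : z.compl ≠ z := by
  intro h
  have h1 : (z.1)ᶜ = z.1 := congrArg Subtype.val h
  obtain ⟨i, hi⟩ := Finset.card_pos.1 z.2.1
  have := hi
  rw [← h1, Finset.mem_compl] at this
  exact this hi

theorem mem_pairs {B : Finset (Row n)} : B ∈ pairs n ↔ ∃ z : Row n, B = {z, z.compl} := by
  simp [pairs, eq_comm]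

theorem pair_eq_of_mem {B : Finset (Row n)} (hB : B ∈ pairs n) {z : Row n} (hz : z ∈ B) :
    B = {z, z.compl} := by
  obtain ⟨y, rfl⟩ := mem_pairs.1 hB
  rw [Finset.mem_insert, Finset.mem_singleton] at hz
  rcases hz with rfl | rfl
  · rfl
  · rw [Row.compl_compl, Finset.pair_comm]

theorem pairwiseDisjoint_pairs {T : Finset (Finset (Row n))} (hT : T ⊆ pairs n) :
    (T : Set (Finset (Row n))).PairwiseDisjoint id := by
  intro B hB B' hB' hne
  rw [Function.onFun, id, id, Finset.disjoint_left]
  intro z hz hz'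
  exact hne ((pair_eq_of_mem (hT hB) hz).trans (pair_eq_of_mem (hT hB') hz').symm)

theorem sum_sampledRows {E : Type} [AddCommMonoid E] {T : Finset (Finset (Row n))}
    (hT : T ⊆ pairs n) (f : Row n → E) :
    ∑ z ∈ sampledRows T, f z = ∑ B ∈ T, ∑ z ∈ B, f z :=
  Finset.sum_biUnion (pairwiseDisjoint_pairs hT)

theorem sum_pair {E : Type} [AddCommMonoid E] (z : Row n) (f : Row n → E) :
    ∑ y ∈ ({z, z.compl} : Finset (Row n)), f y = f z + f z.compl :=
  Finset.sum_pair z.compl_ne.symm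

theorem sampledRows_pairs : sampledRows (pairs n) = Finset.univ := by
  ext z
  simp only [sampledRows, Finset.mem_biUnion, id, Finset.mem_univ, iff_true]
  exact ⟨{z, z.compl}, mem_pairs.2 ⟨z, rfl⟩, by simp⟩

theorem choose_card_compl (z : Row n) : n.choose z.compl.1.card = n.choose z.1.card := by
  rw [Row.compl, Finset.card_compl, Fintype.card_fin, Nat.choose_symm z.2.2.le]

theorem weight_card_compl (z : Row n) : weight n z.compl.1.card = weight n z.1.card := by
  rw [weight, weight, choose_card_compl, Row.compl, Finset.card_compl, Fintype.card_fin,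
    Nat.cast_sub z.2.2.le]
  ring

/-- Both rows have the same leverage score, a function of the size; sampling without enumerating all
sets rests on this. -/
theorem inclusionProb_pair (c : ℝ) (z : Row n) :
    inclusionProb c {z, z.compl} = levelProb n c z.1.card := by
  rw [inclusionProb, sum_pair, leverageScore_matA z.one_le, leverageScore_matA z.one_le,
    choose_card_compl, levelProb, Monotone.map_min (f := Real.toNNReal) (fun _ _ h => Real.toNNReal_le_toNNReal h), Real.toNNReal_one]
  congr 2
  ring

theorem levelProb_card_compl (c : ℝ) (z : Row n) :
    levelProb n c z.compl.1.card = levelProb n c z.1.card := by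
  rw [levelProb, levelProb, choose_card_compl]

theorem inclusionProb_of_mem {c : ℝ} {B : Finset (Row n)} (hB : B ∈ pairs n) {z : Row n}
    (hz : z ∈ B) : inclusionProb c B = levelProb n c z.1.card := by
  rw [pair_eq_of_mem hB hz, inclusionProb_pair]

end Pairs

/-! ### Normal equations of the sampled problem -/

section Gram

variable {n : ℕ}

/-- The weight `w(|z|) / p_z` of a sampled row. -/
def rowWeight (c : ℝ) (z : Row n) : ℝ := weight n z.1.card / levelProb n c z.1.card

theorem rowWeight_nonneg (c : ℝ) (z : Row n) : 0 ≤ rowWeight c z :=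
  div_nonneg (weight_nonneg n _ (card_le z.1)) (NNReal.coe_nonneg _)

/-- The entry `v(z) - v(∅) - ((v([n]) - v(∅)) / n) |z|` of `b'`. -/
def target (v : Finset (Fin n) → ℝ) (z : Row n) : ℝ :=
  v z.1 - v ∅ - (v Finset.univ - v ∅) / n * z.1.card

/-- The Gram matrix `P Z'ᵀ W Z' P` of the sampled problem. -/
def gram (c : ℝ) (T : Finset (Finset (Row n))) : Matrix (Fin n) (Fin n) ℝ :=
  ∑ z ∈ sampledRows T, rowWeight c z • Matrix.vecMulVec (centered z.1) (centered z.1)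

/-- The right hand side `P Z'ᵀ W b'` of the normal equations of the sampled problem. -/
def gramRhs (v : Finset (Fin n) → ℝ) (c : ℝ) (T : Finset (Finset (Row n))) : Fin n → ℝ :=
  ∑ z ∈ sampledRows T, (rowWeight c z * target v z) • centered z.1

theorem sampledMatrix_apply (c : ℝ) (T : Finset (Finset (Row n))) (z : sampledRows T)
    (j : Fin n) :
    (sqrtW c T * sampledZ T * matP n) z j = √(rowWeight c z.1) * centered z.1.1 j := by
  rw [Matrix.mul_apply, ← mul_matP]
  refine Finset.sum_congr rfl fun k _ => ?_
  rw [sqrtW, Matrix.diagonal_mul, inclusionProb_pair]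
  rfl

theorem sampledMatrix_gram (c : ℝ) (T : Finset (Finset (Row n))) :
    (sqrtW c T * sampledZ T * matP n)ᵀ * (sqrtW c T * sampledZ T * matP n) = gram c T := by
  ext i j
  rw [Matrix.mul_apply, gram, Matrix.sum_apply, ← Finset.sum_coe_sort (sampledRows T)]
  refine Finset.sum_congr rfl fun z _ => ?_
  rw [Matrix.transpose_apply, sampledMatrix_apply, sampledMatrix_apply, Matrix.smul_apply,
    Matrix.vecMulVec_apply, smul_eq_mul]
  have := Real.mul_self_sqrt (rowWeight_nonneg c z.1)
  linear_combination (centered z.1.1 i * centered z.1.1 j) * this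

theorem sampledMatrix_rhs (v : Finset (Fin n) → ℝ) (c : ℝ) (T : Finset (Finset (Row n))) :
    (sqrtW c T * sampledZ T * matP n)ᵀ *ᵥ (sqrtW c T *ᵥ sampledB v T) = gramRhs v c T := by
  ext i
  rw [Matrix.mulVec, dotProduct, gramRhs, Finset.sum_apply, ← Finset.sum_coe_sort (sampledRows T)]
  refine Finset.sum_congr rfl fun z _ => ?_
  have hb : sampledB v T z = target v z.1 := by
    rw [sampledB, target, Matrix.mulVec, dotProduct]
    simp only [sampledZ, Matrix.of_apply, mul_one, sum_indicator]
  rw [Matrix.transpose_apply, sampledMatrix_apply, sqrtW, Matrix.mulVec_diagonal,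
    inclusionProb_pair, hb, Pi.smul_apply, smul_eq_mul]
  have := Real.mul_self_sqrt (rowWeight_nonneg c z.1)
  rw [rowWeight] at this ⊢
  linear_combination (centered z.1.1 i * target v z.1) * this

/-- The error analysis needs only the normal equations and the range condition; `estimate_eq` is the
converse, used to identify the output of the program. -/
theorem exists_estimate_eq (v : Finset (Fin n) → ℝ) (c : ℝ) (T : Finset (Finset (Row n))) :
    ∃ x y : Fin n → ℝ, gram c T *ᵥ x = gramRhs v c T ∧ x = gram c T *ᵥ y ∧
      ∀ i, estimate v c T i = x i + (v Finset.univ - v ∅) / n := by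
  have h1 := leastSquares_normal (sqrtW c T * sampledZ T * matP n) (sqrtW c T *ᵥ sampledB v T)
  obtain ⟨y, hy⟩ := exists_leastSquares_eq (sqrtW c T * sampledZ T * matP n)
    (sqrtW c T *ᵥ sampledB v T)
  rw [sampledMatrix_gram, sampledMatrix_rhs] at h1
  rw [sampledMatrix_gram] at hy
  exact ⟨_, y, h1, hy, fun i => rfl⟩

theorem estimate_eq {v : Finset (Fin n) → ℝ} {c : ℝ} {T : Finset (Finset (Row n))}
    {x y : Fin n → ℝ} (hx : gram c T *ᵥ x = gramRhs v c T) (hy : x = gram c T *ᵥ y)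
    (i : Fin n) : estimate v c T i = x i + (v Finset.univ - v ∅) / n := by
  rw [estimate, leastSquares_eq_of_normal (x := x) (y := y)]
  · rwa [sampledMatrix_gram, sampledMatrix_rhs]
  · rwa [sampledMatrix_gram]

/-- The range is spanned by centered vectors. Hence the least norm solution has sum zero and the
constraint holds for every sample. -/
theorem sum_gram_mulVec (c : ℝ) (T : Finset (Finset (Row n))) (y : Fin n → ℝ) :
    ∑ i, (gram c T *ᵥ y) i = 0 := by
  rcases Nat.eq_zero_or_pos n with rfl | hn
  · simp
  · simp only [gram, Matrix.sum_mulVec, Matrix.smul_mulVec, Matrix.vecMulVec_mulVec,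
      Finset.sum_apply, Pi.smul_apply, MulOpposite.smul_eq_mul_unop, MulOpposite.unop_op,
      smul_eq_mul]
    rw [Finset.sum_comm]
    simp only [← Finset.mul_sum, ← Finset.sum_mul, sum_centered hn]
    simp

theorem sum_estimate (hn : 1 ≤ n) (v : Finset (Fin n) → ℝ) (c : ℝ)
    (T : Finset (Finset (Row n))) : ∑ i, estimate v c T i = v Finset.univ - v ∅ := by
  have h0 : (n : ℝ) ≠ 0 := by positivity
  obtain ⟨x, y, -, hy, he⟩ := exists_estimate_eq v c T
  simp only [he, Finset.sum_add_distrib]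
  rw [hy, sum_gram_mulVec]
  simp
  field_simp

end Gram

/-! ### Accuracy of the estimate -/

section Accuracy

variable {n : ℕ}

/-- The gradient noise `∑ (1 / p_z) r_z A_z` of the sample. -/
def noise (v : Finset (Fin n) → ℝ) (c : ℝ) (T : Finset (Finset (Row n))) (i : Fin n) : ℝ :=
  ∑ z ∈ sampledRows T, (levelProb n c z.1.card : ℝ)⁻¹ * residual v z * matA n z i

theorem norm_toLp_sq {ρ : Type} [Fintype ρ] (x : ρ → ℝ) : ‖WithLp.toLp 2 x‖ ^ 2 = x ⬝ᵥ x := by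
  rw [EuclideanSpace.norm_sq_eq, dotProduct]
  exact Finset.sum_congr rfl fun i _ => by simp [sq]

theorem objective_shapley (v : Finset (Fin n) → ℝ) :
    objective v (shapley v) = residual v ⬝ᵥ residual v := norm_toLp_sq _

/-- Pythagoras: the residual is orthogonal to the range of A, and A scales squared norms of sum-zero
vectors by `1 / n`. -/
theorem objective_eq (hn : 1 ≤ n) (v : Finset (Fin n) → ℝ) (φ d : Fin n → ℝ)
    (hφ : ∀ i, φ i = shapley v i + d i) (hd : ∑ i, d i = 0) :
    objective v φ = objective v (shapley v) + (d ⬝ᵥ d) / n := by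
  have hd' : matP n *ᵥ d = d := matP_mulVec_of_sum_eq_zero hd
  have h1 : matZ n *ᵥ φ - vecY v = residual v + matA n *ᵥ d := by
    have : φ = shapley v + d := funext hφ
    rw [this, Matrix.mulVec_add, matA, ← Matrix.mulVec_mulVec, hd']
    ext z
    simp only [Pi.add_apply, Pi.sub_apply, residual]
    ring
  have h2 : residual v ⬝ᵥ (matA n *ᵥ d) = 0 := by
    rw [Matrix.dotProduct_mulVec, ← Matrix.mulVec_transpose,
      matA_transpose_mulVec_residual hn, zero_dotProduct]
  have h3 : (matA n *ᵥ d) ⬝ᵥ (matA n *ᵥ d) = (d ⬝ᵥ d) / n := by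
    rw [Matrix.dotProduct_mulVec, ← Matrix.mulVec_transpose, Matrix.mulVec_mulVec, matA_gram hn,
      Matrix.smul_mulVec, hd', smul_dotProduct, smul_eq_mul]
    ring
  rw [objective_shapley, objective, norm_toLp_sq, h1]
  simp only [add_dotProduct, dotProduct_add]
  rw [dotProduct_comm (matA n *ᵥ d) (residual v), h2, h3]
  ring

theorem residual_eq (hn : 1 ≤ n) (v : Finset (Fin n) → ℝ) (z : Row n) :
    residual v z = √(weight n z.1.card) *
      (centered z.1 ⬝ᵥ (fun i => shapley v i - (v Finset.univ - v ∅) / n) - target v z) := by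
  have h0 : (n : ℝ) ≠ 0 := by positivity
  have hs := sum_shapley hn v
  have e : centered z.1 ⬝ᵥ (fun i => shapley v i - (v Finset.univ - v ∅) / n) =
      ∑ i, indicator z.1 i * shapley v i - z.1.card / n * (v Finset.univ - v ∅) := by
    have : ∀ i, centered z.1 i * (shapley v i - (v Finset.univ - v ∅) / n) =
        indicator z.1 i * shapley v i - z.1.card / n * shapley v i -
          centered z.1 i * ((v Finset.univ - v ∅) / n) := fun i => by
      rw [centered]; ring
    simp only [dotProduct, this, Finset.sum_sub_distrib, ← Finset.mul_sum, ← Finset.sum_mul,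
      sum_centered hn, hs]
    ring
  rw [e, target, residual, Pi.sub_apply, vecY, Matrix.mulVec, dotProduct]
  simp only [matZ, Matrix.of_apply, mul_assoc, ← Finset.mul_sum]
  field_simp
  ring

/-- The excess error is controlled by the noise once the sample preserves the geometry. -/
theorem objective_estimate_le (hn : 1 ≤ n) (v : Finset (Fin n) → ℝ) (c : ℝ)
    (T : Finset (Finset (Row n)))
    (hgram : ∀ x : Fin n → ℝ, ∑ i, x i = 0 →
      1 / 4 * (x ⬝ᵥ x) ≤ n * (x ⬝ᵥ (gram c T *ᵥ x))) :
    objective v (estimate v c T) ≤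
      objective v (shapley v) + 16 * n * (noise v c T ⬝ᵥ noise v c T) := by
  have hn0 : (0 : ℝ) < n := by positivity
  obtain ⟨x, y, hx, hy, he⟩ := exists_estimate_eq v c T
  set α := (v Finset.univ - v ∅) / n with hα
  set β : Fin n → ℝ := fun i => shapley v i - α with hβ
  set d := x - β with hd
  have hx0 : ∑ i, x i = 0 := by rw [hy, sum_gram_mulVec]
  have hd0 : ∑ i, d i = 0 := by
    simp only [hd, hβ, Pi.sub_apply, Finset.sum_sub_distrib, hx0, sum_shapley hn]
    simp [hα]
    field_simp
    ring
  -- `x` solves the sampled normal equations exactly, while the shifted Shapley vector `β` solves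
  -- them up to the noise.
  have hgd : gram c T *ᵥ d = -noise v c T := by
    rw [hd, Matrix.mulVec_sub, hx]
    ext i
    simp only [gram, gramRhs, noise, Matrix.sum_mulVec, Matrix.smul_mulVec,
      Matrix.vecMulVec_mulVec, Pi.sub_apply, Finset.sum_apply, Pi.smul_apply,
      MulOpposite.smul_eq_mul_unop, MulOpposite.unop_op, smul_eq_mul, Pi.neg_apply,
      ← Finset.sum_neg_distrib, ← Finset.sum_sub_distrib]
    refine Finset.sum_congr rfl fun z _ => ?_
    rw [residual_eq hn, matA_apply, rowWeight]
    have := Real.mul_self_sqrt (weight_nonneg n z.1.card (card_le z.1))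
    rw [← hα, ← hβ]
    linear_combination (-(levelProb n c z.1.card : ℝ)⁻¹ * (target v z - centered z.1 ⬝ᵥ β) *
      centered z.1 i) * this
  rw [objective_eq hn v (estimate v c T) d (fun i => by
    rw [he, hd, Pi.sub_apply, hβ]; ring) hd0]
  have h1 := hgram d hd0
  rw [hgd, dotProduct_neg] at h1
  -- Cauchy–Schwarz by completing the square; the factor `4 * n` is the inverse of the lower bound
  -- `1 / (4 * n)` for the Gram matrix.
  have h3 : (0 : ℝ) ≤ (d + (4 * n : ℝ) • (noise v c T)) ⬝ᵥ (d + (4 * n : ℝ) • (noise v c T)) := by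
    simpa using dotProduct_star_self_nonneg (d + (4 * n : ℝ) • (noise v c T))
  simp only [add_dotProduct, dotProduct_add, smul_dotProduct, dotProduct_smul, smul_eq_mul] at h3
  rw [dotProduct_comm (noise v c T) d] at h3
  have h4 : d ⬝ᵥ d ≤ 16 * n ^ 2 * (noise v c T ⬝ᵥ noise v c T) := by
    nlinarith
  have h5 : (d ⬝ᵥ d) / n ≤ 16 * n * (noise v c T ⬝ᵥ noise v c T) := by
    rw [div_le_iff₀ hn0]
    linarith
  linarith

theorem dotProduct_self_nonneg' {κ : Type} [Fintype κ] (x : κ → ℝ) : 0 ≤ x ⬝ᵥ x := by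
  simpa using dotProduct_star_self_nonneg x

theorem coe_inclusionProb_of_mem {c : ℝ} {B : Finset (Row n)} (hB : B ∈ pairs n) {z : Row n}
    (hz : z ∈ B) : (inclusionProb c B : ℝ) = levelProb n c z.1.card := by
  rw [inclusionProb_of_mem hB hz]

theorem levelProb_pos {c : ℝ} (hc : 0 < c) {s : ℕ} (hs : s ≤ n) : 0 < (levelProb n c s : ℝ) := by
  rw [coe_levelProb hc.le]
  have := choose_cast_pos hs
  exact lt_min one_pos (by positivity)

theorem matA_row_sq (z : Row n) : matA n z ⬝ᵥ matA n z = 1 / (n * n.choose z.1.card) := by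
  have hn := z.one_le
  have h0 : (n : ℝ) ≠ 0 := by positivity
  have hrow : matA n z = √(weight n z.1.card) • centered z.1 := by
    ext j; rw [matA_apply]; rfl
  rw [hrow]
  simp only [smul_dotProduct, dotProduct_smul, smul_eq_mul]
  rw [← mul_assoc, Real.mul_self_sqrt (weight_nonneg n z.1.card (card_le z.1)), dotProduct,
    sum_centered_sq hn, weight]
  have h2 : (z.1.card : ℝ) ≠ 0 := by exact_mod_cast z.2.1.ne'
  have h3 : (n : ℝ) - z.1.card ≠ 0 := by
    rw [sub_ne_zero]; exact_mod_cast z.2.2.ne'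
  have h1 := (choose_cast_pos z.2.2.le).ne'
  field_simp

/-- Saturated rows have no variance. For the others the probability is `2c / binom(n, s)`, and the
squared row norm is `1 / (n binom(n, s))`, so the size drops out: leverage sampling bounds all
variances equally. -/
theorem one_sub_div_levelProb_le {c : ℝ} (hc : 0 < c) (z : Row n) :
    (1 - (levelProb n c z.1.card : ℝ)) * (levelProb n c z.1.card : ℝ)⁻¹ *
      (matA n z ⬝ᵥ matA n z) ≤ 1 / (2 * n * c) := by
  have hn := z.one_le
  have hn0 : (0 : ℝ) < n := by positivity
  have hC := choose_cast_pos z.2.2.le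
  rw [matA_row_sq, coe_levelProb hc.le]
  rcases le_total 1 (2 * c * (n.choose z.1.card : ℝ)⁻¹) with h | h
  · rw [min_eq_left h, sub_self, zero_mul, zero_mul]; positivity
  · rw [min_eq_right h]
    have h1 : (1 - 2 * c * (n.choose z.1.card : ℝ)⁻¹) ≤ 1 := by
      have : 0 ≤ 2 * c * (n.choose z.1.card : ℝ)⁻¹ := by positivity
      linarith
    calc _ ≤ 1 * (2 * c * (n.choose z.1.card : ℝ)⁻¹)⁻¹ * (1 / (n * n.choose z.1.card)) := by
          gcongr
      _ = 1 / (2 * n * c) := by field_simp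

/-- The second moment of the gradient noise. -/
theorem bernoulliMean_noise_le (hn : 1 ≤ n) (v : Finset (Fin n) → ℝ) {c : ℝ} (hc : 0 < c) :
    bernoulliMean (pairs n) (fun B => (inclusionProb c B : ℝ))
      (fun T => noise v c T ⬝ᵥ noise v c T) ≤ objective v (shapley v) / (n * c) := by
  have hn0 : (0 : ℝ) < n := by positivity
  set u : Fin n → Finset (Row n) → ℝ := fun i B =>
    ∑ z ∈ B, (levelProb n c z.1.card : ℝ)⁻¹ * residual v z * matA n z i with hu
  have hpu : ∀ i, ∀ B ∈ pairs n, (inclusionProb c B : ℝ) * u i B =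
      ∑ z ∈ B, residual v z * matA n z i := by
    intro i B hB
    rw [hu, Finset.mul_sum]
    refine Finset.sum_congr rfl fun z hz => ?_
    rw [coe_inclusionProb_of_mem hB hz]
    have := (levelProb_pos hc (card_le z.1)).ne'
    field_simp
  -- The division by the inclusion probability makes the mean equal to Aᵀr, which vanishes by
  -- optimality.
  have hmean : ∀ i, ∑ B ∈ pairs n, (inclusionProb c B : ℝ) * u i B = 0 := by
    intro i
    rw [Finset.sum_congr rfl (hpu i), ← sum_sampledRows subset_rfl, sampledRows_pairs]
    have := congrFun (matA_transpose_mulVec_residual hn v) i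
    rw [Matrix.mulVec, dotProduct, Pi.zero_apply] at this
    rw [← this]
    exact Finset.sum_congr rfl fun z _ => by rw [Matrix.transpose_apply, mul_comm]
  have hcoord : ∀ i, bernoulliMean (pairs n) (fun B => (inclusionProb c B : ℝ))
      (fun T => noise v c T i * noise v c T i) =
      ∑ B ∈ pairs n, (inclusionProb c B : ℝ) * (1 - inclusionProb c B) * u i B ^ 2 := by
    intro i
    have := bernoulliMean_sq (pairs n) (fun B => (inclusionProb c B : ℝ)) (u i) 0
    rw [hmean] at this
    simp only [zero_add, sub_zero, ne_eq, OfNat.ofNat_ne_zero, not_false_eq_true, zero_pow] at this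
    rw [← this]
    refine Finset.sum_congr rfl fun T hT => ?_
    beta_reduce
    rw [noise, sum_sampledRows (Finset.mem_powerset.1 hT), sq]
  have hpair : ∀ B ∈ pairs n, ∑ i, (inclusionProb c B : ℝ) * (1 - inclusionProb c B) *
      u i B ^ 2 ≤ (∑ z ∈ B, residual v z ^ 2) / (n * c) := by
    intro B hB
    obtain ⟨z, rfl⟩ := mem_pairs.1 hB
    have hpz : (inclusionProb c {z, z.compl} : ℝ) = levelProb n c z.1.card := by
      rw [inclusionProb_pair]
    have hp0 := levelProb_pos hc (card_le z.1)
    have hp1 : (levelProb n c z.1.card : ℝ) ≤ 1 := by exact_mod_cast levelProb_le_one c z.1.card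
    have hA : ∀ i, matA n z.compl i = -matA n z i := by
      intro i
      rw [matA_apply, matA_apply, weight_card_compl, Row.compl, centered_compl hn]
      ring
    -- Complementary rows of A are opposite, so a pair contributes through the difference of its two
    -- residuals; bounding the square of this difference costs the factor 2 gained in
    -- `one_sub_div_levelProb_le`.
    have hui : ∀ i, u i {z, z.compl} = (levelProb n c z.1.card : ℝ)⁻¹ *
        (residual v z - residual v z.compl) * matA n z i := by
      intro i
      rw [hu]
      beta_reduce
      rw [sum_pair, hA, levelProb_card_compl]
      ring
    have e : ∑ i, (inclusionProb c {z, z.compl} : ℝ) * (1 - inclusionProb c {z, z.compl}) *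
        u i {z, z.compl} ^ 2 = ((1 - (levelProb n c z.1.card : ℝ)) *
          (levelProb n c z.1.card : ℝ)⁻¹ * (matA n z ⬝ᵥ matA n z)) *
          (residual v z - residual v z.compl) ^ 2 := by
      rw [hpz, dotProduct, Finset.mul_sum, Finset.sum_mul]
      refine Finset.sum_congr rfl fun i _ => ?_
      rw [hui]
      field_simp
    rw [e, sum_pair]
    calc _ ≤ 1 / (2 * n * c) * (residual v z - residual v z.compl) ^ 2 :=
          mul_le_mul_of_nonneg_right (one_sub_div_levelProb_le hc z) (sq_nonneg _)
      _ ≤ 1 / (2 * n * c) * (2 * (residual v z ^ 2 + residual v z.compl ^ 2)) := by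
          refine mul_le_mul_of_nonneg_left ?_ (by positivity)
          nlinarith [sq_nonneg (residual v z + residual v z.compl)]
      _ = _ := by field_simp
  simp only [dotProduct]
  rw [bernoulliMean_sum]
  simp only [hcoord]
  rw [Finset.sum_comm]
  refine (Finset.sum_le_sum hpair).trans_eq ?_
  rw [← Finset.sum_div, ← sum_sampledRows subset_rfl, sampledRows_pairs, objective_shapley,
    dotProduct]
  simp only [sq]

open Classical in
/-- A rank one root of the contribution of a sampled pair to `n` times the Gram matrix. -/
def pairVec (c : ℝ) (B : Finset (Row n)) : Fin n → ℝ :=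
  if h : ∃ z : Row n, B = {z, z.compl} then √(2 * n * rowWeight c h.choose) • centered h.choose.1
  else 0

theorem exists_pairVec_eq (c : ℝ) {B : Finset (Row n)} (hB : B ∈ pairs n) :
    ∃ z : Row n, B = {z, z.compl} ∧
      pairVec c B = √(2 * n * rowWeight c z) • centered z.1 := by
  have h := mem_pairs.1 hB
  exact ⟨h.choose, h.choose_spec, by rw [pairVec, dif_pos h]⟩

theorem rowWeight_compl (c : ℝ) (z : Row n) : rowWeight c z.compl = rowWeight c z := by
  rw [rowWeight, rowWeight, weight_card_compl, levelProb_card_compl]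

/-- Opposite vectors have the same rank one matrix, so a pair is a single rank one summand despite
its two rows; this explains the factor 2 in `pairVec`. -/
theorem vecMulVec_pairVec (c : ℝ) {B : Finset (Row n)} (hB : B ∈ pairs n) :
    Matrix.vecMulVec (pairVec c B) (pairVec c B) =
      (n : ℝ) • ∑ z ∈ B, rowWeight c z • Matrix.vecMulVec (centered z.1) (centered z.1) := by
  obtain ⟨z, rfl, h⟩ := exists_pairVec_eq c hB
  have hn := z.one_le
  have hneg : centered z.compl.1 = -centered z.1 := funext fun i => centered_compl hn _ i
  rw [h, vecMulVec_sqrt_smul (by have := rowWeight_nonneg c z; positivity), sum_pair,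
    rowWeight_compl, hneg, Matrix.neg_vecMulVec, Matrix.vecMulVec_neg, neg_neg, ← two_smul ℝ,
    smul_smul, smul_smul]
  congr 1
  ring

theorem sum_vecMulVec_pairVec (c : ℝ) {T : Finset (Finset (Row n))} (hT : T ⊆ pairs n) :
    ∑ B ∈ T, Matrix.vecMulVec (pairVec c B) (pairVec c B) = (n : ℝ) • gram c T := by
  rw [gram, sum_sampledRows hT, Finset.smul_sum]
  exact Finset.sum_congr rfl fun B hB => vecMulVec_pairVec c (hT hB)

/-- For an unsaturated pair the weight, the probability and the norm of the centered vector cancel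
to exactly `1 / c`. This is the shortness needed for the Chernoff bound with `q ≤ c / 2`. -/
theorem pairVec_sq (c : ℝ) (hc : 0 < c) {B : Finset (Row n)} (hB : B ∈ pairs n) :
    (inclusionProb c B : ℝ) = 1 ∨ pairVec c B ⬝ᵥ pairVec c B ≤ 1 / c := by
  obtain ⟨z, rfl, h⟩ := exists_pairVec_eq c hB
  have hn := z.one_le
  have hn0 : (0 : ℝ) < n := by positivity
  rw [h, inclusionProb_pair, coe_levelProb hc.le]
  rcases le_total 1 (2 * c * (n.choose z.1.card : ℝ)⁻¹) with h1 | h1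
  · exact Or.inl (min_eq_left h1)
  · right
    have hw := rowWeight_nonneg c z
    simp only [smul_dotProduct, dotProduct_smul, smul_eq_mul]
    rw [← mul_assoc, Real.mul_self_sqrt (by positivity), rowWeight, coe_levelProb hc.le,
      min_eq_right h1, dotProduct, sum_centered_sq hn, weight]
    have h2 : (z.1.card : ℝ) ≠ 0 := by exact_mod_cast z.2.1.ne'
    have h3 : (n : ℝ) - z.1.card ≠ 0 := by
      rw [sub_ne_zero]; exact_mod_cast z.2.2.ne'
    have h1 := (choose_cast_pos z.2.2.le).ne'
    apply le_of_eq
    field_simp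

theorem sum_half_vecMulVec_pairVec {c : ℝ} (hc : 0 < c) :
    ∑ B ∈ pairs n, ((inclusionProb c B : ℝ) / 2) • Matrix.vecMulVec (pairVec c B) (pairVec c B) =
      (1 / 2 : ℝ) • matP n := by
  rcases Nat.eq_zero_or_pos n with rfl | hn
  · exact Subsingleton.elim _ _
  have h0 : (n : ℝ) ≠ 0 := by positivity
  have e : ∀ B ∈ pairs n,
      ((inclusionProb c B : ℝ) / 2) • Matrix.vecMulVec (pairVec c B) (pairVec c B) =
      (n / 2 : ℝ) • ∑ z ∈ B, weight n z.1.card •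
        Matrix.vecMulVec (centered z.1) (centered z.1) := by
    intro B hB
    rw [vecMulVec_pairVec c hB, smul_smul, Finset.smul_sum, Finset.smul_sum]
    refine Finset.sum_congr rfl fun z hz => ?_
    rw [smul_smul, smul_smul, coe_inclusionProb_of_mem hB hz, rowWeight]
    have := (levelProb_pos hc (card_le z.1)).ne'
    congr 1
    field_simp
  rw [Finset.sum_congr rfl e, ← Finset.smul_sum, ← sum_sampledRows subset_rfl, sampledRows_pairs]
  ext i j
  rw [Matrix.smul_apply, Matrix.smul_apply, Matrix.sum_apply]
  simp only [Matrix.smul_apply, Matrix.vecMulVec_apply, smul_eq_mul]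
  rw [sum_row_weight fun S => centered S i * centered S j, sum_weight_centered_mul_centered hn]
  field_simp

/-- The rank one projection `1 1ᵀ / n`. -/
def matJ (n : ℕ) : Matrix (Fin n) (Fin n) ℝ :=
  (1 / (n : ℝ)) • Matrix.vecMulVec (fun _ => 1) (fun _ => 1)

theorem matP_add_matJ (n : ℕ) : matP n + matJ n = 1 := by
  ext i j
  simp [matP, matJ, Matrix.vecMulVec_apply]

/-- The pairs never reach the constant vectors. Starting from `½ J` fills this direction: together
with half the expected sum `½ P` it gives `½ I`, and it does not affect sum-zero vectors. -/
theorem posSemidef_half_matJ (n : ℕ) : ((1 / 2 : ℝ) • matJ n).PosSemidef := by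
  rw [matJ, smul_smul]
  simpa using posSemidef_add_smul (κ := Fin n) Matrix.PosSemidef.zero
    (by positivity : (0 : ℝ) ≤ 1 / 2 * (1 / n)) (fun _ => 1)

theorem posSemidef_half_matJ_add_sum (c : ℝ) (T : Finset (Finset (Row n))) :
    ((1 / 2 : ℝ) • matJ n +
      ∑ B ∈ T, Matrix.vecMulVec (pairVec c B) (pairVec c B)).PosSemidef :=
  (posSemidef_half_matJ n).add (Matrix.posSemidef_sum _ fun B _ => by
    simpa using Matrix.posSemidef_vecMulVec_self_star (pairVec c B))

theorem potential_nonneg {κ : Type} [Fintype κ] [DecidableEq κ] (q : ℕ) {H : Matrix κ κ ℝ}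
    (hH : H.PosSemidef) : 0 ≤ potential q H :=
  ((posDef_one_add hH).inv.posSemidef.pow q).trace_nonneg

/-- The sample preserves the geometry up to a constant, unless the potential is large. -/
theorem quadratic_of_potential_lt (q : ℕ) {c : ℝ} {T : Finset (Finset (Row n))}
    (hT : T ⊆ pairs n)
    (h : potential q ((1 / 2 : ℝ) • matJ n +
      ∑ B ∈ T, Matrix.vecMulVec (pairVec c B) (pairVec c B)) < ((1 + 1 / 4 : ℝ)⁻¹) ^ q)
    (x : Fin n → ℝ) (hx : ∑ i, x i = 0) :
    1 / 4 * (x ⬝ᵥ x) ≤ n * (x ⬝ᵥ (gram c T *ᵥ x)) := by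
  have := le_quadratic_of_potential_lt q (posSemidef_half_matJ_add_sum c T) (by norm_num) h x
  rw [sum_vecMulVec_pairVec c hT] at this
  have hJ : matJ n *ᵥ x = 0 := by
    rw [matJ, Matrix.smul_mulVec, Matrix.vecMulVec_mulVec]
    simp [dotProduct, hx]
  rwa [Matrix.add_mulVec, Matrix.smul_mulVec, hJ, smul_zero, zero_add, Matrix.smul_mulVec,
    dotProduct_smul, smul_eq_mul] at this

/-- Half the expectation plus the starting matrix is `½ I`, whose potential is explicit. -/
theorem bernoulliMean_potential_pairs_le (q : ℕ) {c : ℝ} (hc : 0 < c) (hq : (q : ℝ) ≤ c / 2) :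
    bernoulliMean (pairs n) (fun B => (inclusionProb c B : ℝ)) (fun T =>
      potential q ((1 / 2 : ℝ) • matJ n +
        ∑ B ∈ T, Matrix.vecMulVec (pairVec c B) (pairVec c B))) ≤ n * ((2 / 3 : ℝ) ^ q) := by
  refine (bernoulliMean_potential_le q (pairs n) _ (pairVec c) (fun B _ => NNReal.coe_nonneg _)
    (fun B _ => by exact_mod_cast (min_le_left _ _ : inclusionProb c B ≤ 1)) (fun B hB => ?_)
    (posSemidef_half_matJ n)).trans_eq ?_
  · refine (pairVec_sq c hc hB).imp id fun h => ?_
    calc (q : ℝ) * (pairVec c B ⬝ᵥ pairVec c B) ≤ c / 2 * (1 / c) :=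
          mul_le_mul hq h (dotProduct_self_nonneg' _) (by positivity)
      _ = 1 / 2 := by field_simp
  · rw [sum_half_vecMulVec_pairVec hc, ← smul_add, add_comm (matJ n), matP_add_matJ, potential]
    have h1 : (1 + (1 / 2 : ℝ) • (1 : Matrix (Fin n) (Fin n) ℝ))⁻¹ =
        (2 / 3 : ℝ) • (1 : Matrix (Fin n) (Fin n) ℝ) := by
      refine Matrix.inv_eq_right_inv ?_
      rw [Matrix.mul_smul, Matrix.mul_one, smul_add, smul_smul, ← add_smul]
      norm_num
    rw [h1, smul_pow, one_pow, Matrix.trace_smul, Matrix.trace_one, Fintype.card_fin, smul_eq_mul,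
      mul_comm]

/-- Here `5/6 = (5/4)(2/3)`: the factor `2/3` comes from the mean potential and `4/5` from the
threshold for the eigenvalue `1/4`. -/
theorem mul_pow_le_of_log_le {δ : ℝ} (hδ : 0 < δ) (hn : 1 ≤ n) (q : ℕ)
    (hq : 6 * Real.log (2 * n / δ) ≤ q) : n * (5 / 6 : ℝ) ^ q ≤ δ / 2 := by
  have hn0 : (0 : ℝ) < n := by positivity
  have h1 : (5 / 6 : ℝ) ≤ Real.exp (-(1 / 6)) := by
    have := Real.add_one_le_exp (-(1 / 6) : ℝ)
    linarith
  have h2 : (5 / 6 : ℝ) ^ q ≤ Real.exp (-Real.log (2 * n / δ)) := by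
    calc (5 / 6 : ℝ) ^ q ≤ Real.exp (-(1 / 6)) ^ q := pow_le_pow_left₀ (by norm_num) h1 q
      _ = Real.exp (q * -(1 / 6)) := by rw [← Real.exp_nat_mul]
      _ ≤ _ := Real.exp_le_exp.2 (by linarith)
  rw [Real.exp_neg, Real.exp_log (by positivity)] at h2
  calc n * (5 / 6 : ℝ) ^ q ≤ n * (2 * n / δ)⁻¹ := mul_le_mul_of_nonneg_left h2 hn0.le
    _ = δ / 2 := by field_simp

/-- Accuracy of the estimate for a large oversampling parameter. -/
theorem le_toOuterMeasure_sampleLaw (hn : 2 ≤ n) (v : Finset (Fin n) → ℝ) {c ε δ : ℝ}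
    (hε : 0 < ε) (hδ : 0 < δ) (hδ1 : δ < 1)
    (hc : 32 * (Real.log (n / δ) + 1 / (ε * δ)) ≤ c) :
    ENNReal.ofReal (1 - δ) ≤ (sampleLaw n c).toOuterMeasure
      {T | objective v (estimate v c T) ≤ (1 + ε) * objective v (shapley v)} := by
  have hn1 : 1 ≤ n := by omega
  have hn0 : (0 : ℝ) < n := by positivity
  have hn2 : (2 : ℝ) ≤ n := by exact_mod_cast hn
  have hL : Real.log 2 ≤ Real.log (n / δ) := by
    refine Real.log_le_log two_pos ?_
    rw [le_div_iff₀ hδ]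
    nlinarith
  have hlog2 := Real.log_two_gt_d9
  have hεδ : 0 < 1 / (ε * δ) := by positivity
  have hc0 : 0 < c := by linarith
  have hlog : Real.log (2 * n / δ) ≤ 2 * Real.log (n / δ) := by
    rw [mul_div_assoc, Real.log_mul two_ne_zero (by positivity)]
    linarith
  -- The largest exponent for which vectors of squared norm at most `1 / c` count as short.
  set q := ⌊c / 2⌋₊ with hq
  have hq1 : (q : ℝ) ≤ c / 2 := Nat.floor_le (by positivity)
  have hq2 : c / 2 < q + 1 := Nat.lt_floor_add_one _
  have hq3 : 6 * Real.log (2 * n / δ) ≤ q := by linarith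
  set R := objective v (shapley v) with hR
  have hR0 : 0 ≤ R := by rw [hR, objective_shapley]; exact dotProduct_self_nonneg' _
  -- The sum of the two normalized quantities is at least 1 whenever the estimate is bad; each has
  -- mean at most `δ / 2`.
  refine le_toOuterMeasure_bernoulliSubset (pairs n) _ _ _ (fun T =>
    (5 / 4 : ℝ) ^ q * potential q ((1 / 2 : ℝ) • matJ n +
        ∑ B ∈ T, Matrix.vecMulVec (pairVec c B) (pairVec c B)) +
      16 * n / (ε * R) * (noise v c T ⬝ᵥ noise v c T)) ?_ ?_ ?_
  · intro T _
    have := potential_nonneg q (posSemidef_half_matJ_add_sum c T)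
    have := dotProduct_self_nonneg' (noise v c T)
    positivity
  · intro T hT hbad
    by_contra hlt
    push Not at hlt
    have h1 := potential_nonneg q (posSemidef_half_matJ_add_sum c T)
    have h2 := dotProduct_self_nonneg' (noise v c T)
    have h3 : 0 ≤ 16 * n / (ε * R) * (noise v c T ⬝ᵥ noise v c T) := by positivity
    have h4 : 0 ≤ (5 / 4 : ℝ) ^ q * potential q ((1 / 2 : ℝ) • matJ n +
        ∑ B ∈ T, Matrix.vecMulVec (pairVec c B) (pairVec c B)) := by positivity
    have h5 : potential q ((1 / 2 : ℝ) • matJ n +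
        ∑ B ∈ T, Matrix.vecMulVec (pairVec c B) (pairVec c B)) < ((1 + 1 / 4 : ℝ)⁻¹) ^ q := by
      rw [inv_pow, ← one_div, lt_div_iff₀ (by positivity), mul_comm]
      norm_num at hlt ⊢
      linarith
    have h6 := objective_estimate_le hn1 v c T (quadratic_of_potential_lt q hT h5)
    refine hbad (h6.trans ?_)
    rw [← hR, add_mul, one_mul, add_le_add_iff_left]
    -- If `R = 0`, the coefficient `16 n / (ε R)` is 0 by convention and carries no information; but
    -- then the residual, and with it the noise, vanishes identically.
    rcases hR0.eq_or_lt with h0 | h0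
    · have hres : residual v = 0 := by
        rw [hR, objective_shapley] at h0
        exact dotProduct_self_eq_zero.1 h0.symm
      have : noise v c T = 0 := by
        ext i
        simp [noise, hres]
      rw [this, ← h0]
      simp
    · have h7 : 16 * n / (ε * R) * (noise v c T ⬝ᵥ noise v c T) < 1 := by linarith
      rw [div_mul_eq_mul_div, div_lt_one (by positivity)] at h7
      exact h7.le
  · rw [bernoulliMean_add, bernoulliMean_const_mul, bernoulliMean_const_mul]
    have h1 := bernoulliMean_potential_pairs_le (n := n) q hc0 hq1
    have h2 := bernoulliMean_noise_le hn1 v hc0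
    have h3 := mul_pow_le_of_log_le hδ hn1 q hq3
    have h4 : (5 / 6 : ℝ) ^ q = (5 / 4) ^ q * (2 / 3) ^ q := by rw [← mul_pow]; norm_num
    have h5 : 16 * n / (ε * R) * (R / (n * c)) ≤ δ / 2 := by
      rcases hR0.eq_or_lt with h0 | h0
      · rw [← h0]; simp; positivity
      · have : 16 * n / (ε * R) * (R / (n * c)) = 16 / (ε * c) := by field_simp
        rw [this, div_le_iff₀ (by positivity)]
        have h6 : 32 * (1 / (ε * δ)) ≤ c := by linarith
        rw [mul_one_div, div_le_iff₀ (by positivity)] at h6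
        linarith
    have h6 : (5 / 4 : ℝ) ^ q * (n * (2 / 3) ^ q) ≤ δ / 2 := by
      rw [h4] at h3; linarith
    have h7 := mul_le_mul_of_nonneg_left h1 (by positivity : (0 : ℝ) ≤ (5 / 4) ^ q)
    have h8 := mul_le_mul_of_nonneg_left h2 (by positivity : (0 : ℝ) ≤ 16 * n / (ε * R))
    linarith

theorem IsOversampling.le {m : ℕ} {c : ℝ} (h : IsOversampling n m c) (hn : 1 ≤ n) :
    (m : ℝ) - 2 ≤ (n - 1) * (2 * c) := by
  rw [h]
  refine (Finset.sum_le_card_nsmul _ _ (2 * c) fun s hs => ?_).trans_eq ?_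
  · rw [min_one_mul_choose (Finset.mem_Ico.1 hs).2.le]
    exact min_le_right _ _
  · rw [nsmul_eq_mul, Nat.card_Ico, Nat.cast_sub hn, Nat.cast_one]

theorem isOversampling_two_pow (hn : 1 ≤ n) {c : ℝ} (hc : (2 : ℝ) ^ n ≤ c) :
    IsOversampling n (2 ^ n) c := by
  rw [IsOversampling]
  push_cast
  rw [← sum_choose_Ico hn]
  refine Finset.sum_congr rfl fun s hs => ?_
  have hs' := (Finset.mem_Ico.1 hs).2.le
  rw [min_one_mul_choose hs', min_eq_left]
  have h1 : (n.choose s : ℝ) ≤ 2 ^ n := by exact_mod_cast Nat.choose_le_two_pow n s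
  have h2 : (0 : ℝ) ≤ 2 ^ n := by positivity
  linarith

/-- One accurate parameter is enough, since the law of the run will be the one prescribed by every
admissible `c`. If `2 ^ n ≤ m`, every large `c` is admissible; otherwise each of the `n - 1` sizes
contributes at most `2 c` to the budget, which bounds `c` from below. For `n = 1` there are no rows.
-/
theorem exists_accurate (hn : 1 ≤ n) (v : Finset (Fin n) → ℝ) {m : ℕ} (hm : 2 ≤ m) {ε δ : ℝ}
    (hε : 0 < ε) (hδ : 0 < δ) (hδ1 : δ < 1)
    (hC : 256 * (n * Real.log (n / δ) + n / (ε * δ)) ≤ m) :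
    ∃ c, IsOversampling n (min m (2 ^ n)) c ∧
      ENNReal.ofReal (1 - δ) ≤ (sampleLaw n c).toOuterMeasure
      {T | objective v (estimate v c T) ≤ (1 + ε) * objective v (shapley v)} := by
  obtain ⟨c, hc⟩ := exists_isOversampling hn hm
  rcases hn.eq_or_lt with rfl | hn2
  · refine ⟨c, hc, ?_⟩
    have : ∀ x, objective v x = 0 := by
      intro x
      have : IsEmpty (Row 1) := ⟨fun z => by have := z.2; omega⟩
      rw [objective, norm_toLp_sq, dotProduct]
      simp
    simp only [this, mul_zero, le_refl, Set.ofPred_true]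
    rw [(PMF.toOuterMeasure_apply_eq_one_iff _ _).2 (Set.subset_univ _)]
    exact ENNReal.ofReal_le_one.2 (by linarith)
  · rcases le_or_gt (2 ^ n) m with hmn | hmn
    · rw [min_eq_right hmn]
      refine ⟨max (2 ^ n) (32 * (Real.log (n / δ) + 1 / (ε * δ))),
        isOversampling_two_pow hn (le_max_left _ _), ?_⟩
      exact le_toOuterMeasure_sampleLaw hn2 v hε hδ hδ1 (le_max_right _ _)
    · refine ⟨c, hc, le_toOuterMeasure_sampleLaw hn2 v hε hδ hδ1 ?_⟩
      rw [min_eq_left hmn.le] at hc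
      have h1 := hc.le hn
      have hn2' : (2 : ℝ) ≤ n := by exact_mod_cast hn2
      have hL : Real.log 2 ≤ Real.log (n / δ) := by
        refine Real.log_le_log two_pos ?_
        rw [le_div_iff₀ hδ]
        nlinarith
      have hlog2 := Real.log_two_gt_d9
      have hεδ : 0 < 1 / (ε * δ) := by positivity
      set L := Real.log (n / δ) + 1 / (ε * δ) with hLdef
      have hL0 : (1 / 2 : ℝ) ≤ L := by linarith
      have h2 : 256 * (n * L) ≤ m := by
        refine le_trans (le_of_eq ?_) hC
        rw [hLdef]; ring
      have h3 : 128 * (n * L) ≤ (n - 1) * (2 * c) := by nlinarith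
      have hc0 : 0 ≤ c := hc.nonneg hn2 hm
      have h4 : n * (64 * L) ≤ n * c := by nlinarith
      have h5 := le_of_mul_le_mul_left h4 (by linarith)
      linarith

end Accuracy

/-! ### Couplings of laws -/

section Coupling

variable {α β γ κ : Type}

/-- A coupling of `μ` and `ρ` that is supported on `Q`. -/
def Couple (μ : PMF α) (ρ : PMF β) (Q : α → β → Prop) : Prop :=
  ∃ ν : PMF (α × β), ν.map Prod.fst = μ ∧ ν.map Prod.snd = ρ ∧ ∀ x ∈ ν.support, Q x.1 x.2

theorem Couple.mono {μ : PMF α} {ρ : PMF β} {Q Q' : α → β → Prop} (h : Couple μ ρ Q)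
    (hQ : ∀ a b, Q a b → Q' a b) : Couple μ ρ Q' := by
  obtain ⟨ν, h1, h2, h3⟩ := h
  exact ⟨ν, h1, h2, fun x hx => hQ _ _ (h3 x hx)⟩

theorem couple_refl (μ : PMF α) : Couple μ μ Eq := by
  refine ⟨μ.map fun a => (a, a), ?_, ?_, ?_⟩
  · rw [PMF.map_comp]; exact PMF.map_id μ
  · rw [PMF.map_comp]; exact PMF.map_id μ
  · intro x hx
    rw [PMF.support_map] at hx
    obtain ⟨a, -, rfl⟩ := hx
    rfl

/-- Against a point mass a coupling is just a statement on the support; deterministic stages enter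
couplings in this way. -/
theorem couple_of_support (a : α) {ρ : PMF β} {Q : α → β → Prop} (h : ∀ b ∈ ρ.support, Q a b) :
    Couple (PMF.pure a) ρ Q := by
  refine ⟨ρ.map fun b => (a, b), ?_, ?_, ?_⟩
  · rw [PMF.map_comp]; exact PMF.map_const ρ a
  · rw [PMF.map_comp]; exact PMF.map_id ρ
  · intro x hx
    rw [PMF.support_map] at hx
    obtain ⟨b, hb, rfl⟩ := hx
    exact h b hb

theorem couple_pure {a : α} {b : β} {Q : α → β → Prop} (h : Q a b) :
    Couple (PMF.pure a) (PMF.pure b) Q :=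
  couple_of_support a fun b' hb' => by
    rw [PMF.support_pure, Set.mem_singleton_iff] at hb'
    rwa [hb']

/-- Glue the couplings of the continuations. Off `Q`, which has probability zero, the independent
product is used, so that the marginals are right at every pair. -/
theorem Couple.bind {μ : PMF α} {ρ : PMF β} {Q : α → β → Prop} (h : Couple μ ρ Q)
    {f : α → PMF γ} {g : β → PMF κ} {Q' : γ → κ → Prop}
    (hfg : ∀ a b, Q a b → Couple (f a) (g b) Q') : Couple (μ.bind f) (ρ.bind g) Q' := by
  classical
  obtain ⟨ν, h1, h2, h3⟩ := h
  let F : α × β → PMF (γ × κ) := fun x =>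
    if hx : Q x.1 x.2 then (hfg _ _ hx).choose
    else (f x.1).bind fun c => (g x.2).map fun d => (c, d)
  have hF1 : ∀ x, (F x).map Prod.fst = f x.1 := by
    intro x
    simp only [F]
    split_ifs with hx
    · exact (hfg _ _ hx).choose_spec.1
    · rw [PMF.map_bind]
      simp only [PMF.map_comp]
      exact (congrArg _ (funext fun c => PMF.map_const (g x.2) c)).trans (PMF.bind_pure _)
  have hF2 : ∀ x, (F x).map Prod.snd = g x.2 := by
    intro x
    simp only [F]
    split_ifs with hx
    · exact (hfg _ _ hx).choose_spec.2.1
    · rw [PMF.map_bind]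
      simp only [PMF.map_comp, Function.comp_def]
      rw [PMF.bind_const]
      exact PMF.map_id _
  refine ⟨ν.bind F, ?_, ?_, ?_⟩
  · rw [PMF.map_bind, ← h1, PMF.bind_map]
    exact congrArg ν.bind (funext hF1)
  · rw [PMF.map_bind, ← h2, PMF.bind_map]
    exact congrArg ν.bind (funext hF2)
  · intro y hy
    rw [PMF.mem_support_bind_iff] at hy
    obtain ⟨x, hx, hy⟩ := hy
    have hQ := h3 x hx
    simp only [F, dif_pos hQ] at hy
    exact (hfg _ _ hQ).choose_spec.2.2 y hy

theorem Couple.map_eq {μ : PMF α} {ρ : PMF β} {Q : α → β → Prop} (h : Couple μ ρ Q)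
    {f : α → γ} {g : β → γ} (hfg : ∀ a b, Q a b → f a = g b) : μ.map f = ρ.map g := by
  obtain ⟨ν, h1, h2, h3⟩ := h
  rw [← h1, ← h2, PMF.map_comp, PMF.map_comp, ← PMF.bind_pure_comp, ← PMF.bind_pure_comp]
  ext c
  rw [PMF.bind_apply, PMF.bind_apply]
  refine tsum_congr fun x => ?_
  by_cases hx : ν x = 0
  · rw [hx, zero_mul, zero_mul]
  · simp only [Function.comp_apply]
    rw [hfg _ _ (h3 x ((PMF.mem_support_iff _ _).2 hx))]

theorem Couple.exists_of_mem_support {μ : PMF α} {ρ : PMF β} {Q : α → β → Prop}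
    (h : Couple μ ρ Q) {b : β} (hb : b ∈ ρ.support) : ∃ a ∈ μ.support, Q a b := by
  obtain ⟨ν, h1, h2, h3⟩ := h
  rw [← h2, PMF.support_map] at hb
  obtain ⟨x, hx, rfl⟩ := hb
  refine ⟨x.1, ?_, h3 x hx⟩
  rw [← h1, PMF.support_map]
  exact ⟨x, hx, rfl⟩

theorem Couple.and_right {μ : PMF α} {ρ : PMF β} {Q : α → β → Prop} {P : β → Prop}
    (h : Couple μ ρ Q) (hP : ∀ b ∈ ρ.support, P b) : Couple μ ρ fun a b => Q a b ∧ P b := by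
  obtain ⟨ν, h1, h2, h3⟩ := h
  refine ⟨ν, h1, h2, fun x hx => ⟨h3 x hx, hP _ ?_⟩⟩
  rw [← h2, PMF.support_map]
  exact ⟨x, hx, rfl⟩

theorem Couple.and_left {μ : PMF α} {ρ : PMF β} {Q : α → β → Prop} {P : α → Prop}
    (h : Couple μ ρ Q) (hP : ∀ a ∈ μ.support, P a) : Couple μ ρ fun a b => Q a b ∧ P a := by
  obtain ⟨ν, h1, h2, h3⟩ := h
  refine ⟨ν, h1, h2, fun x hx => ⟨h3 x hx, hP _ ?_⟩⟩
  rw [← h1, PMF.support_map]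
  exact ⟨x, hx, rfl⟩

theorem Couple.iterate {f : ℕ → α → PMF α} {g : ℕ → β → PMF β} {Q : ℕ → α → β → Prop}
    {a : α} {b : β} (h0 : Q 0 a b) (N : ℕ)
    (hs : ∀ k < N, ∀ a b, Q k a b → Couple (f k a) (g k b) (Q (k + 1))) :
    Couple (iterate f N a) (iterate g N b) (Q N) := by
  induction N with
  | zero => exact couple_pure h0
  | succ N ih =>
    exact (ih fun k hk => hs k (hk.trans N.lt_succ_self)).bind (hs N N.lt_succ_self)

theorem iterate_support {f : ℕ → α → PMF α} {Q : ℕ → α → Prop} {a : α} (h0 : Q 0 a) (N : ℕ)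
    (hs : ∀ k < N, ∀ a, Q k a → ∀ b ∈ (f k a).support, Q (k + 1) b) :
    ∀ b ∈ (iterate f N a).support, Q N b := by
  induction N with
  | zero =>
    intro b hb
    simp only [iterate, PMF.support_pure, Set.mem_singleton_iff] at hb
    rwa [hb]
  | succ N ih =>
    intro b hb
    simp only [iterate, PMF.mem_support_bind_iff] at hb
    obtain ⟨c, hc, hb⟩ := hb
    exact hs N N.lt_succ_self c (ih (fun k hk => hs k (hk.trans N.lt_succ_self)) c hc) b hb

end Coupling

/-! ### Hoare logic, framing and a generic time bound -/

section Hoare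

variable {n : ℕ}

/-- Every possible final state satisfies `Q`. -/
def Holds (v : Finset (Fin n) → ℝ) (p : Cmd) (σ : State n) (Q : State n → Prop) : Prop :=
  ∀ τ ∈ (p.run v σ).support, Q τ

variable {v : Finset (Fin n) → ℝ} {σ : State n} {Q : State n → Prop}

theorem Holds.mono {p : Cmd} {Q' : State n → Prop} (h : Holds v p σ Q) (hQ : ∀ τ, Q τ → Q' τ) :
    Holds v p σ Q' := fun τ hτ => hQ τ (h τ hτ)

theorem Holds.and {p : Cmd} {Q' : State n → Prop} (h : Holds v p σ Q) (h' : Holds v p σ Q') :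
    Holds v p σ fun τ => Q τ ∧ Q' τ := fun τ hτ => ⟨h τ hτ, h' τ hτ⟩

theorem holds_skip : Holds v .skip σ Q ↔ Q σ := by simp [Holds, Cmd.run]

theorem holds_seq {p q : Cmd} :
    Holds v (.seq p q) σ Q ↔ Holds v p σ fun τ => Holds v q τ Q := by
  simp only [Holds, Cmd.run, PMF.mem_support_bind_iff]
  exact ⟨fun h τ hτ ρ hρ => h ρ ⟨τ, hτ, hρ⟩, fun h ρ ⟨τ, hτ, hρ⟩ => h τ hτ ρ hρ⟩

theorem holds_setNat {a : ℕ} {i e : NExp} : Holds v (.setNat a i e) σ Q ↔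
    Q ((σ.putNat a (i.eval σ) (e.eval σ)).tick (i.size + e.size + 1)) := by
  simp [Holds, Cmd.run]

theorem holds_setReal {a : ℕ} {i : NExp} {e : RExp} : Holds v (.setReal a i e) σ Q ↔
    Q ((σ.putReal a (i.eval σ) (e.eval σ)).tick (i.size + e.size + 1)) := by
  simp [Holds, Cmd.run]

theorem holds_ite {b : BExp} {p q : Cmd} : Holds v (.ite b p q) σ Q ↔
    (b.eval σ → Holds v p (σ.tick (b.size + 1)) Q) ∧
      (¬b.eval σ → Holds v q (σ.tick (b.size + 1)) Q) := by
  by_cases h : b.eval σ <;> simp [Holds, Cmd.run, h]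

theorem holds_query {a : ℕ} {i : NExp} {b : ℕ} : Holds v (.query a i b) σ Q ↔
    Q { (σ.putReal a (i.eval σ) (v (σ.readSet b))).tick (i.size + 1) with
        queries := σ.readSet b :: σ.queries } := by
  simp [Holds, Cmd.run]

theorem holds_coin {a : ℕ} {i : NExp} {e : RExp} (h : ∀ x ≤ 1,
    Q ((σ.putNat a (i.eval σ) x).tick (i.size + e.size + 1))) : Holds v (.coin a i e) σ Q := by
  intro τ hτ
  rw [Cmd.run, PMF.support_map] at hτ
  obtain ⟨r, -, rfl⟩ := hτ
  exact h _ (by split_ifs <;> omega)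

/-- The integer arrays a program writes to. -/
def Cmd.natWrites : Cmd → List ℕ
  | .skip => []
  | .seq p q => p.natWrites ++ q.natWrites
  | .setNat a _ _ => [a]
  | .setReal _ _ _ => []
  | .ite _ p q => p.natWrites ++ q.natWrites
  | .loop x _ p => x :: p.natWrites
  | .coin a _ _ => [a]
  | .query _ _ _ => []

/-- The real arrays a program writes to. -/
def Cmd.realWrites : Cmd → List ℕ
  | .skip => []
  | .seq p q => p.realWrites ++ q.realWrites
  | .setNat _ _ _ => []
  | .setReal a _ _ => [a]
  | .ite _ p q => p.realWrites ++ q.realWrites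
  | .loop _ _ p => p.realWrites
  | .coin _ _ _ => []
  | .query a _ _ => [a]

/-- A program without queries. -/
def Cmd.queryFree : Cmd → Bool
  | .seq p q => p.queryFree && q.queryFree
  | .ite _ p q => p.queryFree && q.queryFree
  | .loop _ _ p => p.queryFree
  | .query _ _ _ => false
  | _ => true

/-- What a run of `p` from `σ` to `τ` leaves unchanged. -/
structure Frame (p : Cmd) (σ τ : State n) : Prop where
  nat : ∀ a, a ∉ p.natWrites → τ.nat a = σ.nat a
  real : ∀ a, a ∉ p.realWrites → τ.real a = σ.real a
  queries : p.queryFree = true → τ.queries = σ.queries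

theorem Frame.trans {p : Cmd} {σ τ ρ : State n} (h : Frame p σ τ) (h' : Frame p τ ρ) :
    Frame p σ ρ :=
  ⟨fun a ha => (h'.nat a ha).trans (h.nat a ha), fun a ha => (h'.real a ha).trans (h.real a ha),
    fun hq => (h'.queries hq).trans (h.queries hq)⟩

theorem frame_tick (p : Cmd) (σ : State n) (k : ℕ) : Frame p σ (σ.tick k) :=
  ⟨fun _ _ => rfl, fun _ _ => rfl, fun _ => rfl⟩

/-- The written arrays are computed from the program text, so for concrete programs what is
preserved can be settled by `decide`. -/
theorem holds_frame (p : Cmd) (σ : State n) : Holds v p σ (Frame p σ) := by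
  induction p generalizing σ with
  | skip => exact holds_skip.2 ⟨fun _ _ => rfl, fun _ _ => rfl, fun _ => rfl⟩
  | seq p q hp hq =>
    refine holds_seq.2 fun τ hτ ρ hρ => ?_
    obtain ⟨h1, h2, h3⟩ := hp σ τ hτ
    obtain ⟨h4, h5, h6⟩ := hq τ ρ hρ
    refine ⟨fun a ha => ?_, fun a ha => ?_, fun h => ?_⟩
    · simp only [Cmd.natWrites, List.mem_append, not_or] at ha
      rw [h4 a ha.2, h1 a ha.1]
    · simp only [Cmd.realWrites, List.mem_append, not_or] at ha
      rw [h5 a ha.2, h2 a ha.1]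
    · simp only [Cmd.queryFree, Bool.and_eq_true] at h
      rw [h6 h.2, h3 h.1]
  | setNat a i e =>
    refine holds_setNat.2 ⟨fun b hb => ?_, fun _ _ => rfl, fun _ => rfl⟩
    simp only [Cmd.natWrites, List.mem_singleton] at hb
    simp [State.putNat, State.tick, hb]
  | setReal a i e =>
    refine holds_setReal.2 ⟨fun _ _ => rfl, fun b hb => ?_, fun _ => rfl⟩
    simp only [Cmd.realWrites, List.mem_singleton] at hb
    simp [State.putReal, State.tick, hb]
  | ite b p q hp hq =>
    refine holds_ite.2 ⟨fun _ => (hp _).mono ?_, fun _ => (hq _).mono ?_⟩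
    · rintro τ ⟨h1, h2, h3⟩
      refine ⟨fun a ha => ?_, fun a ha => ?_, fun h => ?_⟩
      · simp only [Cmd.natWrites, List.mem_append, not_or] at ha
        exact h1 a ha.1
      · simp only [Cmd.realWrites, List.mem_append, not_or] at ha
        exact h2 a ha.1
      · simp only [Cmd.queryFree, Bool.and_eq_true] at h
        exact h3 h.1
    · rintro τ ⟨h1, h2, h3⟩
      refine ⟨fun a ha => ?_, fun a ha => ?_, fun h => ?_⟩
      · simp only [Cmd.natWrites, List.mem_append, not_or] at ha
        exact h1 a ha.2
      · simp only [Cmd.realWrites, List.mem_append, not_or] at ha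
        exact h2 a ha.2
      · simp only [Cmd.queryFree, Bool.and_eq_true] at h
        exact h3 h.2
  | loop x e p hp =>
    refine iterate_support (Q := fun _ => Frame (.loop x e p) σ) (frame_tick _ σ _) _ ?_
    intro k _ τ hτ ρ hρ
    refine hτ.trans ?_
    obtain ⟨h1, h2, h3⟩ := hp _ ρ hρ
    refine ⟨fun a ha => ?_, fun a ha => h2 a ha, fun h => h3 h⟩
    simp only [Cmd.natWrites, List.mem_cons, not_or] at ha
    rw [h1 a ha.2]
    simp [State.putNat, State.tick, ha.1]
  | coin a i e =>
    refine holds_coin fun x _ => ⟨fun b hb => ?_, fun _ _ => rfl, fun _ => rfl⟩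
    simp only [Cmd.natWrites, List.mem_singleton] at hb
    simp [State.putNat, State.tick, hb]
  | query a i b =>
    refine holds_query.2 ⟨fun _ _ => rfl, fun c hc => ?_, fun h => by simp [Cmd.queryFree] at h⟩
    simp only [Cmd.realWrites, List.mem_singleton] at hc
    simp [State.putReal, State.tick, hc]

theorem Holds.with_frame {p : Cmd} (h : Holds v p σ Q) :
    Holds v p σ fun τ => Frame p σ τ ∧ Q τ := (holds_frame p σ).and h

/-- The rule for loops: an invariant, together with all that the loop does not write to. -/
theorem holds_loop {x : ℕ} {e : NExp} {p : Cmd} (Inv : ℕ → State n → Prop)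
    (h0 : Inv 0 (σ.tick (e.size + 1)))
    (hs : ∀ k < e.eval σ, ∀ τ, Frame (.loop x e p) σ τ → Inv k τ →
      Holds v p ((τ.putNat x 0 k).tick 1) (Inv (k + 1)))
    (hQ : ∀ τ, Frame (.loop x e p) σ τ → Inv (e.eval σ) τ → Q τ) :
    Holds v (.loop x e p) σ Q := by
  have h : Holds v (.loop x e p) σ (Inv (e.eval σ)) := by
    have := iterate_support
      (f := fun k τ => p.run v ((τ.putNat x 0 k).tick 1))
      (Q := fun k τ => Frame (.loop x e p) σ τ ∧ Inv k τ)
      (a := σ.tick (e.size + 1)) ⟨frame_tick _ σ _, h0⟩ (e.eval σ) (fun k hk τ hτ ρ hρ =>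
        ⟨hτ.1.trans ?_, hs k hk τ hτ.1 hτ.2 ρ hρ⟩)
    · exact fun τ hτ => (this τ hτ).2
    · obtain ⟨h1, h2, h3⟩ := holds_frame p _ ρ hρ
      refine ⟨fun a ha => ?_, fun a ha => h2 a ha, fun h => h3 h⟩
      simp only [Cmd.natWrites, List.mem_cons, not_or] at ha
      rw [h1 a ha.2]
      simp [State.putNat, State.tick, ha.1]
  exact h.with_frame.mono fun τ hτ => hQ τ hτ.1 hτ.2

/-- Loop bounds that do not exceed the input size `n`, kept in cell 0 of array 0. -/
def NExp.sizeBound : NExp → Bool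
  | .get 0 (.const 0) => true
  | .sub e _ => e.sizeBound
  | _ => false

theorem NExp.eval_le_of_sizeBound {e : NExp} (he : e.sizeBound = true) (σ : State n) :
    e.eval σ ≤ σ.nat 0 0 := by
  induction e with
  | const k => simp [NExp.sizeBound] at he
  | get a i ih =>
    rcases a with _ | a
    · cases i with
      | const k => rcases k with _ | k
                   · exact le_rfl
                   · simp [NExp.sizeBound] at he
      | get _ _ => simp [NExp.sizeBound] at he
      | add _ _ => simp [NExp.sizeBound] at he
      | sub _ _ => simp [NExp.sizeBound] at he
      | mul _ _ => simp [NExp.sizeBound] at he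
    · simp [NExp.sizeBound] at he
  | add e f _ _ => simp [NExp.sizeBound] at he
  | sub e f h1 _ => exact (Nat.sub_le _ _).trans (h1 he)
  | mul e f _ _ => simp [NExp.sizeBound] at he

/-- Programs all of whose loops are bounded by the input size, which they do not change. -/
def Cmd.polyLoops : Cmd → Bool
  | .seq p q => p.polyLoops && q.polyLoops
  | .ite _ p q => p.polyLoops && q.polyLoops
  | .loop x e p => x != 0 && e.sizeBound && p.polyLoops
  | .setNat a _ _ => a != 0
  | .coin a _ _ => a != 0
  | _ => true

/-- The depth of nested loops. -/
def Cmd.depth : Cmd → ℕ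
  | .seq p q => max p.depth q.depth
  | .ite _ p q => max p.depth q.depth
  | .loop _ _ p => p.depth + 1
  | _ => 0

/-- The number of operations in the text of a program. -/
def Cmd.textSize : Cmd → ℕ
  | .skip => 0
  | .seq p q => p.textSize + q.textSize
  | .setNat _ i e => i.size + e.size + 1
  | .setReal _ i e => i.size + e.size + 1
  | .ite b p q => b.size + 1 + p.textSize + q.textSize
  | .loop _ e p => e.size + 2 + p.textSize
  | .coin _ i e => i.size + e.size + 1
  | .query _ i _ => i.size + 1

theorem Cmd.zero_notMem_natWrites {p : Cmd} (hp : p.polyLoops = true) : 0 ∉ p.natWrites := by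
  induction p with
  | skip => simp [Cmd.natWrites]
  | seq p q h1 h2 =>
    simp only [Cmd.polyLoops, Bool.and_eq_true] at hp
    simp [Cmd.natWrites, h1 hp.1, h2 hp.2]
  | setNat a i e =>
    simp only [Cmd.polyLoops, bne_iff_ne, ne_eq] at hp
    simp only [Cmd.natWrites, List.mem_singleton]
    exact fun h => hp h.symm
  | setReal a i e => simp [Cmd.natWrites]
  | ite b p q h1 h2 =>
    simp only [Cmd.polyLoops, Bool.and_eq_true] at hp
    simp [Cmd.natWrites, h1 hp.1, h2 hp.2]
  | loop x e p h1 =>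
    simp only [Cmd.polyLoops, Bool.and_eq_true, bne_iff_ne, ne_eq] at hp
    simp only [Cmd.natWrites, List.mem_cons, not_or]
    exact ⟨fun h => hp.1.1 h.symm, h1 hp.2⟩
  | coin a i e =>
    simp only [Cmd.polyLoops, bne_iff_ne, ne_eq] at hp
    simp only [Cmd.natWrites, List.mem_singleton]
    exact fun h => hp h.symm
  | query a i b => simp [Cmd.natWrites]

/-- Each operation of the text is executed at most `N` times per enclosing loop. The integer array
0, which holds the loop bound, is never written. -/
theorem holds_time_le {p : Cmd} (hp : p.polyLoops = true) {N : ℕ} (hN : 1 ≤ N)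
    (hσ : σ.nat 0 0 = N) :
    Holds v p σ fun τ => τ.time ≤ σ.time + p.textSize * N ^ p.depth := by
  induction p generalizing σ with
  | skip => exact holds_skip.2 (by simp)
  | seq p q h1 h2 =>
    simp only [Cmd.polyLoops, Bool.and_eq_true] at hp
    refine holds_seq.2 ((h1 hp.1 hσ).with_frame.mono fun τ hτ =>
      (h2 hp.2 ?_).mono fun ρ hρ => ?_)
    · rw [hτ.1.nat 0 (Cmd.zero_notMem_natWrites hp.1), hσ]
    · have e1 := hτ.2
      have e2 : p.textSize * N ^ p.depth ≤ p.textSize * N ^ (max p.depth q.depth) :=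
        Nat.mul_le_mul_left _ (Nat.pow_le_pow_right hN (le_max_left _ _))
      have e3 : q.textSize * N ^ q.depth ≤ q.textSize * N ^ (max p.depth q.depth) :=
        Nat.mul_le_mul_left _ (Nat.pow_le_pow_right hN (le_max_right _ _))
      simp only [Cmd.textSize, Cmd.depth, add_mul]
      omega
  | setNat a i e => exact holds_setNat.2 (by simp [State.tick, State.putNat, Cmd.textSize, Cmd.depth])
  | setReal a i e => exact holds_setReal.2 (by simp [State.tick, State.putReal, Cmd.textSize, Cmd.depth])
  | ite b p q h1 h2 =>
    simp only [Cmd.polyLoops, Bool.and_eq_true] at hp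
    have e0 : 1 ≤ N ^ (max p.depth q.depth) := Nat.one_le_pow _ _ hN
    have e2 : p.textSize * N ^ p.depth ≤ p.textSize * N ^ (max p.depth q.depth) :=
      Nat.mul_le_mul_left _ (Nat.pow_le_pow_right hN (le_max_left _ _))
    have e3 : q.textSize * N ^ q.depth ≤ q.textSize * N ^ (max p.depth q.depth) :=
      Nat.mul_le_mul_left _ (Nat.pow_le_pow_right hN (le_max_right _ _))
    have e4 : b.size + 1 ≤ (b.size + 1) * N ^ (max p.depth q.depth) := Nat.le_mul_of_pos_right _ e0
    have key : ∀ (X : Cmd) (τ : State n), X.textSize * N ^ X.depth ≤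
        p.textSize * N ^ (max p.depth q.depth) + q.textSize * N ^ (max p.depth q.depth) →
        τ.time ≤ (σ.tick (b.size + 1)).time + X.textSize * N ^ X.depth →
        τ.time ≤ σ.time + (Cmd.ite b p q).textSize * N ^ (Cmd.ite b p q).depth := by
      intro X τ hX hτ
      have : (σ.tick (b.size + 1)).time = σ.time + (b.size + 1) := rfl
      have : (Cmd.ite b p q).textSize * N ^ (Cmd.ite b p q).depth =
        (b.size + 1) * N ^ (max p.depth q.depth) + p.textSize * N ^ (max p.depth q.depth) +
          q.textSize * N ^ (max p.depth q.depth) := by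
        simp only [Cmd.textSize, Cmd.depth, add_mul]
      omega
    refine holds_ite.2 ⟨fun _ => (h1 hp.1 (σ := σ.tick (b.size + 1)) hσ).mono fun τ hτ =>
        key p τ (by omega) hτ,
      fun _ => (h2 hp.2 (σ := σ.tick (b.size + 1)) hσ).mono fun τ hτ => key q τ (by omega) hτ⟩
  | loop x e p h1 =>
    simp only [Cmd.polyLoops, Bool.and_eq_true, bne_iff_ne, ne_eq] at hp
    have h0 : 0 ∉ (Cmd.loop x e p).natWrites :=
      Cmd.zero_notMem_natWrites (by simp [Cmd.polyLoops, hp])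
    refine holds_loop
      (fun k τ => τ.time ≤ σ.time + (e.size + 1) + k * (1 + p.textSize * N ^ p.depth)) ?_ ?_ ?_
    · simp [State.tick]
    · intro k _ τ hF hτ
      refine (h1 hp.2 (σ := (τ.putNat x 0 k).tick 1) ?_).mono fun ρ hρ => ?_
      · have : (0 : ℕ) ≠ x := fun h => hp.1.1 h.symm
        simp only [State.tick, State.putNat, Function.update_of_ne this]
        rw [hF.nat 0 h0, hσ]
      · have : ((τ.putNat x 0 k).tick 1).time = τ.time + 1 := rfl
        rw [add_mul (k : ℕ) 1]
        omega
    · intro τ _ hτ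
      have e1 : e.eval σ ≤ N := hσ ▸ NExp.eval_le_of_sizeBound hp.1.2 σ
      have e2 := Nat.mul_le_mul_right (1 + p.textSize * N ^ p.depth) e1
      have e3 : 1 ≤ N ^ (p.depth + 1) := Nat.one_le_pow _ _ hN
      have e4 : e.size + 1 ≤ (e.size + 1) * N ^ (p.depth + 1) := Nat.le_mul_of_pos_right _ e3
      have e5 : N ≤ N ^ (p.depth + 1) := Nat.le_self_pow (by omega) N
      have e6 : (Cmd.loop x e p).textSize * N ^ (Cmd.loop x e p).depth =
          (e.size + 1) * N ^ (p.depth + 1) + N ^ (p.depth + 1) +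
            N * (p.textSize * N ^ p.depth) := by
        simp only [Cmd.textSize, Cmd.depth, pow_succ]; ring
      have e7 : N * (1 + p.textSize * N ^ p.depth) = N + N * (p.textSize * N ^ p.depth) := by ring
      omega
  | coin a i e =>
    exact holds_coin fun x _ => by simp [State.tick, State.putNat, Cmd.textSize, Cmd.depth]
  | query a i b =>
    exact holds_query.2 (by simp [State.tick, State.putReal, Cmd.textSize, Cmd.depth])

end Hoare

/-! ### Reading and writing memory cells -/

section Memory

variable {n : ℕ} (σ : State n)

@[simp] theorem State.tick_nat (k : ℕ) : (σ.tick k).nat = σ.nat := rfl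
@[simp] theorem State.tick_real (k : ℕ) : (σ.tick k).real = σ.real := rfl
@[simp] theorem State.tick_queries (k : ℕ) : (σ.tick k).queries = σ.queries := rfl
@[simp] theorem State.tick_time (k : ℕ) : (σ.tick k).time = σ.time + k := rfl
@[simp] theorem State.putNat_real (a i x : ℕ) : (σ.putNat a i x).real = σ.real := rfl
@[simp] theorem State.putNat_queries (a i x : ℕ) : (σ.putNat a i x).queries = σ.queries := rfl
@[simp] theorem State.putNat_time (a i x : ℕ) : (σ.putNat a i x).time = σ.time := rfl
@[simp] theorem State.putReal_nat (a i : ℕ) (x : ℝ) : (σ.putReal a i x).nat = σ.nat := rfl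
@[simp] theorem State.putReal_queries (a i : ℕ) (x : ℝ) :
    (σ.putReal a i x).queries = σ.queries := rfl
@[simp] theorem State.putReal_time (a i : ℕ) (x : ℝ) : (σ.putReal a i x).time = σ.time := rfl

@[simp] theorem State.putNat_nat (a i x b j : ℕ) :
    (σ.putNat a i x).nat b j = if b = a ∧ j = i then x else σ.nat b j := by
  by_cases h : b = a
  · subst h
    simp [State.putNat, Function.update_apply]
  · simp [State.putNat, h]

theorem State.putNat_nat_of_ne {a b : ℕ} (h : b ≠ a) (i x : ℕ) :
    (σ.putNat a i x).nat b = σ.nat b := by simp [State.putNat, h]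

@[simp] theorem State.putReal_real (a i : ℕ) (x : ℝ) (b j : ℕ) :
    (σ.putReal a i x).real b j = if b = a ∧ j = i then x else σ.real b j := by
  by_cases h : b = a
  · subst h
    simp [State.putReal, Function.update_apply]
  · simp [State.putReal, h]

theorem State.putReal_real_of_ne {a b : ℕ} (h : b ≠ a) (i : ℕ) (x : ℝ) :
    (σ.putReal a i x).real b = σ.real b := by simp [State.putReal, h]

attribute [simp] NExp.eval RExp.eval BExp.eval

/-- An injective numbering of pairs, for two-dimensional arrays. -/
def idx (a k : ℕ) : ℕ := (a + k) * (a + k) + a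

-- With `s = a + k` the index lies between `s²` and `s² + s`, and these intervals are disjoint for
-- different `s`.
@[simp] theorem idx_inj {a k a' k' : ℕ} : idx a k = idx a' k' ↔ a = a' ∧ k = k' := by
  refine ⟨fun h => ?_, fun ⟨h1, h2⟩ => by rw [h1, h2]⟩
  rw [idx, idx] at h
  have h1 : a + k = a' + k' := by
    rcases lt_trichotomy (a + k) (a' + k') with hlt | heq | hlt
    · nlinarith
    · exact heq
    · nlinarith
  rw [h1] at h
  omega

/-- The expression for `idx`. -/
def NExp.ix (a k : NExp) : NExp := .add (.mul (.add a k) (.add a k)) a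

@[simp] theorem NExp.eval_ix (a k : NExp) :
    (NExp.ix a k).eval σ = idx (a.eval σ) (k.eval σ) := rfl

end Memory

/-! ### Notation for programs -/

section Abbreviations

/-- The input size. -/
abbrev NExp.dim : NExp := .get 0 (.const 0)

/-- The counter of an outermost loop. -/
abbrev NExp.i : NExp := .get 5 (.const 0)

/-- The counter of a loop inside another loop. -/
abbrev NExp.j : NExp := .get 6 (.const 0)

/-- The counter of an innermost loop. -/
abbrev NExp.l : NExp := .get 7 (.const 0)

/-- The successor. -/
abbrev NExp.succ (e : NExp) : NExp := .add e (.const 1)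

/-- A natural number constant as a real. -/
abbrev RExp.const (k : ℕ) : RExp := .ofNat (.const k)

/-- Run a list of programs one after the other. -/
abbrev Cmd.list : List Cmd → Cmd
  | [] => .skip
  | [p] => p
  | p :: q :: ps => .seq p (Cmd.list (q :: ps))

end Abbreviations

/-! ### Tables, water level and emptiness probabilities -/

section Setup

variable {n : ℕ} {v : Finset (Fin n) → ℝ}

/-- Tables of the powers of two and of the binomial coefficients. -/
def tables : Cmd := .list [
  .setNat 2 (.const 0) (.const 1),
  .setReal 1 (.const 0) (.const 1),
  .loop 5 .dim (.list [
    .setNat 2 (.succ .i) (.add (.get 2 .i) (.get 2 .i)),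
    .setReal 1 (.succ .i)
      (.div (.mul (.get 1 .i) (.ofNat (.sub .dim .i))) (.ofNat (.succ .i)))])]

theorem holds_tables {σ : State n} (hn : σ.nat 0 0 = n) :
    Holds v tables σ fun τ => (∀ t ≤ n, τ.nat 2 t = 2 ^ t) ∧ ∀ t ≤ n, τ.real 1 t = n.choose t := by
  rw [tables]
  simp only [Cmd.list, holds_seq, holds_setNat, holds_setReal]
  refine holds_loop (fun k τ => (∀ t ≤ k, τ.nat 2 t = 2 ^ t) ∧ ∀ t ≤ k, τ.real 1 t = n.choose t)
    ?_ ?_ ?_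
  · simp
  · intro k hk τ hF ⟨h1, h2⟩
    have hn' := hF.nat 0 (by decide)
    simp [hn] at hk
    simp only [holds_seq, holds_setNat, holds_setReal]
    refine ⟨fun t ht => ?_, fun t ht => ?_⟩
    · rcases ht.lt_or_eq with h | rfl
      · simp [h1 t (by omega), h.ne]
      · simp [h1 k le_rfl, pow_succ]; ring
    · rcases ht.lt_or_eq with h | rfl
      · simp [h2 t (by omega), h.ne]
      · simp [h2 k le_rfl, hn', hn]
        rw [div_eq_iff (by positivity)]
        have := Nat.choose_succ_right_eq n k
        exact_mod_cast this.symm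
  · intro τ _ h
    simpa [hn] using h

/-- The expected number of sampled sets `min(m, 2ⁿ) - 2`. -/
def budget : Cmd :=
  .ite (.natLt (.get 0 (.const 1)) (.get 2 .dim))
    (.setReal 3 (.const 1) (.sub (.ofNat (.get 0 (.const 1))) (.const 2)))
    (.setReal 3 (.const 1) (.sub (.ofNat (.get 2 .dim)) (.const 2)))

theorem holds_budget {σ : State n} {m : ℕ} (hn : σ.nat 0 0 = n) (hm : σ.nat 0 1 = m)
    (h2 : σ.nat 2 n = 2 ^ n) :
    Holds v budget σ fun τ => τ.real 3 1 = ((min m (2 ^ n) : ℕ) : ℝ) - 2 := by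
  rw [budget, holds_ite]
  simp only [holds_setReal, BExp.eval, NExp.eval, hn, hm, h2]
  refine ⟨fun h => ?_, fun h => ?_⟩
  · rw [min_eq_left h.le]; simp [hm]
  · rw [min_eq_right (not_lt.1 h)]; simp [hn, h2]

/-- The water level that determines the inclusion probabilities. -/
def level : Cmd :=
  .loop 5 (.sub .dim (.const 1)) (.list [
    .setReal 3 (.const 0) (.get 3 (.const 1)),
    .setNat 13 (.const 0) (.const 0),
    .loop 6 (.sub .dim (.const 1))
      (.ite (.realLt (.get 1 (.succ .j)) (.get 1 (.succ .i)))
        (.setReal 3 (.const 0) (.sub (.get 3 (.const 0)) (.get 1 (.succ .j))))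
        (.setNat 13 (.const 0) (.succ (.get 13 (.const 0))))),
    .setReal 3 (.const 0) (.div (.get 3 (.const 0)) (.ofNat (.get 13 (.const 0)))),
    .ite (.realLt (.get 2 (.const 0)) (.get 3 (.const 0)))
      (.setReal 2 (.const 0) (.get 3 (.const 0))) .skip])

/-- Computes all candidate levels and keeps the maximum, starting from 0. The scratch cells hold the
remaining budget and the number of unsaturated sizes; a loop counter `k` stands for the size `k +
1`. -/
theorem holds_level {σ : State n} {m : ℕ} (hn1 : 1 ≤ n) (hn : σ.nat 0 0 = n)
    (hB : ∀ t ≤ n, σ.real 1 t = n.choose t) (hM : σ.real 3 1 = (m : ℝ) - 2)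
    (h0 : σ.real 2 0 = 0) : Holds v level σ fun τ => IsMaxLevel n m (τ.real 2 0) := by
  rw [level]
  refine holds_loop (fun k τ => τ.real 3 1 = (m : ℝ) - 2 ∧ 0 ≤ τ.real 2 0 ∧
    (∀ t ∈ Finset.Ico 1 (k + 1), candidateLevel n m t ≤ τ.real 2 0) ∧
    (τ.real 2 0 = 0 ∨ ∃ t ∈ Finset.Ico 1 (k + 1), τ.real 2 0 = candidateLevel n m t)) ?_ ?_ ?_
  · simp [hM, h0]
  · intro k hk τ hF ⟨h1, h2, h3, h4⟩
    have hn' := hF.nat 0 (by decide)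
    have hB' := hF.real 1 (by decide)
    simp [hn] at hk
    simp only [Cmd.list, holds_seq, holds_setNat, holds_setReal]
    refine holds_loop (fun u ρ => ρ.real 3 1 = (m : ℝ) - 2 ∧ ρ.real 3 0 = (m : ℝ) - 2 -
        ∑ s ∈ Finset.Ico 1 (u + 1) with (n.choose s : ℝ) < n.choose (k + 1), (n.choose s : ℝ) ∧
      ρ.nat 13 0 = ((Finset.Ico 1 (u + 1)).filter
        fun s => ¬(n.choose s : ℝ) < n.choose (k + 1)).card) ?_ ?_ ?_
    · simp [h1]
    · intro u hu ρ hG ⟨g0, g1, g2⟩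
      simp [hn', hn] at hu
      have hBk := hG.real 1 (by decide)
      have h5 := congrFun (hG.nat 5 (by decide)) 0
      simp [State.putReal_real_of_ne] at hBk h5
      rw [holds_ite]
      simp only [holds_setNat, holds_setReal]
      have e1 : ρ.real 1 (u + 1) = n.choose (u + 1) := by rw [hBk, hB', hB _ (by omega)]
      have e2 : ρ.real 1 (k + 1) = n.choose (k + 1) := by rw [hBk, hB', hB _ (by omega)]
      rw [show u + 1 + 1 = (u + 1) + 1 from rfl,
        ← Finset.insert_Ico_right_eq_Ico_add_one (by omega : 1 ≤ u + 1), Finset.filter_insert,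
        Finset.filter_insert]
      have hnot : ∀ (P : ℕ → Prop) [DecidablePred P], u + 1 ∉ (Finset.Ico 1 (u + 1)).filter P := by
        simp
      simp only [BExp.eval, RExp.eval, NExp.eval]
      constructor
      · intro hlt
        simp [h5, e1, e2] at hlt
        rw [if_pos (by exact_mod_cast hlt), if_neg (by simpa using hlt),
          Finset.sum_insert (hnot _)]
        simp [g0, g1, g2, e1]
        ring
      · intro hlt
        simp [h5, e1, e2] at hlt
        rw [if_neg (by simpa using hlt), if_pos (by simpa using hlt),
          Finset.card_insert_of_notMem (hnot _)]
        simp [g0, g1, g2]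
    · intro ρ hG ⟨g0, g1, g2⟩
      have hn'' : σ.nat 0 0 - 1 + 1 = n := by omega
      have h2' := congrFun (hG.real 2 (by decide)) 0
      simp [hn', hn''] at g1 g2 h2'
      have hc : ρ.real 3 0 / ρ.nat 13 0 = candidateLevel n m (k + 1) := by rw [g1, g2]; simp [candidateLevel]
      simp only [holds_setReal, holds_ite, holds_skip]
      have hI : Finset.Ico 1 (k + 1 + 1) = insert (k + 1) (Finset.Ico 1 (k + 1)) :=
        (Finset.insert_Ico_right_eq_Ico_add_one (by omega)).symm
      rw [hI]
      constructor
      · intro hlt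
        simp [hc, h2'] at hlt
        simp only [Finset.forall_mem_insert, Finset.exists_mem_insert]
        simp [hc, g0]
        refine ⟨h2.trans hlt.le, fun t ht1 ht2 => (h3 t (by simp; omega)).trans hlt.le⟩
      · intro hlt
        simp [hc, h2'] at hlt
        simp only [Finset.forall_mem_insert, Finset.exists_mem_insert]
        simp [h2', g0]
        refine ⟨h2, ⟨hlt, fun t ht1 ht2 => h3 t (by simp; omega)⟩, ?_⟩
        rcases h4 with h4 | ⟨t, ht, h4⟩
        · exact Or.inl h4
        · exact Or.inr (Or.inr ⟨t, by simpa using ht, h4⟩)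
  · intro τ _ ⟨_, h⟩
    simp [hn, Nat.sub_add_cancel hn1] at h
    simpa [IsMaxLevel] using h

/-- The inclusion probability of a set of size `k` that does not contain the last element; the
empty set is never included. -/
def subsetProb (n : ℕ) (c : ℝ) (k : ℕ) : ℝ≥0 := if k = 0 then 0 else levelProb n c k

/-- The probability that none of the sets is included that extend a given set of size `k` by some
of `a` further elements. -/
def emptyProb (n : ℕ) (c : ℝ) : ℕ → ℕ → ℝ
  | 0, k => 1 - subsetProb n c k
  | a + 1, k => emptyProb n c a k * emptyProb n c a (k + 1)

/-- The table of the probabilities `emptyProb`. -/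
def emptyTable : Cmd := .list [
  .setReal 4 (.ix (.const 0) (.const 0)) (.const 1),
  .loop 5 (.sub .dim (.const 1)) (.list [
    .setReal 3 (.const 0) (.div (.get 2 (.const 0)) (.get 1 (.succ .i))),
    .ite (.realLt (.get 3 (.const 0)) (.const 1))
      (.setReal 4 (.ix (.const 0) (.succ .i)) (.sub (.const 1) (.get 3 (.const 0))))
      (.setReal 4 (.ix (.const 0) (.succ .i)) (.const 0))]),
  .loop 5 (.sub .dim (.const 1))
    (.loop 6 (.sub (.sub .dim (.const 1)) .i)
      (.setReal 4 (.ix (.succ .i) .j)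
        (.mul (.get 4 (.ix .i .j)) (.get 4 (.ix .i (.succ .j))))))]

/-- The cell holds the water level `τ₀`, which is twice the oversampling parameter; hence `τ₀ / 2`.
-/
theorem holds_emptyTable {σ : State n} {τ₀ : ℝ} (hn1 : 1 ≤ n) (hn : σ.nat 0 0 = n)
    (hB : ∀ t ≤ n, σ.real 1 t = n.choose t) (hτ : σ.real 2 0 = τ₀) (hτ0 : 0 ≤ τ₀) :
    Holds v emptyTable σ fun τ => ∀ a k, a + k < n →
      τ.real 4 (idx a k) = emptyProb n (τ₀ / 2) a k := by
  rw [emptyTable]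
  simp only [Cmd.list, holds_seq, holds_setReal]
  refine holds_loop (fun i τ => ∀ k ≤ i, τ.real 4 (idx 0 k) = emptyProb n (τ₀ / 2) 0 k) ?_ ?_ ?_
  · simp [emptyProb, subsetProb]
  · intro k hk τ hF h
    have h1 := hF.real 1 (by decide)
    have h2 := hF.real 2 (by decide)
    simp [hn] at hk
    simp [State.putReal_real_of_ne] at h1 h2
    simp only [holds_setReal, holds_ite, holds_seq]
    have hE : emptyProb n (τ₀ / 2) 0 (k + 1) = 1 - min 1 (τ₀ / n.choose (k + 1)) := by
      rw [emptyProb, subsetProb, if_neg (by omega), coe_levelProb (by positivity),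
        mul_div_cancel₀ _ two_ne_zero, div_eq_mul_inv]
    have hq : τ.real 2 0 / τ.real 1 (k + 1) = τ₀ / n.choose (k + 1) := by
      rw [h2, h1, hτ, hB _ (by omega)]
    constructor
    · intro hlt t ht
      simp [hq] at hlt
      rcases ht.lt_or_eq with ht' | rfl
      · simp [h t (by omega), ht'.ne]
      · simp [hE, hq, min_eq_right hlt.le]
    · intro hlt t ht
      simp [hq] at hlt
      rcases ht.lt_or_eq with ht' | rfl
      · simp [h t (by omega), ht'.ne]
      · simp [hE, min_eq_left hlt]
  · intro τ hF h
    have hn' := congrFun (hF.nat 0 (by decide)) 0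
    simp [hn] at hn' h
    refine holds_loop (fun i ρ => ∀ a k, a ≤ i → a + k < n →
      ρ.real 4 (idx a k) = emptyProb n (τ₀ / 2) a k) ?_ ?_ ?_
    · intro a k ha hk
      obtain rfl : a = 0 := by omega
      simp [h k (by omega)]
    · intro i hi ρ hG hρ
      have hn'' := congrFun (hG.nat 0 (by decide)) 0
      simp [hn'] at hi hn''
      refine holds_loop (fun j π => (∀ a k, a ≤ i → a + k < n →
        π.real 4 (idx a k) = emptyProb n (τ₀ / 2) a k) ∧
        ∀ k < j, π.real 4 (idx (i + 1) k) = emptyProb n (τ₀ / 2) (i + 1) k) ?_ ?_ ?_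
      · simpa using hρ
      · intro j hj π hH ⟨g1, g2⟩
        have h5 := congrFun (hH.nat 5 (by decide)) 0
        simp [hn''] at hj h5
        rw [holds_setReal]
        refine ⟨fun a k ha hk => ?_, fun k hk => ?_⟩
        · have : a ≠ i + 1 := by omega
          simp [h5, this, g1 a k ha hk]
        · rcases Nat.lt_succ_iff_lt_or_eq.1 hk with hk | rfl
          · simp [h5, hk.ne, g2 k hk]
          · simp [h5, emptyProb, g1 i k le_rfl (by omega), g1 i (k + 1) le_rfl (by omega)]
      · intro π _ ⟨g1, g2⟩ a k ha hk
        simp [hn''] at g2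
        rcases Nat.lt_succ_iff_lt_or_eq.1 (Nat.lt_succ_of_le ha) with ha | rfl
        · exact g1 a k (by omega) hk
        · exact g2 k (by omega)
    · intro ρ _ hρ a k hk
      simp [hn'] at hρ
      exact hρ a k (by omega) hk

end Setup

/-! ### Solving a singular system by conjugate deflation -/

section Deflation

variable {κ : Type} [Fintype κ]

/-- The invariants of the solution of `G x = h` by deflation of the columns of `G`: the columns of
`C` are what remains of the columns of `G`, and `ρ` is the residual. -/
structure Deflated (G C : Matrix κ κ ℝ) (h x ρ : κ → ℝ) : Prop where
  range_mat : ∃ K, C = G * K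
  range_vec : ∃ y, x = G *ᵥ y
  residual : h = ρ + G *ᵥ x
  conjugate : Cᵀ * (G * (G - C)) = 0
  orthogonal : (G - C)ᵀ *ᵥ ρ = 0

theorem deflated_init (G : Matrix κ κ ℝ) (h : κ → ℝ) : Deflated G G h 0 h := by
  classical
  exact ⟨⟨1, by simp⟩, ⟨0, by simp⟩, by simp, by simp, by simp⟩

/-- Gram–Schmidt for the form `G`: column `t` of `C` is the new direction `d`, all columns are made
conjugate to it, and a line search along `d` makes the residual orthogonal to it. Conjugacy to the
earlier directions keeps the orthogonality already achieved. Column `t` becomes zero, and zero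
columns stay zero. -/
theorem Deflated.step {G C : Matrix κ κ ℝ} {h x ρ : κ → ℝ} (hD : Deflated G C h x ρ)
    (hG : G.PosSemidef) (t : κ) {d g f : κ → ℝ} (hd : d = fun i => C i t) (hg : g = G *ᵥ d)
    (hf : f = Cᵀ *ᵥ g) :
    Deflated G (C - (d ⬝ᵥ g)⁻¹ • Matrix.vecMulVec d f) h (x + (d ⬝ᵥ ρ / d ⬝ᵥ g) • d)
      (ρ - (d ⬝ᵥ ρ / d ⬝ᵥ g) • g) ∧
    (∀ i, (C - (d ⬝ᵥ g)⁻¹ • Matrix.vecMulVec d f) i t = 0) ∧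
    ∀ j, (∀ i, C i j = 0) → ∀ i, (C - (d ⬝ᵥ g)⁻¹ • Matrix.vecMulVec d f) i j = 0 := by
  classical
  have hGs : Gᵀ = G := by
    simpa [Matrix.conjTranspose_eq_transpose_of_trivial] using hG.1.eq
  obtain ⟨⟨K, hK⟩, ⟨y, hy⟩, hres, hconj, horth⟩ := hD
  have hdK : d = G *ᵥ (fun i => K i t) := by
    rw [hd, hK]; ext i; simp [Matrix.mul_apply, Matrix.mulVec, dotProduct]
  have hft : f t = d ⬝ᵥ g := by
    rw [hf, hd]; rfl
  have hcol : ∀ j, (∀ i, C i j = 0) →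
      ∀ i, (C - (d ⬝ᵥ g)⁻¹ • Matrix.vecMulVec d f) i j = 0 := by
    intro j hj i
    have : f j = 0 := by
      rw [hf]; simp [Matrix.mulVec, dotProduct, hj]
    simp [hj, Matrix.vecMulVec_apply, this]
  -- A zero pivot forces `G d = 0`; since `d` is in the range of the symmetric `G`, it is zero. The
  -- step then changes nothing, whatever the value of the division by zero.
  by_cases hs : d ⬝ᵥ g = 0
  · have hg0 : g = 0 := by
      rw [hg] at hs ⊢
      exact (hG.dotProduct_mulVec_zero_iff d).1 (by simpa using hs)
    have hd0 : d = 0 := by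
      rw [← dotProduct_self_eq_zero]
      nth_rw 2 [hdK]
      rw [Matrix.dotProduct_mulVec, ← Matrix.mulVec_transpose, hGs, ← hg, hg0, zero_dotProduct]
    refine ⟨?_, ?_, hcol⟩
    · rw [hs, hd0, hg0]
      simpa using ⟨⟨K, hK⟩, ⟨y, hy⟩, hres, hconj, horth⟩
    · intro i
      have := congrFun (hd.symm.trans hd0) i
      simp only [Pi.zero_apply] at this
      simp [hs, this]
  · have h3 : d ᵥ* (G * (G - C)) = 0 := by
      ext j
      have := congrFun (congrFun hconj t) j
      rw [hd]
      exact this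
    have h3' : (G - C)ᵀ *ᵥ g = 0 := by
      rw [hg, Matrix.mulVec_mulVec]
      have : (G - C)ᵀ * G = (G * (G - C))ᵀ := by rw [Matrix.transpose_mul, hGs]
      rw [this, Matrix.mulVec_transpose, h3]
    have hGd : G *ᵥ d = g := hg.symm
    refine ⟨⟨?_, ?_, ?_, ?_, ?_⟩, ?_, hcol⟩
    · refine ⟨K - (d ⬝ᵥ g)⁻¹ • Matrix.vecMulVec (fun i => K i t) f, ?_⟩
      rw [Matrix.mul_sub, ← hK, Matrix.mul_smul, Matrix.mul_vecMulVec, ← hdK]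
    · refine ⟨y + (d ⬝ᵥ ρ / d ⬝ᵥ g) • (fun i => K i t), ?_⟩
      rw [Matrix.mulVec_add, Matrix.mulVec_smul, ← hdK, ← hy]
    · rw [Matrix.mulVec_add, Matrix.mulVec_smul, hGd, hres]
      abel
    · have e1 : G - (C - (d ⬝ᵥ g)⁻¹ • Matrix.vecMulVec d f) =
          (G - C) + (d ⬝ᵥ g)⁻¹ • Matrix.vecMulVec d f := by abel
      rw [e1, Matrix.transpose_sub, Matrix.transpose_smul, Matrix.transpose_vecMulVec,
        Matrix.mul_add, Matrix.mul_smul, Matrix.mul_vecMulVec, hGd, Matrix.sub_mul, Matrix.mul_add,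
        hconj, zero_add, Matrix.smul_mul, Matrix.mul_smul, Matrix.mul_vecMulVec, ← hf,
        Matrix.vecMulVec_mul, Matrix.vecMul_add, h3, zero_add, Matrix.vecMul_smul,
        Matrix.vecMul_vecMulVec, smul_smul, inv_mul_cancel₀ hs, one_smul, sub_self]
    · have e1 : G - (C - (d ⬝ᵥ g)⁻¹ • Matrix.vecMulVec d f) =
          (G - C) + (d ⬝ᵥ g)⁻¹ • Matrix.vecMulVec d f := by abel
      rw [e1, Matrix.transpose_add, Matrix.transpose_smul, Matrix.transpose_vecMulVec,
        Matrix.add_mulVec, Matrix.mulVec_sub, horth, Matrix.mulVec_smul, h3', smul_zero, sub_zero,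
        zero_add, Matrix.smul_mulVec, Matrix.vecMulVec_mulVec, dotProduct_sub, dotProduct_smul,
        smul_eq_mul, div_mul_cancel₀ _ hs, sub_self]
      simp
    · intro i
      have hCt : C i t = d i := by rw [hd]
      simp only [Matrix.sub_apply, Matrix.smul_apply, Matrix.vecMulVec_apply, hft, hCt, smul_eq_mul]
      field_simp
      ring

/-- Once `C = 0`, the residual is orthogonal to the range of `G`. For a solvable system it also lies
in that range, so it is zero. -/
theorem Deflated.solves {G : Matrix κ κ ℝ} {h x ρ : κ → ℝ} (hD : Deflated G 0 h x ρ)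
    (hG : Gᵀ = G) {z : κ → ℝ} (hz : h = G *ᵥ z) : G *ᵥ x = h ∧ ∃ y, x = G *ᵥ y := by
  obtain ⟨-, hy, hres, -, horth⟩ := hD
  refine ⟨?_, hy⟩
  rw [sub_zero, hG] at horth
  have hρ : ρ = G *ᵥ (z - x) := by
    rw [Matrix.mulVec_sub, ← hz, hres]; abel
  have : ρ = 0 := by
    rw [← dotProduct_self_eq_zero]
    nth_rw 2 [hρ]
    rw [Matrix.dotProduct_mulVec, ← Matrix.mulVec_transpose, hG, horth, zero_dotProduct]
  rw [hres, this, zero_add]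

end Deflation

/-! ### The solver as a program -/

section Solver

/-- For every `j`, write to cell `j` of array `a` the sum of `e` over the innermost counter. -/
def sumLoop (a : ℕ) (e : RExp) : Cmd :=
  .loop 6 .dim (.list [
    .setReal a .j (.const 0),
    .loop 7 .dim (.setReal a .j (.add (.get a .j) e))])

/-- One step of the deflation. -/
def deflate : Cmd := .list [
  .loop 6 .dim (.setReal 10 .j (.get 9 (.ix .j .i))),
  sumLoop 11 (.mul (.get 8 (.ix .j .l)) (.get 10 .l)),
  sumLoop 12 (.mul (.get 11 .l) (.get 9 (.ix .l .j))),
  .setReal 3 (.const 6) (.const 0),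
  .setReal 3 (.const 7) (.const 0),
  .loop 6 .dim (.list [
    .setReal 3 (.const 6) (.add (.get 3 (.const 6)) (.mul (.get 10 .j) (.get 11 .j))),
    .setReal 3 (.const 7) (.add (.get 3 (.const 7)) (.mul (.get 10 .j) (.get 7 .j)))]),
  .setReal 3 (.const 7) (.div (.get 3 (.const 7)) (.get 3 (.const 6))),
  .loop 6 .dim (.list [
    .setReal 0 .j (.add (.get 0 .j) (.mul (.get 3 (.const 7)) (.get 10 .j))),
    .setReal 7 .j (.sub (.get 7 .j) (.mul (.get 3 (.const 7)) (.get 11 .j))),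
    .loop 7 .dim (.setReal 9 (.ix .j .l)
      (.sub (.get 9 (.ix .j .l)) (.div (.mul (.get 10 .j) (.get 12 .l)) (.get 3 (.const 6)))))])]

/-- Solve `G x = ρ` and add the constant. -/
def solver : Cmd := .list [
  .loop 5 .dim deflate,
  .loop 5 .dim (.setReal 0 .i (.add (.get 0 .i) (.get 5 (.const 2))))]

variable {n : ℕ} {v : Finset (Fin n) → ℝ}

theorem holds_sumLoop {σ : State n} (hn : σ.nat 0 0 = n) {a : ℕ} {e : RExp} (F : ℕ → ℕ → ℝ)
    (he : ∀ τ : State n, (∀ b, b ≠ a → τ.real b = σ.real b) →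
      e.eval τ = F (τ.nat 6 0) (τ.nat 7 0)) :
    Holds v (sumLoop a e) σ fun τ => ∀ j < n, τ.real a j = ∑ u ∈ Finset.range n, F j u := by
  rw [sumLoop]
  refine holds_loop (fun k τ => ∀ j < k, τ.real a j = ∑ u ∈ Finset.range n, F j u) (by simp) ?_ ?_
  · intro k hk τ hFr hτ
    have hn' := congrFun (hFr.nat 0 (by simp [Cmd.natWrites])) 0
    simp only [Cmd.list, holds_seq, holds_setReal]
    refine holds_loop (fun l ρ => (∀ j < k, ρ.real a j = ∑ u ∈ Finset.range n, F j u) ∧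
      ρ.real a k = ∑ u ∈ Finset.range l, F k u) ?_ ?_ ?_
    · refine ⟨fun j hj => ?_, by simp⟩
      simp [hj.ne, hτ j hj]
    · intro l hl ρ hFr' ⟨h1, h2⟩
      have h6 := congrFun (hFr'.nat 6 (by simp [Cmd.natWrites])) 0
      simp at h6
      rw [holds_setReal]
      have hev : e.eval ((ρ.putNat 7 0 l).tick 1) = F k l := by
        rw [he]
        · simp [h6]
        · intro b hb
          have h1 := hFr'.real b (by simp [Cmd.realWrites, hb])
          have h2 := hFr.real b (by simp [Cmd.realWrites, hb])
          simp [State.putReal_real_of_ne _ hb] at h1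
          simp [h1, h2]
      refine ⟨fun j hj => ?_, ?_⟩
      · simp [h6, hj.ne, h1 j hj]
      · rw [Finset.sum_range_succ, ← h2, ← hev]
        simp [h6]
    · intro ρ _ ⟨h1, h2⟩ j hj
      simp [hn', hn] at h2
      rcases Nat.lt_succ_iff_lt_or_eq.1 hj with hj | rfl
      · exact h1 j hj
      · exact h2
  · intro τ _ h
    simpa [hn] using h

/-- The effect of one deflation step on the arrays. -/
theorem holds_deflate {σ : State n} (hn : σ.nat 0 0 = n) (d g f : ℕ → ℝ)
    (hd : ∀ j, d j = σ.real 9 (idx j (σ.nat 5 0)))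
    (hg : ∀ j, g j = ∑ u ∈ Finset.range n, σ.real 8 (idx j u) * d u)
    (hf : ∀ j, f j = ∑ u ∈ Finset.range n, g u * σ.real 9 (idx u j)) :
    Holds v deflate σ fun τ =>
      (∀ j < n, τ.real 0 j = σ.real 0 j + (∑ u ∈ Finset.range n, d u * σ.real 7 u) /
        (∑ u ∈ Finset.range n, d u * g u) * d j) ∧
      (∀ j < n, τ.real 7 j = σ.real 7 j - (∑ u ∈ Finset.range n, d u * σ.real 7 u) /
        (∑ u ∈ Finset.range n, d u * g u) * g j) ∧
      (∀ j < n, ∀ u < n, τ.real 9 (idx j u) = σ.real 9 (idx j u) -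
        d j * f u / (∑ u ∈ Finset.range n, d u * g u)) := by
  rw [deflate]
  simp only [Cmd.list, holds_seq, holds_setReal]
  refine holds_loop (fun k τ => ∀ j < k, τ.real 10 j = d j) (by simp) ?_ ?_
  · intro k hk τ hF h
    have h9 := hF.real 9 (by decide)
    have h5 := hF.nat 5 (by decide)
    rw [holds_setReal]
    intro j hj
    rcases Nat.lt_succ_iff_lt_or_eq.1 hj with hj | rfl
    · simp [hj.ne, h j hj]
    · simp [h9, h5, hd]
  intro τ₁ hF₁ h10
  have hn₁ := congrFun (hF₁.nat 0 (by decide)) 0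
  have h8₁ := hF₁.real 8 (by decide)
  have h9₁ := hF₁.real 9 (by decide)
  have h0₁ := hF₁.real 0 (by decide)
  have h7₁ := hF₁.real 7 (by decide)
  simp [hn] at h10
  refine (holds_sumLoop (hn₁.trans hn)
    (fun j u => σ.real 8 (idx j u) * τ₁.real 10 u) (fun τ hτ => ?_)).with_frame.mono ?_
  · simp [hτ 8 (by decide), hτ 10 (by decide), h8₁]
  rintro τ₂ ⟨hF₂, h11⟩
  have hn₂ := congrFun (hF₂.nat 0 (by decide)) 0
  have h9₂ := hF₂.real 9 (by decide)
  have h10₂ := hF₂.real 10 (by decide)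
  have h0₂ := hF₂.real 0 (by decide)
  have h7₂ := hF₂.real 7 (by decide)
  have h11' : ∀ j < n, τ₂.real 11 j = g j := by
    intro j hj
    rw [h11 j hj, hg]
    exact Finset.sum_congr rfl fun u hu => by rw [h10 u (Finset.mem_range.1 hu)]
  refine (holds_sumLoop (hn₂.trans (hn₁.trans hn))
    (fun j u => τ₂.real 11 u * σ.real 9 (idx u j)) (fun τ hτ => ?_)).with_frame.mono ?_
  · simp [hτ 11 (by decide), hτ 9 (by decide), h9₂, h9₁]
  rintro τ₃ ⟨hF₃, h12⟩
  have hn₃ := congrFun (hF₃.nat 0 (by decide)) 0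
  have h9₃ := hF₃.real 9 (by decide)
  have h10₃ := hF₃.real 10 (by decide)
  have h11₃ := hF₃.real 11 (by decide)
  have h0₃ := hF₃.real 0 (by decide)
  have h7₃ := hF₃.real 7 (by decide)
  have h12' : ∀ j < n, τ₃.real 12 j = f j := by
    intro j hj
    rw [h12 j hj, hf]
    exact Finset.sum_congr rfl fun u hu => by rw [h11' u (Finset.mem_range.1 hu)]
  have e10 : ∀ j < n, τ₃.real 10 j = d j := fun j hj => by rw [h10₃, h10₂, h10 j hj]
  have e11 : ∀ j < n, τ₃.real 11 j = g j := fun j hj => by rw [h11₃, h11' j hj]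
  have e9 : τ₃.real 9 = σ.real 9 := by rw [h9₃, h9₂, h9₁]
  have e7 : τ₃.real 7 = σ.real 7 := by rw [h7₃, h7₂, h7₁]
  have e0 : τ₃.real 0 = σ.real 0 := by rw [h0₃, h0₂, h0₁]
  have en : τ₃.nat 0 0 = n := by rw [hn₃, hn₂, hn₁, hn]
  clear hF₁ hF₂ hF₃ h10 h11 h12 h11' hn₁ hn₂ hn₃ h8₁ h9₁ h9₂ h9₃ h10₂ h10₃ h11₃ h0₁ h0₂ h0₃ h7₁
    h7₂ h7₃
  refine holds_loop (fun k τ => τ.real 3 6 = ∑ u ∈ Finset.range k, d u * g u ∧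
    τ.real 3 7 = ∑ u ∈ Finset.range k, d u * σ.real 7 u) (by simp) ?_ ?_
  · intro k hk τ hF ⟨h1, h2⟩
    simp [en] at hk
    have g10 := hF.real 10 (by decide)
    have g11 := hF.real 11 (by decide)
    have g7 := hF.real 7 (by decide)
    simp [State.putReal_real_of_ne] at g10 g11 g7
    simp only [holds_seq, holds_setReal]
    rw [Finset.sum_range_succ, Finset.sum_range_succ]
    constructor
    · simp [h1, g10, g11, e10 k hk, e11 k hk]
    · simp [h2, g10, g7, e10 k hk, e7]
  intro τ₄ hF₄ ⟨hs, he⟩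
  have hn₄ := congrFun (hF₄.nat 0 (by decide)) 0
  have h0₄ := hF₄.real 0 (by decide)
  have h7₄ := hF₄.real 7 (by decide)
  have h9₄ := hF₄.real 9 (by decide)
  have h10₄ := hF₄.real 10 (by decide)
  have h11₄ := hF₄.real 11 (by decide)
  have h12₄ := hF₄.real 12 (by decide)
  simp [State.putReal_real_of_ne, en, e0, e7, e9] at hs he hn₄ h0₄ h7₄ h9₄ h10₄ h11₄ h12₄
  set s := ∑ u ∈ Finset.range n, d u * g u with hsdef
  set e := ∑ u ∈ Finset.range n, d u * σ.real 7 u with hedef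
  refine holds_loop (fun k τ =>
      (∀ j < n, τ.real 0 j = if j < k then σ.real 0 j + e / s * d j else σ.real 0 j) ∧
      (∀ j < n, τ.real 7 j = if j < k then σ.real 7 j - e / s * g j else σ.real 7 j) ∧
      (∀ j < n, ∀ u < n, τ.real 9 (idx j u) = if j < k then σ.real 9 (idx j u) - d j * f u / s
        else σ.real 9 (idx j u))) ?_ ?_ ?_
  · simp [h0₄, h7₄, h9₄]
  · intro k hk τ hF ⟨h1, h2, h3⟩
    have h5 := hF.real 3 (by decide)
    have g10 := hF.real 10 (by decide)
    have g11 := hF.real 11 (by decide)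
    have g12 := hF.real 12 (by decide)
    have hn' := congrFun (hF.nat 0 (by decide)) 0
    have g36 := congrFun h5 6
    have g37 := congrFun h5 7
    simp [hn₄] at hk
    simp [State.putReal_real_of_ne, h10₄, h11₄, h12₄, hn₄, hs, he] at g10 g11 g12 hn' g36 g37
    simp only [holds_seq, holds_setReal]
    refine holds_loop (fun l ρ =>
      (∀ j < n, ∀ u < n, ρ.real 9 (idx j u) = if j < k ∨ (j = k ∧ u < l) then
        σ.real 9 (idx j u) - d j * f u / s else σ.real 9 (idx j u))) ?_ ?_ ?_
    · simpa using h3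
    · intro l hl ρ hG hρ
      have q10 := hG.real 10 (by decide)
      have q12 := hG.real 12 (by decide)
      have q6 := congrFun (hG.nat 6 (by decide)) 0
      have q36 := congrFun (hG.real 3 (by decide)) 6
      simp [hn'] at hl
      simp [State.putReal_real_of_ne, g10, g12, g36] at q10 q12 q36 q6
      rw [holds_setReal]
      intro j hj u hu
      have e1 := hρ j hj u hu
      by_cases hjk : j = k ∧ u = l
      · obtain ⟨rfl, rfl⟩ := hjk
        simp at e1
        simp [q6, e1, q10, q12, q36, e10 j hj, h12' u hu]
      · have : (j < k ∨ j = k ∧ u ≤ l) ↔ (j < k ∨ j = k ∧ u < l) := by omega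
        simp [q6, hjk, e1, this]
    · intro ρ hG hρ
      have q0 := hG.real 0 (by decide)
      have q7 := hG.real 7 (by decide)
      simp [hn'] at hρ
      refine ⟨fun j hj => ?_, fun j hj => ?_, fun j hj u hu => ?_⟩
      · rw [q0]
        by_cases hjk : j = k
        · subst hjk
          simp [h1 j hj, g10, g37, e10 j hj]
        · have : j < k + 1 ↔ j < k := by omega
          simp [hjk, h1 j hj, this]
      · rw [q7]
        by_cases hjk : j = k
        · subst hjk
          simp [h2 j hj, g11, g37, e11 j hj]
        · have : j < k + 1 ↔ j < k := by omega
          simp [hjk, h2 j hj, this]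
      · have : j < k + 1 ↔ j < k ∨ j = k := by omega
        simp [hρ j hj u hu, this, hu]
  · intro τ _ ⟨h1, h2, h3⟩
    simp [hn₄] at h1 h2 h3
    refine ⟨fun j hj => ?_, fun j hj => ?_, fun j hj u hu => ?_⟩
    · simpa [hj] using h1 j hj
    · simpa [hj] using h2 j hj
    · simpa [hj] using h3 j hj u hu

/-- Array 8 keeps `G` while array 9 is deflated. Pass `k` clears column `k`, so nothing is left
after `n` passes. -/
theorem holds_solver {σ : State n} (hn : σ.nat 0 0 = n) {G : Matrix (Fin n) (Fin n) ℝ}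
    {h z : Fin n → ℝ} (hG : G.PosSemidef) (hz : h = G *ᵥ z)
    (h8 : ∀ j u : Fin n, σ.real 8 (idx j u) = G j u)
    (h9 : ∀ j u : Fin n, σ.real 9 (idx j u) = G j u)
    (h7 : ∀ j : Fin n, σ.real 7 j = h j) (h0 : ∀ j : Fin n, σ.real 0 j = 0) :
    Holds v solver σ fun τ => ∃ x, G *ᵥ x = h ∧ (∃ y, x = G *ᵥ y) ∧
      ∀ i : Fin n, τ.real 0 i = x i + σ.real 5 2 := by
  have hGs : Gᵀ = G := by
    simpa [Matrix.conjTranspose_eq_transpose_of_trivial] using hG.1.eq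
  rw [solver]
  simp only [Cmd.list, holds_seq]
  refine holds_loop (fun k τ => Deflated G (Matrix.of fun j u : Fin n => τ.real 9 (idx j u)) h
    (fun j => τ.real 0 j) (fun j => τ.real 7 j) ∧
    ∀ t : Fin n, (t : ℕ) < k → ∀ j : Fin n, τ.real 9 (idx j t) = 0) ?_ ?_ ?_
  · refine ⟨?_, by simp⟩
    have := deflated_init G h
    convert this using 1
    · ext j u; simp [h9]
    · ext j; simp [h0]
    · ext j; simp [h7]
  · intro k hk τ hF ⟨hD, hcol⟩
    have hn' := congrFun (hF.nat 0 (by decide)) 0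
    have h8' := hF.real 8 (by decide)
    simp [hn] at hk hn'
    let t : Fin n := ⟨k, hk⟩
    let d : ℕ → ℝ := fun j => τ.real 9 (idx j k)
    let g : ℕ → ℝ := fun j => ∑ u ∈ Finset.range n, τ.real 8 (idx j u) * d u
    let f : ℕ → ℝ := fun j => ∑ u ∈ Finset.range n, g u * τ.real 9 (idx u j)
    obtain ⟨hD', hc1, hc2⟩ := hD.step hG t (d := fun j => d j) (g := fun j => g j)
      (f := fun j => f j) rfl
      (by ext j; simp [g, h8', h8, Matrix.mulVec, dotProduct, Finset.sum_range])
      (by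
        ext j
        simp [f, Matrix.mulVec, dotProduct, Finset.sum_range]
        exact Finset.sum_congr rfl fun u _ => mul_comm _ _)
    refine (holds_deflate (by simp [hn']) d g f (by simp [d]) (by simp [g]) (by simp [f])).mono ?_
    rintro ρ ⟨r0, r7, r9⟩
    simp only [State.tick_real, State.putNat_real] at r0 r7 r9
    have e9 : ∀ j u : Fin n, ρ.real 9 (idx j u) = _ := fun j u => r9 j j.2 u u.2
    have hC : (Matrix.of fun j u : Fin n => ρ.real 9 (idx j u)) = Matrix.of (fun j u : Fin n =>
        τ.real 9 (idx j u)) - ((fun j : Fin n => d j) ⬝ᵥ fun j : Fin n => g j)⁻¹ •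
          Matrix.vecMulVec (fun j : Fin n => d j) (fun j : Fin n => f j) := by
      ext j u
      simp [e9, Matrix.vecMulVec_apply, dotProduct, Finset.sum_range, div_eq_inv_mul]
    refine ⟨?_, ?_⟩
    · rw [hC]
      convert hD' using 1
      · ext j
        simp [r0 j j.2, dotProduct, Finset.sum_range]
      · ext j
        simp [r7 j j.2, dotProduct, Finset.sum_range]
    · intro s hs j
      have : ρ.real 9 (idx j s) = (Matrix.of fun j u : Fin n => ρ.real 9 (idx j u)) j s := rfl
      rw [this, hC]
      rcases Nat.lt_succ_iff_lt_or_eq.1 hs with hs | hs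
      · exact hc2 s (fun i => hcol s hs i) j
      · obtain rfl : s = t := Fin.ext hs
        exact hc1 j
  · intro τ hF ⟨hD, hcol⟩
    have hn' := congrFun (hF.nat 0 (by decide)) 0
    have h5' := hF.real 5 (by decide)
    simp [hn] at hcol hn'
    have hC : (Matrix.of fun j u : Fin n => τ.real 9 (idx j u)) = 0 := by
      ext j u; exact hcol u j
    rw [hC] at hD
    obtain ⟨hx, hy⟩ := hD.solves hGs hz
    refine holds_loop (fun k ρ => ∀ j < n, ρ.real 0 j =
      if j < k then τ.real 0 j + σ.real 5 2 else τ.real 0 j) (by simp) ?_ ?_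
    · intro k hk ρ hH hρ
      have g5 := hH.real 5 (by decide)
      rw [holds_setReal]
      intro j hj
      by_cases hjk : j = k
      · subst hjk
        simp [hρ j hj, g5, h5']
      · have : j ≤ k ↔ j < k := by omega
        simp [hjk, hρ j hj, this]
    · intro ρ _ hρ
      refine ⟨_, hx, hy, fun i => ?_⟩
      simpa [hn'] using hρ i i.2

end Solver

/-! ### Refinement of random subsets -/

section Laws

variable {α β γ : Type}

theorem bind_congr_support {μ : PMF α} {f g : α → PMF β} (h : ∀ a ∈ μ.support, f a = g a) :
    μ.bind f = μ.bind g := by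
  ext b
  rw [PMF.bind_apply, PMF.bind_apply]
  refine tsum_congr fun a => ?_
  by_cases ha : μ a = 0
  · rw [ha, zero_mul, zero_mul]
  · rw [h a ((PMF.mem_support_iff _ _).2 ha)]

theorem flip_apply (x : ℝ) (r : Bool) :
    flip x r = ((if r then min 1 x.toNNReal else 1 - min 1 x.toNNReal : ℝ≥0) : ℝ≥0∞) := rfl

theorem flip_zero : flip 0 = PMF.pure false := by
  ext r
  cases r <;> simp [flip_apply]

theorem flip_coe_apply {x : ℝ≥0} (hx : x ≤ 1) (r : Bool) :
    flip x r = ((if r then x else 1 - x : ℝ≥0) : ℝ≥0∞) := by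
  rw [flip_apply, Real.toNNReal_coe, min_eq_right hx]

theorem bind_bool_apply (μ : PMF Bool) (f : Bool → PMF β) (b : β) :
    μ.bind f b = μ true * f true b + μ false * f false b := by
  rw [PMF.bind_apply, tsum_fintype, Fintype.sum_bool]

variable [DecidableEq α]

theorem bernoulliSubset_empty (p : α → ℝ≥0) (hp : ∀ a, p a ≤ 1) :
    bernoulliSubset ∅ p hp = PMF.pure ∅ := by
  ext T
  rw [bernoulliSubset_apply, PMF.pure_apply]
  by_cases h : T = ∅ <;> simp [h]

/-- An element is decided on independently of the others. -/
theorem bernoulliSubset_insert {a : α} {s : Finset α} (ha : a ∉ s) (p : α → ℝ≥0)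
    (hp : ∀ a, p a ≤ 1) : bernoulliSubset (insert a s) p hp =
      (flip (p a)).bind fun b => (bernoulliSubset s p hp).map fun T =>
        if b then insert a T else T := by
  ext U
  rw [bind_bool_apply, flip_coe_apply (hp a), flip_coe_apply (hp a)]
  simp only [if_true, Bool.false_eq_true, if_false]
  have h1 : (bernoulliSubset s p hp).map (fun T => T) = bernoulliSubset s p hp := PMF.map_id _
  rw [h1]
  have hs : ∀ T, bernoulliSubset s p hp T ≠ 0 → T ⊆ s := fun T hT =>
    subset_of_mem_support_bernoulliSubset ((PMF.mem_support_iff _ _).2 hT)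
  by_cases haU : a ∈ U
  · have e1 : bernoulliSubset s p hp U = 0 := by
      by_contra h
      exact ha (hs U h haU)
    have e2 : (bernoulliSubset s p hp).map (insert a) U = bernoulliSubset s p hp (U.erase a) := by
      rw [PMF.map_apply, tsum_eq_single (U.erase a)]
      · rw [if_pos (Finset.insert_erase haU).symm]
      · intro T hT
        split_ifs with h
        · by_contra h0
          have haT : a ∉ T := fun h' => ha (hs T h0 h')
          rw [h, Finset.erase_insert haT] at hT
          exact hT rfl
        · rfl
    rw [e1, e2, mul_zero, add_zero, bernoulliSubset_apply, bernoulliSubset_apply]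
    by_cases hU : U ⊆ insert a s
    · have hU' : U.erase a ⊆ s := by
        rwa [← Finset.subset_insert_iff]
      rw [if_pos hU, if_pos hU', ← ENNReal.coe_mul, ← mul_assoc, Finset.mul_prod_erase _ _ haU,
        Finset.insert_sdiff_of_mem _ haU]
      congr 3
      ext x
      simp only [Finset.mem_sdiff, Finset.mem_erase, not_and]
      refine ⟨fun ⟨h, h'⟩ => ⟨h, fun _ => h'⟩, fun ⟨h, h'⟩ => ⟨h, h' fun hx => ha (hx ▸ h)⟩⟩
    · have hU' : ¬U.erase a ⊆ s := by
        rwa [← Finset.subset_insert_iff]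
      rw [if_neg hU, if_neg hU', mul_zero]
  · have e2 : (bernoulliSubset s p hp).map (insert a) U = 0 := by
      rw [PMF.map_apply, ENNReal.tsum_eq_zero]
      intro T
      rw [if_neg]
      rintro rfl
      exact haU (Finset.mem_insert_self _ _)
    rw [e2, mul_zero, zero_add, bernoulliSubset_apply, bernoulliSubset_apply]
    have hU : U ⊆ insert a s ↔ U ⊆ s := by
      rw [Finset.subset_insert_iff, Finset.erase_eq_of_notMem haU]
    by_cases h : U ⊆ s
    · rw [if_pos (hU.2 h), if_pos h, Finset.insert_sdiff_of_notMem _ haU,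
        Finset.prod_insert (by simp [ha]), ← ENNReal.coe_mul]
      congr 1
      ring
    · rw [if_neg (mt hU.1 h), if_neg h, mul_zero]

theorem bernoulliSubset_congr {s : Finset α} {p q : α → ℝ≥0} {hp : ∀ a, p a ≤ 1}
    {hq : ∀ a, q a ≤ 1} (h : ∀ a ∈ s, p a = q a) :
    bernoulliSubset s p hp = bernoulliSubset s q hq := by
  ext T
  rw [bernoulliSubset_apply, bernoulliSubset_apply]
  by_cases hT : T ⊆ s
  · rw [if_pos hT, if_pos hT, Finset.prod_congr rfl fun a ha => h a (hT ha),
      Finset.prod_congr (f := fun a => 1 - p a) rfl fun a ha => by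
        rw [h a (Finset.sdiff_subset ha)]]
  · rw [if_neg hT, if_neg hT]

theorem bernoulliSubset_insert_zero {a : α} {s : Finset α} (ha : a ∉ s) (p : α → ℝ≥0)
    (hp : ∀ a, p a ≤ 1) (h0 : p a = 0) :
    bernoulliSubset (insert a s) p hp = bernoulliSubset s p hp := by
  rw [bernoulliSubset_insert ha, h0, NNReal.coe_zero, flip_zero, PMF.pure_bind]
  exact PMF.map_id _

theorem bernoulliSubset_image [DecidableEq β] {s : Finset α} {e : α → β} (he : Set.InjOn e s)
    (p : β → ℝ≥0) (hp : ∀ b, p b ≤ 1) : bernoulliSubset (s.image e) p hp =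
      (bernoulliSubset s (fun a => p (e a)) fun _ => hp _).map (Finset.image e) := by
  induction s using Finset.induction_on with
  | empty => simp [bernoulliSubset_empty, PMF.pure_map]
  | insert a s ha ih =>
    have he' : Set.InjOn e s := he.mono (by simp)
    have ha' : e a ∉ s.image e := by
      intro h
      obtain ⟨b, hb, hab⟩ := Finset.mem_image.1 h
      have := he (by simp [hb]) (by simp) hab
      exact ha (this ▸ hb)
    rw [Finset.image_insert, bernoulliSubset_insert ha', bernoulliSubset_insert ha, ih he',
      PMF.map_bind]
    congr 1
    funext b
    rw [PMF.map_comp, PMF.map_comp]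
    congr 1
    funext T
    cases b <;> simp

/-- The union of independent random sets, one for each element of a multiset. -/
def independentUnion (κ : α → PMF (Finset α)) (T : Multiset α) : PMF (Finset α) :=
  -- Independent draws and unions commute, so folding over an unordered multiset makes sense.
  letI : LeftCommutative fun (a : α) (μ : PMF (Finset α)) =>
      (κ a).bind fun U => μ.map (U ∪ ·) :=
    ⟨fun a b μ => by
      simp only [← PMF.bind_pure_comp, PMF.bind_bind, PMF.pure_bind, Function.comp_def]
      rw [PMF.bind_comm]
      simp only [Finset.union_left_comm]⟩
  T.foldr (fun a μ => (κ a).bind fun U => μ.map (U ∪ ·)) (PMF.pure ∅)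

theorem independentUnion_zero (κ : α → PMF (Finset α)) :
    independentUnion κ 0 = PMF.pure ∅ := by
  simp [independentUnion]

theorem independentUnion_cons (κ : α → PMF (Finset α)) (a : α) (T : Multiset α) :
    independentUnion κ (a ::ₘ T) =
      (κ a).bind fun U => (independentUnion κ T).map (U ∪ ·) := by
  simp [independentUnion]

/-- A sequential pass over rows in memory has a law that does not depend on their order. -/
theorem iterate_independentUnion (κ : α → PMF (Finset α)) (f : ℕ → α) (N : ℕ) :
    iterate (fun k U => (κ (f k)).map (U ∪ ·)) N ∅ =
      independentUnion κ ((Multiset.range N).map f) := by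
  induction N with
  | zero => simp [iterate, independentUnion_zero]
  | succ N ih =>
    rw [iterate, ih, Multiset.range_succ, Multiset.map_cons, independentUnion_cons]
    simp only [← PMF.bind_pure_comp, Function.comp_def]
    rw [PMF.bind_comm]
    simp only [Finset.union_comm]

/-- Refinement: to sample among `s` and its image under `e`, first sample those `a ∈ s` for which
`a` or `e a` will be present. -/
theorem bernoulliSubset_refine {s : Finset α} {e : α → α} (he : Set.InjOn e s)
    (hes : ∀ a ∈ s, e a ∉ s) {p q : α → ℝ≥0} (hp : ∀ a, p a ≤ 1) (hq : ∀ a, q a ≤ 1)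
    {κ : α → PMF (Finset α)} (hκ : ∀ a ∈ s,
      ((flip (q a)).bind fun b => if b then κ a else PMF.pure ∅) =
        (flip (p a)).bind fun b => (flip (p (e a))).map fun b' =>
          (if b then {a} else ∅) ∪ (if b' then {e a} else ∅)) :
    (bernoulliSubset s q hq).bind (fun T => independentUnion κ T.val) =
      bernoulliSubset (s ∪ s.image e) p hp := by
  induction s using Finset.induction_on with
  | empty => simp [bernoulliSubset_empty, independentUnion_zero]
  | insert a s ha ih =>
    have he' : Set.InjOn e s := he.mono (by simp)
    have hes' : ∀ b ∈ s, e b ∉ s := fun b hb h => hes b (by simp [hb]) (by simp [h])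
    have ha1 : e a ∉ s ∪ s.image e := by
      rw [Finset.mem_union, not_or]
      refine ⟨fun h => hes a (by simp) (by simp [h]), fun h => ?_⟩
      obtain ⟨b, hb, hab⟩ := Finset.mem_image.1 h
      have := he (by simp [hb]) (by simp) hab
      exact ha (this ▸ hb)
    have ha2 : a ∉ insert (e a) (s ∪ s.image e) := by
      simp only [Finset.mem_insert, Finset.mem_union, not_or]
      refine ⟨fun h => hes a (by simp) (by simp [← h]), ha, fun h => ?_⟩
      obtain ⟨b, hb, hab⟩ := Finset.mem_image.1 h
      exact hes b (by simp [hb]) (by simp [hab])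
    have hset : insert a s ∪ (insert a s).image e = insert a (insert (e a) (s ∪ s.image e)) := by
      ext x; simp only [Finset.image_insert, Finset.mem_union, Finset.mem_insert]; tauto
    have hih := ih he' hes' fun b hb => hκ b (by simp [hb])
    rw [hset, bernoulliSubset_insert ha2, bernoulliSubset_insert ha1, ← hih,
      bernoulliSubset_insert ha]
    -- The decisions below `a` are separated from those below the members of `T`, which is possible
    -- since `a ∉ T`.
    have e1 : ((flip (q a)).bind fun b => (bernoulliSubset s q hq).map fun T =>
        if b then insert a T else T).bind (fun T => independentUnion κ T.val) =
        ((flip (q a)).bind fun b => if b then κ a else PMF.pure ∅).bind fun U =>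
          ((bernoulliSubset s q hq).bind fun T => independentUnion κ T.val).map (U ∪ ·) := by
      rw [PMF.bind_bind, PMF.bind_bind]
      congr 1
      funext b
      rw [PMF.bind_map]
      simp only [PMF.map_bind]
      rw [PMF.bind_comm]
      refine bind_congr_support fun T hT => ?_
      have haT : a ∉ T := fun h => ha (subset_of_mem_support_bernoulliSubset hT h)
      cases b
      · simp only [Bool.false_eq_true, if_false, PMF.pure_bind, Function.comp_apply,
          Finset.empty_union]
        exact (PMF.map_id _).symm
      · simp only [if_true, Function.comp_apply, Finset.insert_val_of_notMem haT]
        rw [independentUnion_cons]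
    rw [e1, hκ a (by simp), PMF.bind_bind]
    congr 1
    funext b
    rw [PMF.bind_map, PMF.map_bind]
    congr 1
    funext b'
    rw [PMF.map_comp, Function.comp_apply]
    congr 1
    funext T
    ext x
    cases b <;> cases b' <;> simp

/-- The law of the nonempty ones among two sets, the first of which is empty with probability `x`
and the second with probability `y`, given that one of them is nonempty. -/
theorem flip_split {x y : ℝ} (hx0 : 0 ≤ x) (hx1 : x ≤ 1) (hy0 : 0 ≤ y) (hy1 : y ≤ 1)
    (f : Bool → Bool → PMF β) :
    ((flip (1 - x * y)).bind fun b => if b then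
      ((flip ((1 - y) / (1 - x * y))).bind fun b => if b then
        ((flip (1 - x)).bind fun b' => f b' true) else f true false) else f false false) =
      (flip (1 - x)).bind fun b => (flip (1 - y)).bind fun b' => f b b' := by
  have hxy : x * y ≤ 1 := mul_le_one₀ hx1 hy0 hy1
  have kt : ∀ z : ℝ, z ≤ 1 → flip z true = ENNReal.ofReal z := by
    intro z h1
    rw [flip_apply, if_pos rfl, min_eq_right (Real.toNNReal_le_one.2 h1)]
    rfl
  have kf : ∀ z : ℝ, 0 ≤ z → z ≤ 1 → flip z false = ENNReal.ofReal (1 - z) := by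
    intro z h0 h1
    rw [flip_apply, if_neg (by simp), min_eq_right (Real.toNNReal_le_one.2 h1),
      ENNReal.ofReal_sub _ h0, ENNReal.ofReal_one, ENNReal.coe_sub]
    rfl
  have hz0 : 0 ≤ (1 - y) / (1 - x * y) := div_nonneg (by linarith) (by linarith)
  have hz1 : (1 - y) / (1 - x * y) ≤ 1 := div_le_one_of_le₀ (by nlinarith) (by linarith)
  have hxy0 : 0 ≤ x * y := mul_nonneg hx0 hy0
  ext b
  simp only [bind_bool_apply, if_true, Bool.false_eq_true, if_false]
  rw [kt (1 - x * y) (by linarith), kf (1 - x * y) (by linarith) (by linarith), kt _ hz1,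
    kf _ hz0 hz1, kt (1 - x) (by linarith), kf (1 - x) (by linarith) (by linarith),
    kt (1 - y) (by linarith), kf (1 - y) (by linarith) (by linarith)]
  simp only [mul_add, ← mul_assoc, sub_sub_cancel]
  have e1 : (1 - x * y) * ((1 - y) / (1 - x * y)) = 1 - y := by
    -- If `x y = 1` then `y = 1`, so both sides are 0 and the division by zero is harmless.
    by_cases h : 1 - x * y = 0
    · have : y = 1 := by nlinarith
      rw [h, this]; ring
    · field_simp
  have e2 : (1 - x * y) * (1 - (1 - y) / (1 - x * y)) = (1 - x) * y := by
    rw [mul_sub, e1]; ring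
  have hw : 0 ≤ 1 - x * y := by linarith
  simp only [← ENNReal.ofReal_mul hw, e1, e2, ← ENNReal.ofReal_mul (sub_nonneg.2 hy1),
    ← ENNReal.ofReal_mul (sub_nonneg.2 hx1), ← ENNReal.ofReal_mul hx0]
  rw [mul_comm (1 - y) (1 - x), mul_comm (1 - y) x]
  ring

end Laws

/-! ### Descending the tree of subsets -/

section Levels

variable {n : ℕ}

theorem subsetProb_le_one (c : ℝ) (k : ℕ) : subsetProb n c k ≤ 1 := by
  rw [subsetProb]
  split_ifs
  · exact zero_le_one
  · exact levelProb_le_one c k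

theorem emptyProb_nonneg (c : ℝ) (a k : ℕ) : 0 ≤ emptyProb n c a k := by
  induction a generalizing k with
  | zero => exact sub_nonneg.2 (by exact_mod_cast subsetProb_le_one c k)
  | succ a ih => exact mul_nonneg (ih k) (ih (k + 1))

theorem emptyProb_le_one (c : ℝ) (a k : ℕ) : emptyProb n c a k ≤ 1 := by
  induction a generalizing k with
  | zero => exact sub_le_self _ (NNReal.coe_nonneg _)
  | succ a ih => exact mul_le_one₀ (ih k) (emptyProb_nonneg c a _) (ih (k + 1))

/-- The probability that a set is included that extends a given set of size `k` by some of `a`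
further elements. -/
def extensionProb (n : ℕ) (c : ℝ) (a k : ℕ) : ℝ≥0 :=
  ⟨1 - emptyProb n c a k, sub_nonneg.2 (emptyProb_le_one c a k)⟩

theorem coe_extensionProb (c : ℝ) (a k : ℕ) :
    (extensionProb n c a k : ℝ) = 1 - emptyProb n c a k := rfl

theorem extensionProb_le_one (c : ℝ) (a k : ℕ) : extensionProb n c a k ≤ 1 := by
  rw [← NNReal.coe_le_coe, coe_extensionProb]
  exact sub_le_self _ (emptyProb_nonneg c a k)

theorem extensionProb_zero (c : ℝ) (k : ℕ) : extensionProb n c 0 k = subsetProb n c k := by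
  rw [← NNReal.coe_inj, coe_extensionProb, emptyProb, sub_sub_cancel]

/-- The subsets of the first `i` elements. -/
def family (n i : ℕ) : Finset (Finset (Fin n)) :=
  (Finset.univ.filter fun j : Fin n => (j : ℕ) < i).powerset

theorem mem_family {i : ℕ} {S : Finset (Fin n)} : S ∈ family n i ↔ ∀ j ∈ S, (j : ℕ) < i := by
  simp [family, Finset.subset_iff]

theorem family_zero : family n 0 = {∅} := by
  simp [family]

theorem notMem_of_mem_family {i : ℕ} (hi : i < n) {S : Finset (Fin n)} (hS : S ∈ family n i) :
    (⟨i, hi⟩ : Fin n) ∉ S := fun h => (mem_family.1 hS _ h).false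

theorem family_succ {i : ℕ} (hi : i < n) :
    family n (i + 1) = family n i ∪ (family n i).image (insert ⟨i, hi⟩) := by
  rw [family, family, ← Finset.powerset_insert]
  congr 1
  ext j
  simp only [Finset.mem_filter, Finset.mem_univ, true_and, Finset.mem_insert, Fin.ext_iff]
  omega

theorem injOn_insert_family {i : ℕ} (hi : i < n) :
    Set.InjOn (insert (⟨i, hi⟩ : Fin n)) (family n i : Set (Finset (Fin n))) := by
  intro S hS S' hS' h
  rw [← Finset.erase_insert (notMem_of_mem_family hi hS), h,
    Finset.erase_insert (notMem_of_mem_family hi hS')]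

/-- The law of the subsets of the first `i` elements that extend to an included set. -/
def levelLaw (n : ℕ) (c : ℝ) (i : ℕ) : PMF (Finset (Finset (Fin n))) :=
  bernoulliSubset (family n i) (fun S => extensionProb n c (n - 1 - i) S.card)
    fun _ => extensionProb_le_one _ _ _

/-- The law of those of two sets `S`, `S'` that extend to an included set, given that there is one,
where `x` and `y` are the probabilities that they do not. -/
def childLaw (x y : ℝ) (S S' : Finset (Fin n)) : PMF (Finset (Finset (Fin n))) :=
  (flip ((1 - y) / (1 - x * y))).bind fun b => if b then
    ((flip (1 - x)).bind fun b' => PMF.pure (if b' then {S, S'} else {S'})) else PMF.pure {S}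

theorem levelLaw_zero (c : ℝ) : levelLaw n c 0 =
    (flip (1 - emptyProb n c (n - 1) 0)).map fun b => if b then {∅} else ∅ := by
  rw [levelLaw, family_zero, ← insert_empty_eq, bernoulliSubset_insert (by simp),
    bernoulliSubset_empty, ← PMF.bind_pure_comp]
  simp only [PMF.pure_map, coe_extensionProb, Finset.card_empty, Nat.sub_zero]
  rfl

/-- A node splits according to whether it receives element `i`. It is empty exactly if both children
are, with probability the product of theirs; `childLaw` is the conditional law, by `flip_split`. -/
theorem levelLaw_succ (c : ℝ) {i : ℕ} (hi : i + 1 < n) :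
    (levelLaw n c i).bind (fun T => independentUnion (fun S =>
      childLaw (emptyProb n c (n - 2 - i) S.card) (emptyProb n c (n - 2 - i) (S.card + 1)) S
        (insert ⟨i, by omega⟩ S)) T.val) = levelLaw n c (i + 1) := by
  have hi' : i < n := by omega
  rw [levelLaw, levelLaw, family_succ hi']
  refine bernoulliSubset_refine (injOn_insert_family hi')
    (fun S hS h => notMem_of_mem_family hi' h (Finset.mem_insert_self _ _)) _ _ ?_
  intro S hS
  have e1 : n - 1 - i = (n - 2 - i) + 1 := by omega
  have e2 : n - 1 - (i + 1) = n - 2 - i := by omega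
  have hsplit := flip_split (emptyProb_nonneg (n := n) c (n - 2 - i) S.card)
    (emptyProb_le_one c _ _) (emptyProb_nonneg (n := n) c (n - 2 - i) (S.card + 1))
    (emptyProb_le_one c _ _) (fun b b' => PMF.pure ((if b then {S} else ∅) ∪
      (if b' then {insert (⟨i, hi'⟩ : Fin n) S} else ∅) : Finset (Finset (Fin n))))
  simp only [coe_extensionProb, e1, e2, emptyProb,
    Finset.card_insert_of_notMem (notMem_of_mem_family hi' hS)]
  simp only [← PMF.bind_pure_comp, Function.comp_def]
  rw [← hsplit, childLaw]
  congr 1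
  funext b
  cases b
  · simp
  · simp only [if_true]
    congr 1
    funext b
    cases b
    · simp
    · simp only [if_true]
      congr 1
      funext b
      cases b
      · simp
      · rfl

/-- The pair of row indices that consists of a set and its complement. -/
def pairOf (S : Finset (Fin n)) : Finset (Row n) :=
  Finset.univ.filter fun z => z.1 = S ∨ z.1 = Sᶜ

theorem pairOf_row (z : Row n) : pairOf z.1 = {z, z.compl} := by
  ext y
  simp only [pairOf, Finset.mem_filter, Finset.mem_univ, true_and, Finset.mem_insert,
    Finset.mem_singleton, Subtype.ext_iff, Row.compl]

/-- The nonempty sets without the last element, which represent the pairs. -/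
def representatives (n : ℕ) : Finset (Finset (Fin n)) := (family n (n - 1)).erase ∅

theorem exists_row_of_mem_representatives {S : Finset (Fin n)} (hS : S ∈ representatives n) :
    ∃ z : Row n, z.1 = S := by
  rw [representatives, Finset.mem_erase, mem_family] at hS
  obtain ⟨h1, h2⟩ := hS
  obtain ⟨j, hj⟩ := Finset.nonempty_iff_ne_empty.2 h1
  have hn := j.2
  refine ⟨⟨S, Finset.card_pos.2 ⟨j, hj⟩, ?_⟩, rfl⟩
  have : (⟨n - 1, by omega⟩ : Fin n) ∉ S := fun h => (h2 _ h).false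
  have := Finset.card_lt_univ_of_notMem this
  simpa using this

theorem pairOf_mem_pairs {S : Finset (Fin n)} (hS : S ∈ representatives n) :
    pairOf S ∈ pairs n := by
  obtain ⟨z, rfl⟩ := exists_row_of_mem_representatives hS
  exact mem_pairs.2 ⟨z, pairOf_row z⟩

/-- The last element belongs to exactly one of a set and its complement. -/
theorem mem_representatives_iff_compl (z : Row n) :
    z.1 ∈ representatives n ↔ z.compl.1 ∉ representatives n := by
  have hn : 1 ≤ n := z.one_le
  have key : ∀ z : Row n, z.1 ∈ representatives n ↔ (⟨n - 1, by omega⟩ : Fin n) ∉ z.1 := by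
    intro z
    rw [representatives, Finset.mem_erase, mem_family]
    refine ⟨fun h h' => (h.2 _ h').false, fun h => ⟨?_, fun j hj => ?_⟩⟩
    · exact Finset.nonempty_iff_ne_empty.1 (Finset.card_pos.1 z.2.1)
    · have h1 := j.2
      have h2 : (j : ℕ) ≠ n - 1 := fun h' => h (by
        have : j = ⟨n - 1, by omega⟩ := Fin.ext h'
        rwa [← this])
      omega
  rw [key, key, Row.compl, Finset.mem_compl, not_not]

theorem pairs_eq_image : pairs n = (representatives n).image pairOf := by
  ext B
  rw [mem_pairs, Finset.mem_image]
  constructor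
  · rintro ⟨z, rfl⟩
    by_cases hz : z.1 ∈ representatives n
    · exact ⟨z.1, hz, pairOf_row z⟩
    · refine ⟨z.compl.1, ?_, ?_⟩
      · rw [mem_representatives_iff_compl] at hz
        exact not_not.1 hz
      · rw [pairOf_row, Row.compl_compl, Finset.pair_comm]
  · rintro ⟨S, hS, rfl⟩
    exact mem_pairs.1 (pairOf_mem_pairs hS)

theorem injOn_pairOf : Set.InjOn (pairOf (n := n)) (representatives n : Set (Finset (Fin n))) := by
  intro S hS S' hS' h
  obtain ⟨z, rfl⟩ := exists_row_of_mem_representatives hS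
  obtain ⟨y, rfl⟩ := exists_row_of_mem_representatives hS'
  rw [pairOf_row, pairOf_row] at h
  have hz : z ∈ ({y, y.compl} : Finset (Row n)) := h ▸ Finset.mem_insert_self _ _
  rw [Finset.mem_insert, Finset.mem_singleton] at hz
  rcases hz with rfl | rfl
  · rfl
  · exact absurd hS ((mem_representatives_iff_compl y).1 hS')

/-- With no undecided element left, extending means being included; the empty set drops out because
its probability was set to 0. -/
theorem levelLaw_last (c : ℝ) : levelLaw n c (n - 1) =
    bernoulliSubset (representatives n) (fun S => levelProb n c S.card)
      fun _ => levelProb_le_one _ _ := by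
  have h : family n (n - 1) = insert ∅ (representatives n) := by
    rw [representatives, Finset.insert_erase]
    exact mem_family.2 (by simp)
  rw [levelLaw, h, bernoulliSubset_insert_zero (by simp [representatives])]
  · refine bernoulliSubset_congr fun S hS => ?_
    obtain ⟨z, rfl⟩ := exists_row_of_mem_representatives hS
    rw [Nat.sub_self, extensionProb_zero, subsetProb, if_neg z.2.1.ne']
  · rw [Nat.sub_self, extensionProb_zero, subsetProb, if_pos Finset.card_empty]

theorem sampleLaw_eq_map (c : ℝ) :
    sampleLaw n c = (levelLaw n c (n - 1)).map (Finset.image pairOf) := by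
  have h : ∀ (s : Finset (Finset (Row n))) (hp : ∀ B, inclusionProb (n := n) c B ≤ 1)
      (hs : s = (representatives n).image pairOf), bernoulliSubset s (inclusionProb c) hp =
        (levelLaw n c (n - 1)).map (Finset.image pairOf) := by
    rintro _ hp rfl
    rw [bernoulliSubset_image injOn_pairOf, levelLaw_last]
    congr 1
    refine bernoulliSubset_congr fun S hS => ?_
    obtain ⟨z, rfl⟩ := exists_row_of_mem_representatives hS
    rw [pairOf_row, inclusionProb_pair]
  exact h _ _ pairs_eq_image

theorem subset_of_mem_support_levelLaw {c : ℝ} {T : Finset (Finset (Fin n))}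
    (hT : T ∈ (levelLaw n c (n - 1)).support) : T ⊆ representatives n := by
  rw [levelLaw_last] at hT
  exact subset_of_mem_support_bernoulliSubset hT

end Levels

/-! ### Coupling rules for programs -/

section CoupledRuns

variable {n : ℕ} {v : Finset (Fin n) → ℝ} {σ : State n} {β : Type}

theorem couple_run_frame {ρ : PMF β} {p : Cmd} {Q : β → State n → Prop}
    (h : Couple ρ (p.run v σ) Q) : Couple ρ (p.run v σ) fun b τ => Frame p σ τ ∧ Q b τ :=
  (h.and_right (holds_frame p σ)).mono fun _ _ h => ⟨h.2, h.1⟩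

theorem couple_seq {ρ : PMF β} {γ : Type} {g : β → PMF γ} {p q : Cmd} {Q : β → State n → Prop}
    {Q' : γ → State n → Prop} (h : Couple ρ (p.run v σ) Q)
    (h' : ∀ b τ, Q b τ → Couple (g b) (q.run v τ) Q') :
    Couple (ρ.bind g) ((Cmd.seq p q).run v σ) Q' := h.bind h'

theorem couple_loop {x : ℕ} {e : NExp} {p : Cmd} {g : ℕ → β → PMF β} {b : β}
    (Inv : ℕ → β → State n → Prop) (h0 : Inv 0 b (σ.tick (e.size + 1)))
    (hs : ∀ k < e.eval σ, ∀ c τ, Frame (.loop x e p) σ τ → Inv k c τ →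
      Couple (g k c) (p.run v ((τ.putNat x 0 k).tick 1)) (Inv (k + 1))) :
    Couple (iterate g (e.eval σ) b) ((Cmd.loop x e p).run v σ)
      fun c τ => Frame (.loop x e p) σ τ ∧ Inv (e.eval σ) c τ := by
  refine Couple.iterate (Q := fun k c τ => Frame (.loop x e p) σ τ ∧ Inv k c τ)
    ⟨frame_tick _ σ _, h0⟩ _ ?_
  rintro k hk c τ ⟨hF, hI⟩
  refine (couple_run_frame (hs k hk c τ hF hI)).mono ?_
  rintro c' ρ ⟨⟨h1, h2, h3⟩, h4⟩
  refine ⟨hF.trans ⟨fun a ha => ?_, fun a ha => h2 a ha, fun h => h3 h⟩, h4⟩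
  simp only [Cmd.natWrites, List.mem_cons, not_or] at ha
  rw [h1 a ha.2]
  simp [State.putNat, State.tick, ha.1]

theorem couple_coin {a : ℕ} {i : NExp} {e : RExp} {x : ℝ} (hx : e.eval σ = x) :
    Couple (flip x) ((Cmd.coin a i e).run v σ) fun b τ =>
      τ = (σ.putNat a (i.eval σ) (if b then 1 else 0)).tick (i.size + e.size + 1) := by
  rw [← PMF.bind_pure (flip x), Cmd.run, hx, ← PMF.bind_pure_comp]
  refine (couple_refl (flip x)).bind ?_
  rintro b _ rfl
  exact couple_pure rfl

theorem Holds.couple {p : Cmd} {b : β} {Q : β → State n → Prop} (h : Holds v p σ (Q b)) :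
    Couple (PMF.pure b) (p.run v σ) Q := couple_of_support b h

end CoupledRuns

/-! ### The sampling program -/

section Program

/-- Replace row `r` by its children that extend to a sampled set; an additional child is appended
to the list of rows. -/
def splitRow : Cmd :=
  let a : NExp := .sub (.sub .dim (.const 2)) .i
  let x : RExp := .get 4 (.ix a (.get 4 .j))
  let y : RExp := .get 4 (.ix a (.succ (.get 4 .j)))
  .list [
    .coin 8 (.const 0) (.div (.sub (.const 1) y) (.sub (.const 1) (.mul x y))),
    .ite (.natEq (.get 8 (.const 0)) (.const 1))
      (.list [
        .coin 8 (.const 0) (.sub (.const 1) x),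
        .ite (.natEq (.get 8 (.const 0)) (.const 1))
          (.list [
            .setNat 3 (.get 1 (.const 0)) (.get 3 .j),
            .setNat 4 (.get 1 (.const 0)) (.get 4 .j),
            .setNat 1 (.const 0) (.succ (.get 1 (.const 0)))])
          .skip,
        .setNat 3 .j (.add (.get 3 .j) (.get 2 .i)),
        .setNat 4 .j (.succ (.get 4 .j))])
      .skip]

/-- Sample the representatives of the pairs by descending in the tree of all sets. -/
def sampling : Cmd := .list [
  .coin 1 (.const 0) (.sub (.const 1) (.get 4 (.ix (.sub .dim (.const 1)) (.const 0)))),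
  .loop 5 (.sub .dim (.const 1)) (.loop 6 (.get 1 (.const 0)) splitRow)]

variable {n : ℕ} {v : Finset (Fin n) → ℝ} {σ : State n}

/-- The integer that encodes a set. -/
def code (S : Finset (Fin n)) : ℕ := ∑ j ∈ S, 2 ^ (j : ℕ)

/-- The rows in memory are the codes and the cardinalities of the sets `f 0`, `f 1`, …. -/
structure Stored (σ : State n) (f : ℕ → Finset (Fin n)) : Prop where
  code_eq : ∀ r < σ.nat 1 0, σ.nat 3 r = code (f r)
  card_eq : ∀ r < σ.nat 1 0, σ.nat 4 r = (f r).card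

/-- The rows in memory are the members of a set, each of them occurring once. -/
def StoredSet (σ : State n) (T : Finset (Finset (Fin n))) : Prop :=
  ∃ f, Stored σ f ∧ T.val = (Multiset.range (σ.nat 1 0)).map f

/-- The state in the middle of a pass over the rows: of `N` rows `f 0`, `f 1`, …, the first `k`
have been replaced by the members of `U`. -/
def SplitRows (i N : ℕ) (hi : i < n) (f : ℕ → Finset (Fin n)) (k : ℕ)
    (U : Finset (Finset (Fin n))) (σ : State n) : Prop :=
  (∀ S ∈ U, S.erase ⟨i, hi⟩ ∈ (Finset.range k).image f) ∧
  ∃ g l, σ.nat 1 0 = N + l ∧ Stored σ g ∧ (∀ r, k ≤ r → r < N → g r = f r) ∧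
    U.val = (Multiset.range k).map g + (Multiset.range l).map fun t => g (N + t)

/-- Slot `k` keeps one surviving child. If both survive, the child without `i` is copied to the end
of the list and the one with `i` takes slot `k`. -/
theorem couple_splitRow {i N k : ℕ} (hi : i + 1 < n) {c : ℝ} {f : ℕ → Finset (Fin n)}
    {U : Finset (Finset (Fin n))} (hn : σ.nat 0 0 = n) (h5 : σ.nat 5 0 = i) (h6 : σ.nat 6 0 = k)
    (h2 : σ.nat 2 i = 2 ^ i)
    (hE : ∀ a k, a + k < n → σ.real 4 (idx a k) = emptyProb n c a k) (hk : k < N)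
    (hf : ∀ r < N, f r ∈ family n i) (hinj : ∀ r < N, ∀ s < N, f r = f s → r = s)
    (hU : SplitRows i N (by omega) f k U σ) :
    Couple ((childLaw (emptyProb n c (n - 2 - i) (f k).card)
        (emptyProb n c (n - 2 - i) ((f k).card + 1)) (f k) (insert ⟨i, by omega⟩ (f k))).map (U ∪ ·))
      (splitRow.run v σ) (SplitRows i N (by omega) f (k + 1)) := by
  have hi' : i < n := by omega
  obtain ⟨hU1, g, l, hcnt, ⟨hg1, hg2⟩, hgf, hU2⟩ := hU
  set S := f k with hS
  have hSi : (⟨i, hi'⟩ : Fin n) ∉ S := notMem_of_mem_family hi' (hf k hk)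
  have hgk : g k = S := hgf k le_rfl hk
  have hcode : σ.nat 3 k = code S := by rw [hg1 k (by omega), hgk]
  have hcard : σ.nat 4 k = S.card := by rw [hg2 k (by omega), hgk]
  have hSle : S.card ≤ i := by
    have h1 : S ⊆ Finset.univ.filter fun j : Fin n => (j : ℕ) < i :=
      Finset.mem_powerset.1 (hf k hk)
    have h2 := Finset.card_le_card h1
    have h3 : (Finset.univ.filter fun j : Fin n => (j : ℕ) < i).card ≤ (Finset.range i).card :=
      Finset.card_le_card_of_injOn (fun j => (j : ℕ)) (by intro j; simp) (by
        intro a _ b _ h; exact Fin.ext h)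
    rw [Finset.card_range] at h3
    omega
  have hx := hE (n - 2 - i) S.card (by omega)
  have hy := hE (n - 2 - i) (S.card + 1) (by omega)
  -- Erasing `i` recovers the parent, and the parents are distinct, so children of different rows
  -- never coincide.
  have hnew : ∀ S', S'.erase ⟨i, hi'⟩ = S → S' ∉ U := by
    intro S' h h'
    obtain ⟨r, hr, hr'⟩ := Finset.mem_image.1 (hU1 S' h')
    rw [h] at hr'
    have := hinj r (by have := Finset.mem_range.1 hr; omega) k hk hr'
    rw [this] at hr
    exact absurd hr (by simp)
  have herase : (insert ⟨i, hi'⟩ S).erase ⟨i, hi'⟩ = S := Finset.erase_insert hSi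
  have herase' : S.erase ⟨i, hi'⟩ = S := Finset.erase_eq_of_notMem hSi
  have hne : S ≠ insert ⟨i, hi'⟩ S := fun h => hSi (h ▸ Finset.mem_insert_self _ _)
  have hcode' : code (insert ⟨i, hi'⟩ S) = code S + 2 ^ i := by
    rw [code, Finset.sum_insert hSi, add_comm]; rfl
  have hcard' : (insert ⟨i, hi'⟩ S).card = S.card + 1 := Finset.card_insert_of_notMem hSi
  have hU1' : ∀ V : Finset (Finset (Fin n)), (∀ S' ∈ V, S'.erase ⟨i, hi'⟩ = S) →
      ∀ S' ∈ U ∪ V, S'.erase ⟨i, hi'⟩ ∈ (Finset.range (k + 1)).image f := by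
    intro V hV S' hS'
    rw [Finset.range_add_one, Finset.image_insert, Finset.mem_insert]
    rcases Finset.mem_union.1 hS' with h | h
    · exact Or.inr (hU1 S' h)
    · exact Or.inl (hV S' h)
  have hval : ∀ V : Finset (Finset (Fin n)), (∀ S' ∈ V, S'.erase ⟨i, hi'⟩ = S) →
      (U ∪ V).val = U.val + V.val := by
    intro V hV
    rw [← Finset.disjUnion_eq_union U V, Finset.disjUnion_val]
    rw [Finset.disjoint_left]
    exact fun S' h h' => hnew S' (hV S' h') h
  have hV1 : ∀ S' ∈ ({S} : Finset (Finset (Fin n))), S'.erase ⟨i, hi'⟩ = S := by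
    simp [herase']
  have hV2 : ∀ S' ∈ ({insert ⟨i, hi'⟩ S} : Finset (Finset (Fin n))), S'.erase ⟨i, hi'⟩ = S := by
    simp [herase]
  have hV3 : ∀ S' ∈ ({S, insert ⟨i, hi'⟩ S} : Finset (Finset (Fin n))),
      S'.erase ⟨i, hi'⟩ = S := by
    simp [herase, herase']
  have hmap : ∀ (g' : ℕ → Finset (Fin n)), (∀ r, r ≠ k → r < N + l → g' r = g r) →
      (Multiset.range (k + 1)).map g' + (Multiset.range l).map (fun t => g' (N + t)) =
        U.val + {g' k} := by
    intro g' hg'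
    rw [hU2, Multiset.range_succ, Multiset.map_cons, ← Multiset.singleton_add,
      Multiset.map_congr (g := g) rfl fun r hr => hg' r (by
        have := Multiset.mem_range.1 hr; omega) (by have := Multiset.mem_range.1 hr; omega),
      Multiset.map_congr (f := fun t => g' (N + t)) (g := fun t => g (N + t)) rfl fun t ht =>
        hg' (N + t) (by omega) (by have := Multiset.mem_range.1 ht; omega)]
    abel
  rw [splitRow, childLaw, PMF.map_bind]
  refine couple_seq (couple_coin (by simp [hn, h5, h6, hcard, hx, hy])) ?_
  rintro b τ rfl
  cases b
  · rw [if_neg (by simp), PMF.pure_map]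
    refine Holds.couple ?_
    rw [holds_ite]
    refine ⟨fun h => by simp at h, fun _ => holds_skip.2 ?_⟩
    refine ⟨hU1' _ hV1, g, l, ?_, ⟨?_, ?_⟩, ?_, ?_⟩
    · simpa using hcnt
    · simpa using hg1
    · simpa using hg2
    · exact fun r h h' => hgf r (by omega) h'
    · rw [hval _ hV1, hmap g fun _ _ _ => rfl, hgk]; rfl
  · simp only [if_true, PMF.map_bind]
    rw [Cmd.run, if_pos (by simp)]
    simp only [PMF.pure_map]
    refine couple_seq (couple_coin (by simp [hn, h5, h6, hcard, hx])) ?_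
    rintro b τ rfl
    refine Holds.couple ?_
    simp only [Cmd.list, holds_seq, holds_ite, holds_setNat, holds_skip]
    cases b
    · refine ⟨fun h => by simp at h, fun _ => ?_⟩
      refine ⟨hU1' _ hV2, Function.update g k (insert ⟨i, hi'⟩ S), l, ?_, ⟨?_, ?_⟩, ?_, ?_⟩
      · simpa using hcnt
      · intro r hr
        simp at hr
        by_cases hrk : r = k
        · subst hrk
          simp [h6, h5, h2, hcode, hcode']
        · simp [h6, h5, hrk, hg1 r hr]
      · intro r hr
        simp at hr
        by_cases hrk : r = k
        · subst hrk
          simp [h6, hcard, hcard']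
        · simp [h6, hrk, hg2 r hr]
      · intro r h h'
        rw [Function.update_of_ne (by omega), hgf r (by omega) h']
      · rw [if_neg (by simp), hval _ hV2, hmap _ fun r h _ => Function.update_of_ne h _ _,
          Function.update_self]
        rfl
    · refine ⟨fun _ => ?_, fun h => by simp at h⟩
      have hkl : k ≠ N + l := by omega
      refine ⟨hU1' _ hV3, Function.update (Function.update g (N + l) S) k (insert ⟨i, hi'⟩ S),
        l + 1, ?_, ⟨?_, ?_⟩, ?_, ?_⟩
      · simp [hcnt, add_assoc]
      · intro r hr
        simp [hcnt] at hr
        by_cases hrk : r = k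
        · subst hrk
          simp [h6, h5, h2, hcode, hcode', hcnt, hkl]
        · by_cases hrl : r = N + l
          · subst hrl
            simp [h6, hcode, hcnt, hrk]
          · simp [h6, h5, hrk, hrl, hcnt, hg1 r (by omega)]
      · intro r hr
        simp [hcnt] at hr
        by_cases hrk : r = k
        · subst hrk
          simp [h6, hcard, hcard', hcnt, hkl]
        · by_cases hrl : r = N + l
          · subst hrl
            simp [h6, hcard, hcnt, hrk]
          · simp [h6, hrk, hrl, hcnt, hg2 r (by omega)]
      · intro r h h'
        rw [Function.update_of_ne (by omega), Function.update_of_ne (by omega), hgf r (by omega) h']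
      · rw [if_pos rfl, hval _ hV3, Multiset.range_succ l, Multiset.map_cons, Multiset.add_cons,
          hmap, Function.update_self, Function.update_of_ne hkl.symm, Function.update_self,
          Finset.insert_val_of_notMem (by simpa using hne), Multiset.add_cons]
        · rfl
        · intro r h h'
          rw [Function.update_of_ne h, Function.update_of_ne h'.ne]

/-- Sampling produces the law of the representatives of the sampled pairs. -/
theorem couple_sampling {c : ℝ} (hn1 : 1 ≤ n) (hn : σ.nat 0 0 = n) (h3 : σ.nat 3 0 = 0)
    (h4 : σ.nat 4 0 = 0) (h2 : ∀ t ≤ n, σ.nat 2 t = 2 ^ t)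
    (hE : ∀ a k, a + k < n → σ.real 4 (idx a k) = emptyProb n c a k) :
    Couple (levelLaw n c (n - 1)) (sampling.run v σ) fun T τ => StoredSet τ T := by
  -- The abstract descent from the root; the case distinction only supplies the proof that `i` is an
  -- element.
  have hlaw : ∀ N ≤ n - 1, (levelLaw n c 0).bind (iterate (fun i T => if hi : i + 1 < n then
      independentUnion (fun S => childLaw (emptyProb n c (n - 2 - i) S.card)
        (emptyProb n c (n - 2 - i) (S.card + 1)) S (insert ⟨i, by omega⟩ S)) T.val
      else PMF.pure T) N) = levelLaw n c N := by
    intro N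
    induction N with
    | zero => exact fun _ => PMF.bind_pure _
    | succ N ih =>
      intro hN
      rw [← levelLaw_succ c (by omega : N + 1 < n), ← ih (by omega), PMF.bind_bind]
      congr 1
      funext T
      rw [iterate]
      congr 1
      funext T
      rw [dif_pos (by omega)]
  rw [← hlaw _ le_rfl, levelLaw_zero, PMF.bind_map, sampling]
  refine couple_seq (couple_run_frame (couple_coin (x := 1 - emptyProb n c (n - 1) 0)
    (by simp [hn, hE (n - 1) 0 (by omega)]))) ?_
  rintro b τ ⟨hF, rfl⟩
  have hloop := couple_loop (v := v) (σ := (σ.putNat 1 0 (if b then 1 else 0)).tick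
      (NExp.size (.const 0) + RExp.size (.sub (.const 1)
        (.get 4 (.ix (.sub .dim (.const 1)) (.const 0)))) + 1))
    (x := 5) (e := .sub .dim (.const 1)) (p := .loop 6 (.get 1 (.const 0)) splitRow)
    (g := fun i T => if hi : i + 1 < n then
      independentUnion (fun S => childLaw (emptyProb n c (n - 2 - i) S.card)
        (emptyProb n c (n - 2 - i) (S.card + 1)) S (insert ⟨i, by omega⟩ S)) T.val
      else PMF.pure T) (b := if b then {∅} else ∅)
    (fun i T τ => T ⊆ family n i ∧ StoredSet τ T) ?_ ?_
  · have e1 : (NExp.sub NExp.dim (.const 1)).eval ((σ.putNat 1 0 (if b then 1 else 0)).tick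
      (NExp.size (.const 0) + RExp.size (.sub (.const 1)
        (.get 4 (.ix (.sub .dim (.const 1)) (.const 0)))) + 1)) = n - 1 := by simp [hn]
    rw [e1] at hloop
    exact hloop.mono fun T τ h => h.2.2
  · refine ⟨?_, fun _ => ∅, ⟨?_, ?_⟩, ?_⟩
    · cases b <;> simp [family_zero]
    · intro r hr
      cases b
      · simp at hr
      · simp at hr
        simp [hr, h3, code]
    · intro r hr
      cases b
      · simp at hr
      · simp at hr
        simp [hr, h4]
    · cases b <;> simp
  · rintro i hi T τ hF ⟨hT, f, hf, hfT⟩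
    simp [hn] at hi
    have hn' := congrFun (hF.nat 0 (by decide)) 0
    have h2' := hF.nat 2 (by decide)
    have hE' := hF.real 4 (by decide)
    simp [State.putNat_nat_of_ne, hn] at hn' h2' hE'
    have hi' : i + 1 < n := by omega
    have hi'' : i < n := by omega
    rw [dif_pos hi', hfT, ← iterate_independentUnion]
    have hmem : ∀ r < τ.nat 1 0, f r ∈ T := by
      intro r hr
      rw [← Finset.mem_val, hfT]
      exact Multiset.mem_map_of_mem _ (Multiset.mem_range.2 hr)
    have hnd : ((Multiset.range (τ.nat 1 0)).map f).Nodup := hfT ▸ T.nodup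
    have hinj : ∀ r < τ.nat 1 0, ∀ s < τ.nat 1 0, f r = f s → r = s := by
      intro r hr s hs h
      exact Multiset.inj_on_of_nodup_map hnd r (Multiset.mem_range.2 hr) s
        (Multiset.mem_range.2 hs) h
    -- The loop bound is the number of rows on entry, so children appended during a pass are not
    -- split in the same pass.
    have hin := couple_loop (v := v) (σ := (τ.putNat 5 0 i).tick 1) (x := 6)
      (e := .get 1 (.const 0)) (p := splitRow)
      (g := fun k U => (childLaw (emptyProb n c (n - 2 - i) (f k).card)
        (emptyProb n c (n - 2 - i) ((f k).card + 1)) (f k)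
          (insert ⟨i, by omega⟩ (f k))).map (U ∪ ·)) (b := ∅)
      (SplitRows i (τ.nat 1 0) hi'' f) ?_ ?_
    · have e1 : (NExp.get 1 (.const 0)).eval ((τ.putNat 5 0 i).tick 1) = τ.nat 1 0 := by simp
      rw [e1] at hin
      refine hin.mono ?_
      rintro U ρ ⟨-, hU1, g, l, hcnt, hg, -, hU2⟩
      refine ⟨fun S hS => ?_, g, hg, ?_⟩
      · obtain ⟨r, hr, hr'⟩ := Finset.mem_image.1 (hU1 S hS)
        have h1 := hT (hmem r (Finset.mem_range.1 hr))
        rw [hr'] at h1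
        rw [mem_family] at h1 ⊢
        intro j hj
        by_cases hji : j = ⟨i, hi''⟩
        · rw [hji]; exact Nat.lt_succ_self i
        · exact (h1 j (Finset.mem_erase.2 ⟨hji, hj⟩)).trans (Nat.lt_succ_self i)
      · rw [hU2, hcnt, Multiset.range_add, Multiset.map_add, Multiset.map_map]
        rfl
    · refine ⟨by simp, f, 0, by simp, ⟨?_, ?_⟩, fun _ _ _ => rfl, by simp⟩
      · simpa using hf.1
      · simpa using hf.2
    · rintro k hk U ρ hG hU
      have g0 := congrFun (hG.nat 0 (by decide)) 0
      have g5 := congrFun (hG.nat 5 (by decide)) 0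
      have g2 := hG.nat 2 (by decide)
      have g4 := hG.real 4 (by decide)
      simp [State.putNat_nat_of_ne] at g0 g5 g2 g4 hk
      refine couple_splitRow hi' ?_ ?_ ?_ ?_ ?_ hk (fun r hr => hT (hmem r hr)) hinj ?_
      · simp [g0, hn']
      · simp [g5]
      · simp
      · simp [g2, h2', h2 i (by omega)]
      · simp only [State.tick_real, State.putNat_real, g4, hE']
        exact hE
      · obtain ⟨u1, g, l, u2, ⟨u3, u4⟩, u5, u6⟩ := hU
        exact ⟨u1, g, l, by simpa using u2, ⟨by simpa using u3, by simpa using u4⟩, u5, u6⟩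

end Program

/-! ### Binary codes of sets -/

section Codes

variable {n : ℕ}

/-- The part of the code of a set that stems from the elements below `p`. -/
def codeBelow (S : Finset (Fin n)) (p : ℕ) : ℕ := code (S.filter fun j : Fin n => (j : ℕ) < p)

theorem codeBelow_self (S : Finset (Fin n)) : codeBelow S n = code S := by
  rw [codeBelow, Finset.filter_true_of_mem fun j _ => j.2]

theorem codeBelow_succ (S : Finset (Fin n)) {p : ℕ} (hp : p < n) :
    codeBelow S (p + 1) = (if (⟨p, hp⟩ : Fin n) ∈ S then 2 ^ p else 0) + codeBelow S p := by
  have hnot : (⟨p, hp⟩ : Fin n) ∉ S.filter fun j : Fin n => (j : ℕ) < p := by simp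
  split_ifs with h
  · have : (S.filter fun j : Fin n => (j : ℕ) < p + 1) = insert ⟨p, hp⟩ (S.filter fun j : Fin n => (j : ℕ) < p) := by
      ext j
      simp only [Finset.mem_filter, Finset.mem_insert, Fin.ext_iff]
      constructor
      · rintro ⟨h1, h2⟩
        by_cases hj : (j : ℕ) = p
        · exact Or.inl hj
        · exact Or.inr ⟨h1, by omega⟩
      · rintro (h1 | ⟨h1, h2⟩)
        · have : j = ⟨p, hp⟩ := Fin.ext h1
          exact ⟨this ▸ h, by omega⟩
        · exact ⟨h1, by omega⟩
    rw [codeBelow, this, code, Finset.sum_insert hnot]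
    rfl
  · rw [zero_add, codeBelow, codeBelow]
    congr 1
    ext j
    simp only [Finset.mem_filter]
    refine and_congr_right fun hj => ?_
    have : (j : ℕ) ≠ p := fun h' => h ((Fin.ext h' : j = ⟨p, hp⟩) ▸ hj)
    omega

/-- Lets the program read the top bit of a code by one comparison, without division. -/
theorem codeBelow_lt (S : Finset (Fin n)) {p : ℕ} (hp : p ≤ n) : codeBelow S p < 2 ^ p := by
  induction p with
  | zero => simp [codeBelow, code]
  | succ p ih =>
    have h1 := ih (by omega)
    rw [codeBelow_succ S (by omega), pow_succ]
    split_ifs <;> omega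

end Codes

/-! ### Evaluating the value function and forming the normal equations -/

section Accumulation

/-- Decode a row into the indicator vectors of its set and of the complement. -/
def decode : Cmd := .list [
  .setNat 13 (.const 0) (.get 3 .i),
  .loop 6 .dim
    (.ite (.natLt (.get 13 (.const 0)) (.get 2 (.sub (.sub .dim (.const 1)) .j)))
      (.list [
        .setNat 9 (.sub (.sub .dim (.const 1)) .j) (.const 0),
        .setNat 10 (.sub (.sub .dim (.const 1)) .j) (.const 1)])
      (.list [
        .setNat 9 (.sub (.sub .dim (.const 1)) .j) (.const 1),
        .setNat 10 (.sub (.sub .dim (.const 1)) .j) (.const 0),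
        .setNat 13 (.const 0)
          (.sub (.get 13 (.const 0)) (.get 2 (.sub (.sub .dim (.const 1)) .j)))]))]

/-- Evaluate the value function at a row and at its complement, and compute the weight of the row
and its entry of the right hand side. -/
def weigh : Cmd :=
  let k : NExp := .get 4 .i
  .list [
    .query 3 (.const 2) 9,
    .query 3 (.const 3) 10,
    .setReal 3 (.const 4)
      (.div (.div (.const 1) (.mul (.mul (.get 1 k) (.ofNat k)) (.sub (.ofNat .dim) (.ofNat k))))
        (.sub (.const 1) (.get 4 (.ix (.const 0) k)))),
    .setReal 3 (.const 5) (.mul (.get 3 (.const 4)) (.sub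
      (.sub (.sub (.get 3 (.const 2)) (.get 5 (.const 0))) (.mul (.get 5 (.const 2)) (.ofNat k)))
      (.sub (.sub (.get 3 (.const 3)) (.get 5 (.const 0)))
        (.mul (.get 5 (.const 2)) (.sub (.ofNat .dim) (.ofNat k))))))]

/-- Subtract from the indicator vector of a row its mean. -/
def center : Cmd :=
  .loop 6 .dim (.setReal 6 .j (.sub (.ofNat (.get 9 .j)) (.div (.ofNat (.get 4 .i)) (.ofNat .dim))))

/-- Add the contributions of a row and its complement to the normal equations. -/
def addTerms : Cmd :=
  .loop 6 .dim (.list [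
    .setReal 7 .j (.add (.get 7 .j) (.mul (.get 3 (.const 5)) (.get 6 .j))),
    .loop 7 .dim (.list [
      .setReal 8 (.ix .j .l) (.add (.get 8 (.ix .j .l))
        (.mul (.mul (.mul (.const 2) (.get 3 (.const 4))) (.get 6 .j)) (.get 6 .l))),
      .setReal 9 (.ix .j .l) (.get 8 (.ix .j .l))])])

/-- Treat one row and its complement. -/
def accumulateRow : Cmd := .list [decode, weigh, center, addTerms]

/-- Evaluate the value function at the empty set and at the full set. -/
def evaluateEnds : Cmd := .list [
  .query 5 (.const 0) 12,
  .loop 5 .dim (.setNat 11 .i (.const 1)),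
  .query 5 (.const 1) 11,
  .setReal 5 (.const 2) (.div (.sub (.get 5 (.const 1)) (.get 5 (.const 0))) (.ofNat .dim))]

/-- Set up the normal equations. -/
def accumulate : Cmd := .seq evaluateEnds (.loop 5 (.get 1 (.const 0)) accumulateRow)

variable {n : ℕ} {v : Finset (Fin n) → ℝ} {σ : State n}

/-- Bits are stripped from the top: after `k` rounds the remaining number is the code of the
elements below `n - k`. -/
theorem holds_decode {S : Finset (Fin n)} (hn : σ.nat 0 0 = n)
    (h3 : σ.nat 3 (σ.nat 5 0) = code S) (h2 : ∀ t ≤ n, σ.nat 2 t = 2 ^ t) :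
    Holds v decode σ fun τ => (∀ j : Fin n, τ.nat 9 j = if j ∈ S then 1 else 0) ∧
      τ.readSet 9 = S ∧ τ.readSet 10 = Sᶜ := by
  rw [decode]
  simp only [Cmd.list, holds_seq, holds_setNat]
  refine holds_loop (fun k τ => τ.nat 13 0 = codeBelow S (n - k) ∧
    ∀ j : Fin n, n - k ≤ j → τ.nat 9 j = (if j ∈ S then 1 else 0) ∧
      τ.nat 10 j = if j ∈ S then 0 else 1) ?_ ?_ ?_
  · refine ⟨by simp [h3, codeBelow_self], fun j hj => ?_⟩
    have := j.2
    omega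
  · rintro k hk τ hF ⟨h13, hτ⟩
    have g2 := hF.nat 2 (by decide)
    have g0 := congrFun (hF.nat 0 (by decide)) 0
    simp [hn] at hk
    simp [State.putNat_nat_of_ne, hn] at g2 g0
    have hp : n - 1 - k < n := by omega
    have e1 : n - k = (n - 1 - k) + 1 := by omega
    have e2 : n - (k + 1) = n - 1 - k := by omega
    rw [e1, codeBelow_succ S hp] at h13
    have hlt := codeBelow_lt S hp.le
    rw [e2]
    simp only [holds_ite, holds_seq, holds_setNat]
    have h2' := h2 (n - 1 - k) hp.le
    have hcase : ∀ j : Fin n, n - 1 - k ≤ j → (j = ⟨n - 1 - k, hp⟩ ∨ n - k ≤ j ∧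
        (j : ℕ) ≠ n - 1 - k) := by
      intro j hj
      rcases hj.lt_or_eq with h | h
      · exact Or.inr ⟨by omega, by omega⟩
      · exact Or.inl (Fin.ext h.symm)
    constructor
    · intro hlt'
      simp [g2, g0, h2', h13] at hlt'
      have hnot : (⟨n - 1 - k, hp⟩ : Fin n) ∉ S := by
        intro h
        rw [if_pos h] at hlt'
        omega
      rw [if_neg hnot, zero_add] at h13
      refine ⟨by simp [h13], fun j hj => ?_⟩
      rcases hcase j hj with rfl | ⟨h, h'⟩
      · simp [g0, hnot]
      · simp [g0, h', hτ j h]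
    · intro hlt'
      simp [g2, g0, h2', h13] at hlt'
      have hin : (⟨n - 1 - k, hp⟩ : Fin n) ∈ S := by
        by_contra h
        rw [if_neg h] at hlt'
        omega
      rw [if_pos hin] at h13
      refine ⟨by simp [h13, g2, g0, h2'], fun j hj => ?_⟩
      rcases hcase j hj with rfl | ⟨h, h'⟩
      · simp [g0, hin]
      · simp [g0, h', hτ j h]
  · rintro τ - ⟨-, hτ⟩
    simp [hn] at hτ
    refine ⟨fun j => (hτ j).1, ?_, ?_⟩
    · ext j
      simp [State.readSet, hτ j]
    · ext j
      simp [State.readSet, hτ j]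

/-- The weight `w(k) / p` of a set of size `k` in the sampled problem. -/
def sampleWeight (n : ℕ) (c : ℝ) (k : ℕ) : ℝ := weight n k / levelProb n c k

/-- The contribution of a set and its complement to the Gram matrix. -/
def gramTerm (c : ℝ) (S : Finset (Fin n)) (j l : Fin n) : ℝ :=
  2 * sampleWeight n c S.card * centered S j * centered S l

/-- The contribution of a set and its complement to the right hand side. -/
def rhsTerm (v : Finset (Fin n) → ℝ) (c : ℝ) (S : Finset (Fin n)) (j : Fin n) : ℝ :=
  sampleWeight n c S.card * ((v S - v ∅ - (v Finset.univ - v ∅) / n * S.card) -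
    (v Sᶜ - v ∅ - (v Finset.univ - v ∅) / n * (n - S.card))) * centered S j

theorem holds_query_of {Q : State n → Prop} {a b : ℕ} {i : NExp} {S : Finset (Fin n)}
    (h : σ.readSet b = S) : Holds v (.query a i b) σ Q ↔
      Q { (σ.putReal a (i.eval σ) (v S)).tick (i.size + 1) with queries := S :: σ.queries } := by
  rw [holds_query, h]

/-- The inclusion probability is recovered as 1 minus the emptiness probability at a leaf. The two
targets are subtracted because the centered vector of the complement is the negative. -/
theorem holds_weigh {c : ℝ} {S : Finset (Fin n)} (hn : σ.nat 0 0 = n)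
    (hk0 : S.card ≠ 0) (hkn : S.card < n) (h9 : σ.readSet 9 = S) (h10 : σ.readSet 10 = Sᶜ)
    (h4 : σ.nat 4 (σ.nat 5 0) = S.card) (hB : ∀ t ≤ n, σ.real 1 t = n.choose t)
    (hE : ∀ k < n, σ.real 4 (idx 0 k) = emptyProb n c 0 k) (hV : σ.real 5 0 = v ∅)
    (hα : σ.real 5 2 = (v Finset.univ - v ∅) / n) :
    Holds v weigh σ fun τ => τ.queries = Sᶜ :: S :: σ.queries ∧
      τ.real 3 4 = sampleWeight n c S.card ∧
      τ.real 3 5 = sampleWeight n c S.card *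
        ((v S - v ∅ - (v Finset.univ - v ∅) / n * S.card) -
          (v Sᶜ - v ∅ - (v Finset.univ - v ∅) / n * (n - S.card))) := by
  have hw : ((n : ℝ) - S.card)⁻¹ * ((S.card : ℝ)⁻¹ * (σ.real 1 S.card)⁻¹) /
      (1 - σ.real 4 (idx 0 S.card)) = sampleWeight n c S.card := by
    rw [hE _ hkn, emptyProb, subsetProb, if_neg hk0, sub_sub_cancel, hB _ hkn.le, sampleWeight,
      weight, mul_inv, mul_inv]
    ring
  rw [weigh]
  simp only [Cmd.list]
  refine holds_seq.2 ((holds_query_of h9).2 (holds_seq.2 ((holds_query_of (by exact h10)).2 ?_)))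
  simp only [holds_seq, holds_setReal]
  refine ⟨rfl, ?_, ?_⟩
  · simp [h4, hn, hw]
  · simp [h4, hn, hw, hV, hα]

theorem holds_center {a : ℕ → ℝ} (hn : σ.nat 0 0 = n)
    (ha : ∀ j < n, a j = σ.nat 9 j - (σ.nat 4 (σ.nat 5 0) : ℝ) / n) :
    Holds v center σ fun τ => ∀ j < n, τ.real 6 j = a j := by
  rw [center]
  refine holds_loop (fun k τ => ∀ j < k, τ.real 6 j = a j) (by simp) ?_ ?_
  · intro k hk τ hF hτ
    have g0 := congrFun (hF.nat 0 (by decide)) 0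
    have g4 := hF.nat 4 (by decide)
    have g5 := congrFun (hF.nat 5 (by decide)) 0
    have g9 := hF.nat 9 (by decide)
    simp [hn] at hk
    rw [holds_setReal]
    intro j hj
    rcases Nat.lt_succ_iff_lt_or_eq.1 hj with hj | rfl
    · simp [hj.ne, hτ j hj]
    · simp [g0, g4, g5, g9, hn, ha j hk]
  · intro τ _ h
    simpa [hn] using h

/-- Array 9 is maintained as a copy of array 8: the solver destroys one and needs the other. -/
theorem holds_addTerms {s t : ℝ} {a : ℕ → ℝ} (hn : σ.nat 0 0 = n) (hs : σ.real 3 4 = s)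
    (ht : σ.real 3 5 = t) (ha : ∀ j < n, σ.real 6 j = a j)
    (h89 : ∀ j l : Fin n, σ.real 9 (idx j l) = σ.real 8 (idx j l)) :
    Holds v addTerms σ fun τ =>
      (∀ j : Fin n, τ.real 7 j = σ.real 7 j + t * a j) ∧
      (∀ j l : Fin n, τ.real 8 (idx j l) = σ.real 8 (idx j l) + 2 * s * a j * a l) ∧
      ∀ j l : Fin n, τ.real 9 (idx j l) = τ.real 8 (idx j l) := by
  rw [addTerms]
  refine holds_loop (fun k τ =>
    (∀ j : Fin n, τ.real 7 j = if j < k then σ.real 7 j + t * a j else σ.real 7 j) ∧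
    (∀ j l : Fin n, τ.real 8 (idx j l) = if j < k then σ.real 8 (idx j l) + 2 * s * a j * a l
      else σ.real 8 (idx j l)) ∧
    ∀ j l : Fin n, τ.real 9 (idx j l) = τ.real 8 (idx j l)) ?_ ?_ ?_
  · simpa using h89
  · rintro k hk τ hF ⟨h7, h8, h9⟩
    have g0 := congrFun (hF.nat 0 (by decide)) 0
    have g3 := hF.real 3 (by decide)
    have g6 := hF.real 6 (by decide)
    simp [hn] at hk g0
    simp only [Cmd.list, holds_seq, holds_setReal]
    refine holds_loop (fun u ρ =>
      (∀ j l : Fin n, ρ.real 8 (idx j l) = if j < k ∨ ((j : ℕ) = k ∧ l < u) then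
        σ.real 8 (idx j l) + 2 * s * a j * a l else σ.real 8 (idx j l)) ∧
      ∀ j l : Fin n, ρ.real 9 (idx j l) = ρ.real 8 (idx j l)) ?_ ?_ ?_
    · simpa using ⟨h8, h9⟩
    · rintro u hu ρ hG ⟨q8, q9⟩
      have e3 := hG.real 3 (by decide)
      have e6 := hG.real 6 (by decide)
      have e0 := congrFun (hG.nat 6 (by decide)) 0
      simp [g0] at hu
      simp [State.putReal_real_of_ne, g3, g6] at e3 e6 e0
      simp only [holds_seq, holds_setReal]
      constructor
      · intro j l
        have q := q8 j l
        by_cases hjl : (j : ℕ) = k ∧ (l : ℕ) = u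
        · obtain ⟨hj, hl⟩ := hjl
          have hj' := ha j j.2
          have hl' := ha l l.2
          simp [hj, hl] at q hj' hl'
          simp [e0, hj, hl, q, e3, e6, hs, hj', hl']
        · have : ((j : ℕ) < k ∨ (j : ℕ) = k ∧ (l : ℕ) ≤ u) ↔
              ((j : ℕ) < k ∨ (j : ℕ) = k ∧ (l : ℕ) < u) := by omega
          simp [e0, hjl, q, this]
      · intro j l
        have q := q9 j l
        by_cases hjl : (j : ℕ) = k ∧ (l : ℕ) = u
        · simp [e0, hjl.1, hjl.2]
        · simp [e0, hjl, q]
    · rintro ρ hG ⟨q8, q9⟩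
      have e7 := hG.real 7 (by decide)
      simp [g0] at q8
      refine ⟨fun j => ?_, fun j l => ?_, q9⟩
      · rw [e7]
        by_cases hjk : (j : ℕ) = k
        · have q := h7 j
          have hj' := ha j j.2
          simp [hjk] at q hj'
          simp [hjk, q, g3, g6, ht, hj']
        · have : (j : ℕ) < k + 1 ↔ (j : ℕ) < k := by omega
          simp [hjk, h7 j, this]
      · have : (j : ℕ) < k + 1 ↔ (j : ℕ) < k ∨ (j : ℕ) = k := by omega
        simp [q8 j l, this]
  · rintro τ - ⟨h7, h8, h9⟩
    simp [hn] at h7 h8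
    exact ⟨h7, h8, h9⟩

theorem holds_accumulateRow {c : ℝ} {S : Finset (Fin n)} (hn : σ.nat 0 0 = n)
    (hS : S ∈ representatives n)
    (h3 : σ.nat 3 (σ.nat 5 0) = code S) (h4 : σ.nat 4 (σ.nat 5 0) = S.card)
    (h2 : ∀ t ≤ n, σ.nat 2 t = 2 ^ t) (hB : ∀ t ≤ n, σ.real 1 t = n.choose t)
    (hE : ∀ k < n, σ.real 4 (idx 0 k) = emptyProb n c 0 k) (hV : σ.real 5 0 = v ∅)
    (hα : σ.real 5 2 = (v Finset.univ - v ∅) / n)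
    (h89 : ∀ j l : Fin n, σ.real 9 (idx j l) = σ.real 8 (idx j l)) :
    Holds v accumulateRow σ fun τ => τ.queries = Sᶜ :: S :: σ.queries ∧
      (∀ j : Fin n, τ.real 7 j = σ.real 7 j + rhsTerm v c S j) ∧
      (∀ j l : Fin n, τ.real 8 (idx j l) = σ.real 8 (idx j l) + gramTerm c S j l) ∧
      ∀ j l : Fin n, τ.real 9 (idx j l) = τ.real 8 (idx j l) := by
  obtain ⟨z, hz⟩ := exists_row_of_mem_representatives hS
  obtain ⟨hk0, hkn⟩ := z.2
  rw [hz] at hk0 hkn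
  rw [accumulateRow]
  simp only [Cmd.list, holds_seq]
  refine (holds_decode hn h3 h2).with_frame.mono ?_
  rintro τ ⟨hF, h9, hr9, hr10⟩
  have g0 := congrFun (hF.nat 0 (by decide)) 0
  have g4 := hF.nat 4 (by decide)
  have g5 := congrFun (hF.nat 5 (by decide)) 0
  have r1 := hF.real 1 (by decide)
  have r4 := hF.real 4 (by decide)
  have r5 := hF.real 5 (by decide)
  have r7 := hF.real 7 (by decide)
  have r8 := hF.real 8 (by decide)
  have r9 := hF.real 9 (by decide)
  have hq := hF.queries (by decide)
  rw [← g5, ← g4] at h4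
  rw [← r1] at hB
  rw [← r4] at hE
  rw [← r5] at hV hα
  rw [hn] at g0
  rw [← r8, ← r9] at h89
  rw [← r7, ← r8, ← hq]
  refine (holds_weigh g0 hk0.ne' hkn hr9 hr10 h4 hB hE hV hα).with_frame.mono ?_
  rintro ρ ⟨hG, hρq, h34, h35⟩
  have q0 := congrFun (hG.nat 0 (by decide)) 0
  have q4 := hG.nat 4 (by decide)
  have q5 := congrFun (hG.nat 5 (by decide)) 0
  have q9 := hG.nat 9 (by decide)
  have s7 := hG.real 7 (by decide)
  have s8 := hG.real 8 (by decide)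
  have s9 := hG.real 9 (by decide)
  rw [← q5, ← q4] at h4
  rw [← q9] at h9
  rw [g0] at q0
  rw [← s8, ← s9] at h89
  rw [← s7, ← s8, ← hρq]
  refine (holds_center (a := fun j => ρ.nat 9 j - (ρ.nat 4 (ρ.nat 5 0) : ℝ) / n) q0
    fun _ _ => rfl).with_frame.mono ?_
  rintro π ⟨hH, h6⟩
  have t3 := hH.real 3 (by decide)
  have t7 := hH.real 7 (by decide)
  have t8 := hH.real 8 (by decide)
  have t9 := hH.real 9 (by decide)
  have u0 := congrFun (hH.nat 0 (by decide)) 0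
  have uq := hH.queries (by decide)
  rw [← t8, ← t9] at h89
  rw [← t3] at h34 h35
  rw [← t7, ← t8, ← uq]
  have ha : ∀ j : Fin n, (ρ.nat 9 j - (ρ.nat 4 (ρ.nat 5 0) : ℝ) / n) = centered S j := by
    intro j
    rw [h9 j, h4, centered, indicator]
    split_ifs <;> simp
  refine (holds_addTerms (u0.trans q0) h34 h35 h6 h89).with_frame.mono ?_
  rintro χ ⟨hK, k7, k8, k9⟩
  refine ⟨hK.queries (by decide), fun j => ?_, fun j l => ?_, k9⟩
  · rw [k7, ha, rhsTerm]
  · rw [k8, ha, ha, gramTerm]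

/-- The integer array 12 is never written by the program and serves as the indicator of the empty
set. -/
theorem holds_evaluateEnds (hn : σ.nat 0 0 = n) (h12 : ∀ j, σ.nat 12 j = 0) :
    Holds v evaluateEnds σ fun τ => τ.queries = Finset.univ :: ∅ :: σ.queries ∧
      τ.real 5 0 = v ∅ ∧ τ.real 5 2 = (v Finset.univ - v ∅) / n := by
  have h0 : σ.readSet 12 = ∅ := by
    simp [State.readSet, h12]
  rw [evaluateEnds]
  simp only [Cmd.list, holds_seq, holds_query, h0]
  refine holds_loop (fun k τ => τ.queries = ∅ :: σ.queries ∧ τ.real 5 0 = v ∅ ∧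
    ∀ j < k, τ.nat 11 j = 1) (by simp) ?_ ?_
  · rintro k hk τ hF ⟨h1, h2, h3⟩
    rw [holds_setNat]
    refine ⟨h1, h2, fun j hj => ?_⟩
    rcases Nat.lt_succ_iff_lt_or_eq.1 hj with hj | rfl
    · simp [hj.ne, h3 j hj]
    · simp
  · rintro τ hF ⟨h1, h2, h3⟩
    have g0 := congrFun (hF.nat 0 (by decide)) 0
    simp [hn] at h3 g0
    have hu : τ.readSet 11 = Finset.univ := by
      ext j
      simp [State.readSet, h3 j j.2]
    rw [holds_setReal, hu, h1]
    refine ⟨rfl, by simp [h2], by simp [h2, g0]⟩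

theorem holds_accumulate {c : ℝ} {f : ℕ → Finset (Fin n)} (hn : σ.nat 0 0 = n)
    (hf : Stored σ f) (hrep : ∀ r < σ.nat 1 0, f r ∈ representatives n)
    (h2 : ∀ t ≤ n, σ.nat 2 t = 2 ^ t) (hB : ∀ t ≤ n, σ.real 1 t = n.choose t)
    (hE : ∀ k < n, σ.real 4 (idx 0 k) = emptyProb n c 0 k) (h12 : ∀ j, σ.nat 12 j = 0)
    (h7 : ∀ j, σ.real 7 j = 0) (h8 : ∀ j, σ.real 8 j = 0) (h9 : ∀ j, σ.real 9 j = 0) :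
    Holds v accumulate σ fun τ =>
      (τ.queries : Multiset (Finset (Fin n))) = (∑ r ∈ Finset.range (σ.nat 1 0), {f r, (f r)ᶜ}) +
        ((Finset.univ :: ∅ :: σ.queries : List _) : Multiset (Finset (Fin n))) ∧
      τ.queries.length = 2 * σ.nat 1 0 + 2 + σ.queries.length ∧
      τ.real 5 2 = (v Finset.univ - v ∅) / n ∧
      (∀ j : Fin n, τ.real 7 j = ∑ r ∈ Finset.range (σ.nat 1 0), rhsTerm v c (f r) j) ∧
      (∀ j l : Fin n, τ.real 8 (idx j l) = ∑ r ∈ Finset.range (σ.nat 1 0), gramTerm c (f r) j l) ∧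
      ∀ j l : Fin n, τ.real 9 (idx j l) = ∑ r ∈ Finset.range (σ.nat 1 0), gramTerm c (f r) j l := by
  rw [accumulate, holds_seq]
  refine (holds_evaluateEnds hn h12).with_frame.mono ?_
  rintro τ ⟨hF, hq, hV, hα⟩
  have g0 := congrFun (hF.nat 0 (by decide)) 0
  have g1 := congrFun (hF.nat 1 (by decide)) 0
  have g2 := hF.nat 2 (by decide)
  have g3 := hF.nat 3 (by decide)
  have g4 := hF.nat 4 (by decide)
  have r1 := hF.real 1 (by decide)
  have r4 := hF.real 4 (by decide)
  have r7 := hF.real 7 (by decide)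
  have r8 := hF.real 8 (by decide)
  have r9 := hF.real 9 (by decide)
  obtain ⟨hf3, hf4⟩ := hf
  rw [← g0] at hn
  rw [← g1] at hrep
  rw [← g1, ← g3] at hf3
  rw [← g1, ← g4] at hf4
  rw [← g1, ← hq]
  have hlen : τ.queries.length = 2 + σ.queries.length := by rw [hq]; simp; ring
  refine holds_loop (fun k ρ => (ρ.queries : Multiset (Finset (Fin n))) =
        (∑ r ∈ Finset.range k, {f r, (f r)ᶜ}) + (τ.queries : Multiset (Finset (Fin n))) ∧
      ρ.queries.length = 2 * k + 2 + σ.queries.length ∧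
      ρ.real 5 0 = v ∅ ∧ ρ.real 5 2 = (v Finset.univ - v ∅) / n ∧
      (∀ j : Fin n, ρ.real 7 j = ∑ r ∈ Finset.range k, rhsTerm v c (f r) j) ∧
      (∀ j l : Fin n, ρ.real 8 (idx j l) = ∑ r ∈ Finset.range k, gramTerm c (f r) j l) ∧
      ∀ j l : Fin n, ρ.real 9 (idx j l) = ρ.real 8 (idx j l)) ?_ ?_ ?_
  · refine ⟨by simp, by simp [hlen], hV, hα, ?_, ?_, ?_⟩
    · simp [r7, h7]
    · simp [r8, h8]
    · simp [r8, h8, r9, h9]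
  · rintro k hk ρ hG ⟨p1, p2, p3, p4, p5, p6, p7⟩
    have q0 := congrFun (hG.nat 0 (by decide)) 0
    have q1 := congrFun (hG.nat 1 (by decide)) 0
    have q2 := hG.nat 2 (by decide)
    have q3 := hG.nat 3 (by decide)
    have q4 := hG.nat 4 (by decide)
    have s1 := hG.real 1 (by decide)
    have s4 := hG.real 4 (by decide)
    simp at hk
    refine (holds_accumulateRow (c := c) (S := f k) ?_ (hrep k hk) ?_ ?_ ?_ ?_ ?_ ?_ ?_
      ?_).with_frame.mono ?_
    · simp [q0, hn]
    · simp [q3, hf3 k hk]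
    · simp [q4, hf4 k hk]
    · simpa [State.putNat_nat_of_ne, q2, g2] using h2
    · simpa [s1, r1] using hB
    · simpa [s4, r4] using hE
    · simpa using p3
    · simpa using p4
    · simpa using p7
    · rintro χ ⟨hH, x1, x2, x3, x4⟩
      have y5 := hH.real 5 (by decide)
      simp only [State.tick_real, State.putNat_real, State.tick_queries, State.putNat_queries]
        at y5 x1 x2 x3
      refine ⟨?_, ?_, ?_, ?_, ?_, ?_, x4⟩
      · rw [x1, Finset.sum_range_succ, add_right_comm, ← p1, ← Multiset.cons_coe,
          ← Multiset.cons_coe, add_comm, Multiset.insert_eq_cons, Multiset.cons_add,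
          Multiset.singleton_add, Multiset.cons_swap]
      · rw [x1]; simp [p2]; ring
      · rw [y5, p3]
      · rw [y5, p4]
      · intro j; rw [x2, p5, Finset.sum_range_succ]
      · intro j l; rw [x3, p6, Finset.sum_range_succ]
  · rintro ρ - ⟨p1, p2, p3, p4, p5, p6, p7⟩
    simp at p1 p2 p5 p6
    exact ⟨p1, p2, p4, p5, p6, fun j l => by rw [p7, p6]⟩

end Accumulation

/-! ### Sums over representatives and over rows -/

section Representatives

variable {n : ℕ}

theorem sum_sampledRows_image {E : Type} [AddCommMonoid E] {T : Finset (Finset (Fin n))}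
    (hT : T ⊆ representatives n) (F : Row n → E) :
    ∑ z ∈ sampledRows (T.image pairOf), F z = ∑ S ∈ T, ∑ z ∈ pairOf S, F z := by
  rw [sum_sampledRows, Finset.sum_image (injOn_pairOf.mono (by exact_mod_cast hT))]
  intro B hB
  obtain ⟨S, hS, rfl⟩ := Finset.mem_image.1 hB
  exact pairOf_mem_pairs (hT hS)

theorem gram_image (hn : 1 ≤ n) (c : ℝ) {T : Finset (Finset (Fin n))}
    (hT : T ⊆ representatives n) (j l : Fin n) :
    gram c (T.image pairOf) j l = ∑ S ∈ T, gramTerm c S j l := by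
  rw [gram, sum_sampledRows_image hT, Matrix.sum_apply]
  refine Finset.sum_congr rfl fun S hS => ?_
  obtain ⟨z, rfl⟩ := exists_row_of_mem_representatives (hT hS)
  rw [pairOf_row, sum_pair, rowWeight_compl]
  simp only [Matrix.add_apply, Matrix.smul_apply, Matrix.vecMulVec_apply, smul_eq_mul, Row.compl,
    centered_compl hn, gramTerm, sampleWeight, rowWeight]
  ring

theorem gramRhs_image (hn : 1 ≤ n) (v : Finset (Fin n) → ℝ) (c : ℝ) {T : Finset (Finset (Fin n))}
    (hT : T ⊆ representatives n) (j : Fin n) :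
    gramRhs v c (T.image pairOf) j = ∑ S ∈ T, rhsTerm v c S j := by
  rw [gramRhs, sum_sampledRows_image hT, Finset.sum_apply]
  refine Finset.sum_congr rfl fun S hS => ?_
  obtain ⟨z, rfl⟩ := exists_row_of_mem_representatives (hT hS)
  rw [pairOf_row, sum_pair, rowWeight_compl]
  simp only [Pi.add_apply, Pi.smul_apply, smul_eq_mul, target, rhsTerm, sampleWeight, rowWeight]
  simp only [Row.compl, centered_compl hn, Finset.card_compl, Fintype.card_fin]
  rw [Nat.cast_sub z.2.2.le]
  ring

theorem posSemidef_gram (c : ℝ) (T : Finset (Finset (Row n))) : (gram c T).PosSemidef := by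
  refine Matrix.posSemidef_sum _ fun z _ => Matrix.PosSemidef.smul ?_ (rowWeight_nonneg c z)
  simpa using Matrix.posSemidef_vecMulVec_self_star (centered z.1)

/-- Sampled pairs are disjoint, and ∅ and [n] are distinct and are not rows; so the identity holds
with multiplicities, and no set is evaluated twice. -/
theorem evaluatedSets_image {T : Finset (Finset (Fin n))} (hn : 1 ≤ n)
    (hT : T ⊆ representatives n) : (evaluatedSets (T.image pairOf)).val =
      (∑ S ∈ T, {S, Sᶜ}) + ((Finset.univ :: ∅ :: [] : List (Finset (Fin n))) : Multiset (Finset (Fin n))) := by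
  have h1 : (sampledRows (T.image pairOf)).image Subtype.val =
      (sampledRows (T.image pairOf)).map (Function.Embedding.subtype _) := by
    rw [Finset.map_eq_image]; rfl
  have h2 : ((sampledRows (T.image pairOf)).image Subtype.val).val =
      ∑ S ∈ T, ({S, Sᶜ} : Multiset (Finset (Fin n))) := by
    rw [← Finset.sum_multiset_singleton, h1, Finset.sum_map, sum_sampledRows_image hT]
    refine Finset.sum_congr rfl fun S hS => ?_
    obtain ⟨z, rfl⟩ := exists_row_of_mem_representatives (hT hS)
    rw [pairOf_row, sum_pair]
    rfl
  have h3 : (Finset.univ : Finset (Fin n)) ∉ (sampledRows (T.image pairOf)).image Subtype.val := by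
    intro h
    obtain ⟨z, -, hz⟩ := Finset.mem_image.1 h
    have := z.2.2
    rw [hz] at this
    simp at this
  have h4 : (∅ : Finset (Fin n)) ∉
      insert Finset.univ ((sampledRows (T.image pairOf)).image Subtype.val) := by
    rw [Finset.mem_insert, not_or]
    refine ⟨fun h => ?_, fun h => ?_⟩
    · have := congrArg Finset.card h
      simp at this
      omega
    · obtain ⟨z, -, hz⟩ := Finset.mem_image.1 h
      have := z.2.1
      rw [hz] at this
      simp at this
  rw [evaluatedSets, Finset.insert_val_of_notMem h4, Finset.insert_val_of_notMem h3, h2,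
    ← Multiset.cons_coe, ← Multiset.cons_coe, Multiset.add_cons, Multiset.add_cons,
    Multiset.cons_swap, Multiset.coe_nil, add_zero]

theorem sum_of_val_eq_map {α E : Type} [AddCommMonoid E] {T : Finset α} {f : ℕ → α} {N : ℕ}
    (h : T.val = (Multiset.range N).map f) (φ : α → E) :
    ∑ r ∈ Finset.range N, φ (f r) = ∑ S ∈ T, φ S := by
  rw [Finset.sum_eq_multiset_sum, Finset.sum_eq_multiset_sum, h, Multiset.map_map]
  rfl

theorem sum_levelProb_representatives (c : ℝ) :
    ∑ S ∈ representatives n, 2 * (levelProb n c S.card : ℝ) =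
      ∑ s ∈ Finset.Ico 1 n, n.choose s * (levelProb n c s : ℝ) := by
  rw [← sum_row_card fun s => (levelProb n c s : ℝ), ← sampledRows_pairs, pairs_eq_image,
    sum_sampledRows_image subset_rfl]
  refine Finset.sum_congr rfl fun S hS => ?_
  obtain ⟨z, rfl⟩ := exists_row_of_mem_representatives hS
  rw [pairOf_row, sum_pair, levelProb_card_compl, two_mul]

end Representatives

/-! ### Expected number of evaluations -/

section Expectation

variable {α β : Type}

theorem expect_map (μ : PMF α) (f : α → β) (g : β → ℝ≥0∞) :
    expect (μ.map f) g = expect μ fun a => g (f a) := by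
  classical
  simp only [expect, PMF.map_apply, ← ENNReal.tsum_mul_right]
  rw [ENNReal.tsum_comm]
  refine tsum_congr fun a => ?_
  rw [tsum_eq_single (f a)]
  · rw [if_pos rfl]
  · intro b hb
    rw [if_neg hb, zero_mul]

theorem expect_mono_support {μ : PMF α} {f g : α → ℝ≥0∞} (h : ∀ a ∈ μ.support, f a ≤ g a) :
    expect μ f ≤ expect μ g := by
  refine ENNReal.tsum_le_tsum fun a => ?_
  by_cases ha : μ a = 0
  · rw [ha, zero_mul, zero_mul]
  · gcongr
    exact h a ((PMF.mem_support_iff _ _).2 ha)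

theorem expect_affine (μ : PMF α) (f : α → ℝ≥0∞) (a b : ℝ≥0∞) :
    expect μ (fun x => a * f x + b) = a * expect μ f + b := by
  simp only [expect, mul_add]
  rw [ENNReal.tsum_add, ENNReal.tsum_mul_right, PMF.tsum_coe, one_mul, ← ENNReal.tsum_mul_left]
  congr 1
  exact tsum_congr fun x => by ring

/-- The expected number of evaluated sets. -/
theorem expect_levelLaw_card {n m : ℕ} {c : ℝ} (hn : 1 ≤ n) (hm : 2 ≤ m)
    (hc : IsOversampling n m c) :
    expect (levelLaw n c (n - 1)) (fun T => ((2 * T.card + 2 : ℕ) : ℝ≥0∞)) = (m : ℝ≥0∞) := by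
  have h1 : ∑ s ∈ Finset.Ico 1 n, n.choose s * (levelProb n c s : ℝ) = m - 2 := by
    rw [hc]
    -- For `n = 1` the sums are empty and `c` may be negative; otherwise `c ≥ 0`, and the truncation
    -- in `levelProb` is harmless.
    rcases hn.eq_or_lt with rfl | hn2
    · simp
    · refine Finset.sum_congr rfl fun s _ => ?_
      rw [coe_levelProb (hc.nonneg hn2 hm), mul_comm]
  have h2 : ∀ T : Finset (Finset (Fin n)), ((2 * T.card + 2 : ℕ) : ℝ≥0∞) =
      (((2 * T.card + 2 : ℕ) : ℝ≥0) : ℝ≥0∞) := fun T => by simp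
  simp only [h2]
  rw [levelLaw_last, expect_bernoulliSubset]
  have h3 : (fun T : Finset (Finset (Fin n)) => (((2 * T.card + 2 : ℕ) : ℝ≥0) : ℝ)) =
      fun T => (∑ S ∈ T, (2 : ℝ)) + 2 := by
    funext T
    simp
    ring
  rw [h3, bernoulliMean_add, bernoulliMean_const, bernoulliMean_sum_mem]
  have h4 := sum_levelProb_representatives (n := n) c
  simp only [mul_comm (2 : ℝ)] at h4
  rw [h4, h1, sub_add_cancel, ENNReal.ofReal_natCast]

end Expectation

/-! ### Correctness and running time of the whole program -/

section Assembly

variable {n : ℕ} {v : Finset (Fin n) → ℝ} {σ : State n}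

theorem subsetProb_congr {c c' : ℝ}
    (h : ∀ s ∈ Finset.Ico 1 n, levelProb n c s = levelProb n c' s) {k : ℕ} (hk : k < n) :
    subsetProb n c k = subsetProb n c' k := by
  rw [subsetProb, subsetProb]
  split_ifs with h0
  · rfl
  · exact h k (Finset.mem_Ico.2 ⟨by omega, hk⟩)

/-- The program uses the parameter it computes; this transfers its table to any other admissible
one. -/
theorem emptyProb_congr {c c' : ℝ}
    (h : ∀ s ∈ Finset.Ico 1 n, levelProb n c s = levelProb n c' s) (a : ℕ) {k : ℕ}
    (hk : a + k < n) : emptyProb n c a k = emptyProb n c' a k := by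
  induction a generalizing k with
  | zero => rw [emptyProb, emptyProb, subsetProb_congr h (by omega)]
  | succ a ih => rw [emptyProb, emptyProb, ih (by omega), ih (by omega)]

/-- Compute all tables. -/
def setup : Cmd := .list [tables, budget, level, emptyTable]

/-- The Leverage SHAP program. -/
def leverageShap : Cmd := .list [setup, sampling, accumulate, solver]

/-- The memory after the computation of the tables. -/
structure Ready (n : ℕ) (c : ℝ) (σ : State n) : Prop where
  dim : σ.nat 0 0 = n
  pow : ∀ t ≤ n, σ.nat 2 t = 2 ^ t
  choose : ∀ t ≤ n, σ.real 1 t = n.choose t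
  emptyProb_eq : ∀ a k, a + k < n → σ.real 4 (idx a k) = emptyProb n c a k
  nat_eq_zero : ∀ a ∈ [1, 3, 4, 12], ∀ j, σ.nat a j = 0
  real_eq_zero : ∀ a ∈ [0, 7, 8, 9], ∀ j, σ.real a j = 0
  queries_eq : σ.queries = []

theorem holds_setup {m : ℕ} {c : ℝ} (hn : 1 ≤ n) (hm : 2 ≤ m)
    (hc : IsOversampling n (min m (2 ^ n)) c) :
    Holds v setup (State.init n m) (Ready n c) := by
  rw [setup]
  simp only [Cmd.list, holds_seq]
  refine (holds_tables (by simp [State.init])).with_frame.mono ?_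
  rintro τ ⟨hF, h2, h1⟩
  have a0 := hF.nat 0 (by decide)
  refine (holds_budget (m := m) (by simp [a0, State.init]) (by simp [a0, State.init])
    (h2 n le_rfl)).with_frame.mono ?_
  rintro ρ ⟨hG, h31⟩
  have b0 := hG.nat 0 (by decide)
  have b2 := hG.nat 2 (by decide)
  have c1 := hG.real 1 (by decide)
  have d2 : ρ.real 2 0 = 0 := by
    rw [hG.real 2 (by decide), hF.real 2 (by decide)]; rfl
  rw [← c1] at h1
  refine (holds_level hn (by rw [b0, a0]; simp [State.init]) h1 h31 d2).with_frame.mono ?_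
  rintro π ⟨hH, hlev⟩
  have e0 := hH.nat 0 (by decide)
  have e1 := hH.real 1 (by decide)
  rw [← e1] at h1
  refine (holds_emptyTable hn (by rw [e0, b0, a0]; simp [State.init]) h1 rfl
    hlev.1).with_frame.mono ?_
  rintro χ ⟨hK, hE⟩
  have hover := hlev.isOversampling hn (le_min hm (by
    calc 2 = 2 ^ 1 := rfl
      _ ≤ 2 ^ n := Nat.pow_le_pow_right (by norm_num) hn)) (min_le_right _ _)
  refine ⟨?_, ?_, ?_, ?_, ?_, ?_, ?_⟩
  · rw [hK.nat 0 (by decide), e0, b0, a0]; simp [State.init]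
  · rw [hK.nat 2 (by decide), hH.nat 2 (by decide), b2]; exact h2
  · rw [hK.real 1 (by decide)]; exact h1
  · intro a k hak
    rw [hE a k hak]
    exact emptyProb_congr (fun s hs => hover.levelProb_eq hc hs) a hak
  · intro a ha j
    have h : a ∉ tables.natWrites ∧ a ∉ budget.natWrites ∧ a ∉ level.natWrites ∧
        a ∉ emptyTable.natWrites ∧ a ≠ 0 := by
      revert a; decide
    rw [hK.nat a h.2.2.2.1, hH.nat a h.2.2.1, hG.nat a h.2.1, hF.nat a h.1]
    simp [State.init, h.2.2.2.2]
  · intro a ha j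
    have h : a ∉ tables.realWrites ∧ a ∉ budget.realWrites ∧ a ∉ level.realWrites ∧
        a ∉ emptyTable.realWrites := by
      revert a; decide
    rw [hK.real a h.2.2.2, hH.real a h.2.2.1, hG.real a h.2.1, hF.real a h.1]
    rfl
  · rw [hK.queries (by decide), hH.queries (by decide), hG.queries (by decide),
      hF.queries (by decide)]
    rfl

/-- The result of a run in which the representatives `T` have been sampled. -/
structure Finished (v : Finset (Fin n) → ℝ) (c : ℝ) (T : Finset (Finset (Fin n)))
    (σ : State n) : Prop where
  queries_eq : (σ.queries : Multiset (Finset (Fin n))) = (evaluatedSets (T.image pairOf)).val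
  length_eq : σ.queries.length = 2 * T.card + 2
  card_eq : σ.nat 1 0 = T.card
  output_eq : σ.output = estimate v c (T.image pairOf)

theorem couple_leverageShap {m : ℕ} {c : ℝ} (hn : 1 ≤ n) (hm : 2 ≤ m)
    (hc : IsOversampling n (min m (2 ^ n)) c) :
    Couple (levelLaw n c (n - 1)) (leverageShap.law v m) (Finished v c) := by
  -- The setup is coupled to a one-point law, the sampling to the random set, and the remaining
  -- stages to the identity.
  rw [Cmd.law, leverageShap, ← PMF.pure_bind () fun _ => levelLaw n c (n - 1)]
  refine couple_seq (Holds.couple (Q := fun _ => Ready n c) (holds_setup hn hm hc)) ?_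
  rintro - σ hR
  rw [← PMF.bind_pure (levelLaw n c (n - 1))]
  refine couple_seq ((couple_run_frame (couple_sampling hn hR.dim (hR.nat_eq_zero 3 (by decide) 0)
    (hR.nat_eq_zero 4 (by decide) 0) hR.pow hR.emptyProb_eq)).and_left
      fun T hT => subset_of_mem_support_levelLaw hT) ?_
  rintro T τ ⟨⟨hF, f, hf, hfT⟩, hT⟩
  refine Holds.couple ?_
  rw [Cmd.list, holds_seq]
  have hcard : τ.nat 1 0 = T.card := by
    rw [Finset.card_def, hfT]; simp
  refine (holds_accumulate (c := c) (f := f) ?_ hf ?_ ?_ ?_ ?_ ?_ ?_ ?_ ?_).with_frame.mono ?_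
  · rw [hF.nat 0 (by decide), hR.dim]
  · intro r hr
    refine hT ?_
    rw [← Finset.mem_val, hfT]
    exact Multiset.mem_map_of_mem _ (Multiset.mem_range.2 hr)
  · rw [hF.nat 2 (by decide)]; exact hR.pow
  · rw [hF.real 1 (by decide)]; exact hR.choose
  · rw [hF.real 4 (by decide)]; exact fun k hk => hR.emptyProb_eq 0 k (by omega)
  · rw [hF.nat 12 (by decide)]; exact hR.nat_eq_zero 12 (by decide)
  · rw [hF.real 7 (by decide)]; exact hR.real_eq_zero 7 (by decide)
  · rw [hF.real 8 (by decide)]; exact hR.real_eq_zero 8 (by decide)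
  · rw [hF.real 9 (by decide)]; exact hR.real_eq_zero 9 (by decide)
  rintro ρ ⟨hG, q1, q2, q3, q4, q5, q6⟩
  have hq : τ.queries = [] := by rw [hF.queries (by decide), hR.queries_eq]
  rw [hq] at q1 q2
  rw [sum_of_val_eq_map hfT fun S => ({S, Sᶜ} : Multiset _)] at q1
  have q4' : ∀ j : Fin n, ρ.real 7 j = gramRhs v c (T.image pairOf) j := fun j => by
    rw [q4, sum_of_val_eq_map hfT fun S => rhsTerm v c S j, gramRhs_image hn v c hT]
  have hG' : ∀ j l : Fin n, ∑ r ∈ Finset.range (τ.nat 1 0), gramTerm c (f r) j l =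
      gram c (T.image pairOf) j l := fun j l => by
    rw [sum_of_val_eq_map hfT fun S => gramTerm c S j l, gram_image hn c hT]
  simp only [hG'] at q5 q6
  obtain ⟨x, -, hx, -⟩ := exists_estimate_eq v c (T.image pairOf)
  refine (holds_solver ?_ (posSemidef_gram c _) hx.symm q5 q6 q4' ?_).with_frame.mono ?_
  · rw [hG.nat 0 (by decide), hF.nat 0 (by decide), hR.dim]
  · intro j
    rw [hG.real 0 (by decide), hF.real 0 (by decide), hR.real_eq_zero 0 (by decide)]
  rintro χ ⟨hH, x, hx, ⟨y, hy⟩, hout⟩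
  refine ⟨?_, ?_, ?_, ?_⟩
  · rw [hH.queries (by decide), q1, evaluatedSets_image hn hT]
  · rw [hH.queries (by decide), q2, hcard]; rfl
  · rw [hH.nat 1 (by decide), hG.nat 1 (by decide), hcard]
  · funext i
    rw [estimate_eq hx hy, State.output, hout, q3]

/-- Every kept node has a sampled set below it, so rows never disappear and the final number of rows
bounds the length of every pass. -/
theorem holds_splitRow_count :
    Holds v splitRow σ fun τ => σ.nat 1 0 ≤ τ.nat 1 0 := by
  rw [splitRow]
  simp only [Cmd.list, holds_seq]
  refine holds_coin fun x _ => ?_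
  simp only [holds_ite, holds_seq, holds_skip, holds_setNat]
  refine ⟨fun _ => holds_coin fun y _ => ?_, fun _ => by simp⟩
  exact ⟨fun _ => by simp, fun _ => by simp⟩

/-- The generic bound does not apply, as the inner loop runs over the rows; the invariant charges
every earlier pass with the current number of rows. -/
theorem holds_sampling_time (hn1 : 1 ≤ n) (hn : σ.nat 0 0 = n) :
    Holds v sampling σ fun τ =>
      τ.time ≤ σ.time + (splitRow.textSize + 100) * (n * (τ.nat 1 0 + 1)) := by
  rw [sampling]
  simp only [Cmd.list, holds_seq]
  refine holds_coin fun x _ => ?_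
  refine holds_loop (fun i τ => τ.time ≤ σ.time + 50 +
    i * ((splitRow.textSize + 10) * (τ.nat 1 0 + 1))) ?_ ?_ ?_
  · simp [NExp.size, RExp.size, NExp.ix]
  · intro i hi τ hF hτ
    have g0 := congrFun (hF.nat 0 (by decide)) 0
    simp [hn] at g0
    refine holds_loop (fun k ρ => ρ.time ≤ τ.time + 5 + k * (splitRow.textSize + 1) ∧
      τ.nat 1 0 ≤ ρ.nat 1 0) ?_ ?_ ?_
    · simp [NExp.size]
    · rintro k hk ρ hG ⟨h1, h2⟩
      have q0 := congrFun (hG.nat 0 (by decide)) 0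
      simp [g0] at q0
      refine ((holds_time_le (N := n) (by decide) hn1 (by simp [q0])).and
        holds_splitRow_count).mono ?_
      rintro χ ⟨h3, h4⟩
      have hd : splitRow.depth = 0 := by decide
      rw [hd, pow_zero, mul_one] at h3
      simp at h3 h4
      rw [add_mul k 1]
      exact ⟨by omega, by omega⟩
    · rintro ρ hG ⟨h1, h2⟩
      simp at h1
      have e1 : τ.nat 1 0 * (splitRow.textSize + 1) ≤ ρ.nat 1 0 * (splitRow.textSize + 1) :=
        Nat.mul_le_mul_right _ h2
      have e2 : i * ((splitRow.textSize + 10) * (τ.nat 1 0 + 1)) ≤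
          i * ((splitRow.textSize + 10) * (ρ.nat 1 0 + 1)) := by gcongr
      nlinarith
  · intro τ _ hτ
    simp [hn] at hτ
    have e1 : (n - 1) * ((splitRow.textSize + 10) * (τ.nat 1 0 + 1)) ≤
        n * ((splitRow.textSize + 10) * (τ.nat 1 0 + 1)) := Nat.mul_le_mul_right _ (by omega)
    have e2 : 1 ≤ n * (τ.nat 1 0 + 1) := Nat.mul_pos hn1 (by omega)
    nlinarith

theorem holds_accumulate_time (hn1 : 1 ≤ n) (hn : σ.nat 0 0 = n) :
    Holds v accumulate σ fun τ => τ.time ≤ σ.time + (evaluateEnds.textSize + 10) * n +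
      τ.nat 1 0 * (accumulateRow.textSize * n ^ 2 + 1) := by
  rw [accumulate, holds_seq]
  refine (holds_time_le (N := n) (by decide) hn1 hn).with_frame.mono ?_
  rintro τ ⟨hF, hτ⟩
  have hd : evaluateEnds.depth = 1 := by decide
  rw [hd, pow_one] at hτ
  have g0 := congrFun (hF.nat 0 (by decide)) 0
  refine holds_loop (fun k ρ => ρ.time ≤ τ.time + 5 +
    k * (accumulateRow.textSize * n ^ 2 + 1)) ?_ ?_ ?_
  · simp [NExp.size]
  · intro k hk ρ hG hρ
    have q0 := congrFun (hG.nat 0 (by decide)) 0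
    refine (holds_time_le (N := n) (by decide) hn1 (by simp [q0, g0, hn])).mono ?_
    intro χ h
    have hd : accumulateRow.depth = 2 := by decide
    rw [hd] at h
    simp at h
    rw [add_mul k 1]
    omega
  · intro ρ hG hρ
    have q1 := congrFun (hG.nat 1 (by decide)) 0
    simp at hρ
    rw [q1]
    nlinarith

/-- The constant in the bound for the running time. -/
def timeFactor : ℕ := setup.textSize + splitRow.textSize + evaluateEnds.textSize +
  accumulateRow.textSize + solver.textSize + 200

/-- With `R` the final number of rows the stages take orders `n²`, `n (R + 1)`, `n + R n²` and `n³`,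
and `2 R + 2` is the number of evaluations. -/
theorem holds_leverageShap_time {m : ℕ} (hn : 1 ≤ n) :
    Holds v leverageShap (State.init n m) fun τ =>
      τ.time ≤ timeFactor * ((2 * τ.nat 1 0 + 2 + n) * n ^ 2) := by
  have hi : (State.init n m).nat 0 0 = n := by simp [State.init]
  rw [leverageShap]
  simp only [Cmd.list, holds_seq]
  refine (holds_time_le (N := n) (by decide) hn hi).with_frame.mono ?_
  rintro τ ⟨hF, h1⟩
  have a0 := congrFun (hF.nat 0 (by decide)) 0
  refine (holds_sampling_time hn (a0.trans hi)).with_frame.mono ?_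
  rintro ρ ⟨hG, h2⟩
  have b0 := congrFun (hG.nat 0 (by decide)) 0
  refine (holds_accumulate_time hn (b0.trans (a0.trans hi))).with_frame.mono ?_
  rintro π ⟨hH, h3⟩
  have c0 := congrFun (hH.nat 0 (by decide)) 0
  have c1 := congrFun (hH.nat 1 (by decide)) 0
  refine (holds_time_le (N := n) (by decide) hn (c0.trans (b0.trans (a0.trans hi)))).with_frame.mono
    ?_
  rintro χ ⟨hK, h4⟩
  have d1 := congrFun (hK.nat 1 (by decide)) 0
  have hd1 : setup.depth = 2 := by decide
  have hd2 : solver.depth = 3 := by decide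
  have ht : (State.init n m).time = 0 := rfl
  rw [hd1, ht] at h1
  rw [hd2] at h4
  rw [d1, c1] 
  rw [c1] at h3
  set R := ρ.nat 1 0
  have hX : n ≤ (2 * R + 2 + n) * n ^ 2 := by nlinarith
  have k1 : n ^ 2 ≤ (2 * R + 2 + n) * n ^ 2 := Nat.le_mul_of_pos_left _ (by omega)
  have k2 : n * (R + 1) ≤ (2 * R + 2 + n) * n ^ 2 := by
    rw [mul_comm]
    exact Nat.mul_le_mul (by omega) (Nat.le_self_pow (by norm_num) n)
  have k3 : R * n ^ 2 ≤ (2 * R + 2 + n) * n ^ 2 := Nat.mul_le_mul_right _ (by omega)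
  have k4 : n ^ 3 ≤ (2 * R + 2 + n) * n ^ 2 := by
    rw [pow_succ, mul_comm]
    exact Nat.mul_le_mul_right _ (by omega)
  have k5 : R ≤ (2 * R + 2 + n) * n ^ 2 :=
    (Nat.le_mul_of_pos_right R (by positivity)).trans k3
  set X := (2 * R + 2 + n) * n ^ 2
  have l1 := Nat.mul_le_mul_left setup.textSize k1
  have l2 := Nat.mul_le_mul_left (splitRow.textSize + 100) k2
  have l3 := Nat.mul_le_mul_left (evaluateEnds.textSize + 10) hX
  have l4 := Nat.mul_le_mul_left accumulateRow.textSize k3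
  have l5 := Nat.mul_le_mul_left solver.textSize k4
  have l6 : R * (accumulateRow.textSize * n ^ 2 + 1) =
      accumulateRow.textSize * (R * n ^ 2) + R := by ring
  rw [l6] at h3
  calc χ.time ≤ setup.textSize * X + (splitRow.textSize + 100) * X +
        (evaluateEnds.textSize + 10) * X + (accumulateRow.textSize * X + X) +
        solver.textSize * X := by omega
    _ ≤ timeFactor * X := by rw [timeFactor]; nlinarith

end Assembly

end LeverageShap

end


/-! ### The main theorem -/

theorem theorem1 :
    ∃ (prog : LeverageShap.Cmd) (K : ℕ) (C : ℝ), 0 < C ∧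
      ∀ (n : ℕ), 1 ≤ n → ∀ (v : Finset (Fin n) → ℝ) (m : ℕ), n ≤ m → 2 ≤ m →
        -- the oversampling parameter exists
        (∃ c : ℝ, LeverageShap.IsOversampling n (min m (2 ^ n)) c) ∧
        -- the program executes Leverage SHAP: joint law of the evaluations and of the output
        (∀ c : ℝ, LeverageShap.IsOversampling n (min m (2 ^ n)) c →
          (prog.law v m).map (fun σ => ((σ.queries : Multiset (Finset (Fin n))), σ.output)) =
            (LeverageShap.sampleLaw n c).map
              (fun T => ((LeverageShap.evaluatedSets T).val, LeverageShap.estimate v c T))) ∧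
        -- expected number of evaluations
        LeverageShap.expect (prog.law v m) (fun σ => (σ.queries.length : ENNReal)) =
          ((min m (2 ^ n) : ℕ) : ENNReal) ∧
        -- running time, on every run and in expectation
        (∀ σ ∈ (prog.law v m).support, σ.time ≤ K * ((σ.queries.length + n) * n ^ 2)) ∧
        LeverageShap.expect (prog.law v m) (fun σ => (σ.time : ENNReal)) ≤
          ((K * (min m (2 ^ n) * n ^ 2) : ℕ) : ENNReal) ∧
        -- the estimate always satisfies the constraint
        (∀ σ ∈ (prog.law v m).support,
          ∑ i, σ.output i = v Finset.univ - v ∅) ∧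
        -- accuracy
        (∀ ε δ : ℝ, 0 < ε → 0 < δ → δ < 1 →
          C * (n * Real.log (n / δ) + n / (ε * δ)) ≤ m →
          ENNReal.ofReal (1 - δ) ≤ (prog.law v m).toOuterMeasure
            {σ | LeverageShap.objective v σ.output ≤
              (1 + ε) * LeverageShap.objective v (LeverageShap.shapley v)}) := by
  -- The factor 2 is for the expected time: since `n ≤ min m (2 ^ n)`, the term `n * n ^ 2` is
  -- absorbed by a second copy of the main term.
  refine ⟨LeverageShap.leverageShap, 2 * LeverageShap.timeFactor, 256, by norm_num, ?_⟩
  intro n hn v m hnm hm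
  obtain ⟨c, hc⟩ := LeverageShap.exists_isOversampling hn hm
  have h2 : 2 ≤ min m (2 ^ n) := le_min hm
    (by calc 2 = 2 ^ 1 := rfl
          _ ≤ 2 ^ n := Nat.pow_le_pow_right (by norm_num) hn)
  have hnm0 : n ≤ min m (2 ^ n) := le_min hnm (Nat.lt_two_pow_self).le
  have hcouple := LeverageShap.couple_leverageShap (v := v) hn hm hc
  have hlen : LeverageShap.expect (LeverageShap.leverageShap.law v m)
      (fun σ => (σ.queries.length : ENNReal)) = ((min m (2 ^ n) : ℕ) : ENNReal) := by
    rw [← LeverageShap.expect_levelLaw_card hn h2 hc,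
      ← LeverageShap.expect_map _ (fun σ : LeverageShap.State n => σ.queries.length)
        (fun k => (k : ENNReal)),
      ← LeverageShap.expect_map _ (fun T : Finset (Finset (Fin n)) => 2 * T.card + 2)
        (fun k => (k : ENNReal))]
    rw [hcouple.map_eq fun T σ h => h.length_eq.symm]
  have htime : ∀ σ ∈ (LeverageShap.leverageShap.law v m).support,
      σ.time ≤ LeverageShap.timeFactor * ((σ.queries.length + n) * n ^ 2) := by
    intro σ hσ
    obtain ⟨T, -, hT⟩ := hcouple.exists_of_mem_support hσ
    have := LeverageShap.holds_leverageShap_time (v := v) (m := m) hn σ hσ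
    simp only at this
    rwa [hT.card_eq, ← hT.length_eq] at this
  have hlaw : ∀ c : ℝ, LeverageShap.IsOversampling n (min m (2 ^ n)) c →
      (LeverageShap.leverageShap.law v m).map
        (fun σ => ((σ.queries : Multiset (Finset (Fin n))), σ.output)) =
      (LeverageShap.sampleLaw n c).map
        (fun T => ((LeverageShap.evaluatedSets T).val, LeverageShap.estimate v c T)) := by
    intro c hc
    rw [LeverageShap.sampleLaw_eq_map, PMF.map_comp]
    exact ((LeverageShap.couple_leverageShap (v := v) hn hm hc).map_eq fun T σ h =>
      (Prod.ext h.queries_eq h.output_eq).symm).symm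
  refine ⟨⟨c, hc⟩, hlaw, hlen, ?_, ?_, ?_, ?_⟩
  · intro σ hσ
    refine (htime σ hσ).trans ?_
    rw [mul_assoc]
    omega
  · set K := LeverageShap.timeFactor
    calc LeverageShap.expect (LeverageShap.leverageShap.law v m) (fun σ => (σ.time : ENNReal))
        ≤ LeverageShap.expect (LeverageShap.leverageShap.law v m) (fun σ =>
          ((K * n ^ 2 : ℕ) : ENNReal) * (σ.queries.length : ENNReal) +
            ((K * n * n ^ 2 : ℕ) : ENNReal)) := by
          refine LeverageShap.expect_mono_support fun σ hσ => ?_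
          have h := htime σ hσ
          have h' : σ.time ≤ K * n ^ 2 * σ.queries.length + K * n * n ^ 2 := by
            calc _ ≤ _ := h
              _ = _ := by ring
          exact_mod_cast h'
      _ = ((K * n ^ 2 : ℕ) : ENNReal) * ((min m (2 ^ n) : ℕ) : ENNReal) +
            ((K * n * n ^ 2 : ℕ) : ENNReal) := by
          rw [LeverageShap.expect_affine, hlen]
      _ = ((K * n ^ 2 * min m (2 ^ n) + K * n * n ^ 2 : ℕ) : ENNReal) := by
          rw [Nat.cast_add, Nat.cast_mul (K * n ^ 2)]
      _ ≤ ((2 * K * (min m (2 ^ n) * n ^ 2) : ℕ) : ENNReal) := by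
          refine Nat.cast_le.2 ?_
          have : K * n * n ^ 2 ≤ K * min m (2 ^ n) * n ^ 2 := by gcongr
          nlinarith
  · intro σ hσ
    obtain ⟨T, -, hT⟩ := hcouple.exists_of_mem_support hσ
    rw [hT.output_eq]
    exact LeverageShap.sum_estimate hn v c _
  · intro ε δ hε hδ hδ1 hC
    -- The program does not know `c'`, but its law agrees with the one prescribed by every
    -- admissible parameter.
    obtain ⟨c', hc', hacc⟩ := LeverageShap.exists_accurate hn v hm hε hδ hδ1 hC
    refine hacc.trans (le_of_eq ?_)
    have h := congrArg (fun μ : PMF (Multiset (Finset (Fin n)) × (Fin n → ℝ)) =>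
      μ.toOuterMeasure {x | LeverageShap.objective v x.2 ≤
        (1 + ε) * LeverageShap.objective v (LeverageShap.shapley v)}) (hlaw c' hc')
    simp only [PMF.toOuterMeasure_map_apply] at h
    exact h.symm
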